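/- Let $k,n$ be integers with $2\le k\le n-2$, and put $d=(k-1)(n-k-1)$. **Noncrossing complex.** A $k$-element subset $J=\{j_1<\cdots<j_k\}$ of $[n]=\{1,\dots,n\}$ is *frozen* if it is an interval for the cyclic order $(1,2,\dots,n)$, and *nonfrozen* otherwise. Sets $A,B\subseteq[n]$ are *weakly separated* if there are no $a<b<c<d$ in $[n]$ with $a,c\in A\setminus B$ and $b,d\in B\setminus A$, or with $a,c\in B\setminus A$ and $b,d\in A\setminus B$. Two $k$-element subsets $I=\{i_1<\dots<i_k\}$ and $J=\{j_1<\dots<j_k\}$ are *noncrossing* if for all $1\le a<b\le k$ either $\{i_a,\dots,i_b\}$ and $\{j_a,\dots,j_b\}$ are weakly separated, or $\{i_{a+1},\dots,i_{b-1}\}\neq\{j_{a+1},\dots,j_{b-1}\}$. The reduced noncrossing complex $\mathbf{NC}_{k,n}$ is the set of all collections of pairwise noncrossing nonfrozen $k$-element subsets of $[n]$. **Root polytope.** Let $e_{i,j}$ be the standard basis and $\alpha_{i,j}$ the coordinate functions of $\mathbb{R}^{(k-1)\times(n-k)}$, and let $\mathcal{H}_{k,n}$ be the subspace on which all row sums $\sum_j\alpha_{i,j}$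 vanish. Put $f_{i,j}=e_{i,j}-e_{i,j+1}$ for $1\le j\le n-k-1$ and $f_{i,n-k}=e_{i,n-k}-e_{i,1}$. For a $k$-element subset $J=\{j_1<\cdots<j_k\}$ of $[n]$ put $$\gamma_J=\sum_{\ell=1}^{k-1}\ \sum_{c=j_\ell-(\ell-1)}^{j_{\ell+1}-\ell-1}\alpha_{\ell,c},\qquad v_J=\sum_{\ell=1}^{k-1}\ \sum_{c=j_\ell-(\ell-1)}^{j_{\ell+1}-\ell-1}f_{\ell,c}\in\mathcal{H}_{k,n}.$$ The generalized root polytope $\mathcal{R}^{(k)}_{n-k}$ is the convex hull of the linear functions $\gamma_J|_{\mathcal{H}_{k,n}}$, $J$ nonfrozen, in the dual space $\mathcal{H}_{k,n}^\ast$. There is a linear isomorphism $\mathcal{H}_{k,n}^\ast\to\mathcal{H}_{k,n}$ with $\alpha_{i,j}|_{\mathcal{H}_{k,n}}\mapsto f_{i,j}$ for all $i,j$; it maps $\gamma_J|_{\mathcal{H}_{k,n}}$ to $v_J$ for every $J$, and so identifies $\mathcal{R}^{(k)}_{n-k}$ with the convex hull of the $v_J$, $J$ nonfrozen, in $\mathcal{H}_{k,n}$.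 Volume on the $d$-dimensional space $\mathcal{H}_{k,n}$ is normalized so that the lattice $\mathcal{L}$ with basis $f_{i,j}$ ($1\le i\le k-1$, $1\le j\le n-k-1$) has covolume $1$; the normalized volume is $d!$ times this volume. **Statement.** The points $0$ and $v_J$, for $J$ nonfrozen, are pairwise distinct, and the simplices $$[\mathcal{J}]=\operatorname{conv}\bigl(\{0\}\cup\{v_J:J\in\mathcal{J}\}\bigr),\qquad \mathcal{J}\in\mathbf{NC}_{k,n},$$ together with all their faces, form a triangulation of $\mathcal{R}^{(k)}_{n-k}$: for every $\mathcal{J}\in\mathbf{NC}_{k,n}$ the points $0$, $v_J$ ($J\in\mathcal{J}$) are affinely independent, any two of these simplices and faces intersect in the convex hull of their common vertices, and their union is $\mathcal{R}^{(k)}_{n-k}$. This triangulation is flag (every nonempty finite set of vertices that are pairwise joined by edges of the triangulation is the vertex set of a simplex of it) and unimodular (its vertices lie in $\mathcal{L}$ and each of its maximal simplices has volume $1/d!$). Consequently the normalized volume of $\mathcal{R}^{(k)}_{n-k}$ equals the $k$-dimensional Catalan number $C^{(k)}_{n-k}$, the number of standard Young tableaux of rectangular shape $k\times(n-k)$. 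-/

import Mathlib

open scoped ENNReal Nat

noncomputable section

namespace RootPolytope

/-! ### The noncrossing complex

The ground set `{1, …, n}` is modelled by `Fin n`, the number `x` being `⟨x - 1, _⟩`; positions
inside a `k`-element subset and rows and columns of the grid are shifted by one in the same way. -/

/-- The `k`-element subsets of an `n`-element linearly ordered set. -/
abbrev KSubset (k n : ℕ) : Type := {J : Finset (Fin n) // J.card = k}

variable {k n : ℕ}

/-- The elements of `J` listed increasingly. -/
def elt (J : KSubset k n) (a : Fin k) : Fin n := J.1.orderEmbOfFin J.2 a

/-- `J` is frozen if it is an interval for the cyclic order on the ground set. -/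
def Frozen (J : KSubset k n) : Prop :=
  ∃ s : ℕ, ∀ x : Fin n, x ∈ J.1 ↔ ∃ t < k, (x : ℕ) = (s + t) % n

/-- The set of nonfrozen `k`-element subsets. -/
def nonfrozen (k n : ℕ) : Set (KSubset k n) := {J | ¬ Frozen J}

/-- `e_A - e_B` does not contain the sign pattern `+ - + -` (in the linear order `a < b < c < d`),
nor its cyclic rotation `- + - +`. -/
def WeaklySeparated (A B : Finset (Fin n)) : Prop :=
  ¬ ∃ a b c d : Fin n, a < b ∧ b < c ∧ c < d ∧
    ((a ∈ A \ B ∧ b ∈ B \ A ∧ c ∈ A \ B ∧ d ∈ B \ A) ∨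
      (a ∈ B \ A ∧ b ∈ A \ B ∧ c ∈ B \ A ∧ d ∈ A \ B))

/-- The subset `{j_a, j_{a+1}, …, j_b}` of `J`. -/
def segment (J : KSubset k n) (a b : Fin k) : Finset (Fin n) := (Finset.Icc a b).image (elt J)

/-- The subset `{j_{a+1}, …, j_{b-1}}` of `J`. -/
def interiorSegment (J : KSubset k n) (a b : Fin k) : Finset (Fin n) :=
  (Finset.Ioo a b).image (elt J)

/-- The noncrossing relation on `k`-element subsets. -/
def Noncrossing (I J : KSubset k n) : Prop :=
  ∀ a b : Fin k, a < b →
    WeaklySeparated (segment I a b) (segment J a b) ∨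
      interiorSegment I a b ≠ interiorSegment J a b

/-- The reduced noncrossing complex: collections of pairwise noncrossing nonfrozen subsets. -/
def NC (k n : ℕ) : Set (Finset (KSubset k n)) :=
  {𝒥 | (∀ J ∈ 𝒥, J ∈ nonfrozen k n) ∧ ∀ I ∈ 𝒥, ∀ J ∈ 𝒥, Noncrossing I J}

/-! ### Generalized roots and the root polytope -/

/-- The space of real `(k - 1) × (n - k)` arrays. -/
abbrev Grid (k n : ℕ) : Type := Fin (k - 1) × Fin (n - k) → ℝ

/-- The subspace of arrays all of whose row sums vanish. -/
def rowZero (k n : ℕ) : Submodule ℝ (Grid k n) where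
  carrier := {x | ∀ i, ∑ j, x (i, j) = 0}
  add_mem' := by
    intro x y hx hy i
    simp [Finset.sum_add_distrib, hx i, hy i]
  zero_mem' := by
    intro i
    simp
  smul_mem' := by
    intro c x hx i
    simp [← Finset.mul_sum, hx i]

/-- The standard basis vector `e_{i,j}`. -/
def e (q : Fin (k - 1) × Fin (n - k)) : Grid k n := Pi.single q 1

/-- `f_{i,j} = e_{i,j} - e_{i,j+1}`, the column index being cyclic: `f_{i,n-k} = e_{i,n-k} - e_{i,1}`.
-/
def f (q : Fin (k - 1) × Fin (n - k)) : Grid k n := e q - e (q.1, finRotate (n - k) q.2)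

/-- The cells `(ℓ, c)` with `j_ℓ - (ℓ - 1) ≤ c ≤ j_{ℓ+1} - ℓ - 1`, for `J = {j_1 < ⋯ < j_k}`. In
terms of the shifted values `ℓ = q.1 + 1`, `c = q.2 + 1`, `j_ℓ = elt J q.1 + 1` this reads as
follows. -/
def cells (J : KSubset k n) : Finset (Fin (k - 1) × Fin (n - k)) :=
  Finset.univ.filter fun q =>
    (elt J ⟨q.1, by omega⟩ : ℕ) ≤ (q.2 : ℕ) + q.1 ∧
      (q.2 : ℕ) + q.1 + 1 < (elt J ⟨(q.1 : ℕ) + 1, by omega⟩ : ℕ)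

/-- The generalized root `γ_J`, a sum of coordinate functions `α_{i,j}`. -/
def gamma (J : KSubset k n) : Module.Dual ℝ (Grid k n) := ∑ q ∈ cells J, LinearMap.proj q

/-- The vector `v_J`, the corresponding sum of the vectors `f_{i,j}`. -/
def v (J : KSubset k n) : Grid k n := ∑ q ∈ cells J, f q

/-- The root polytope in the space of linear functions on `rowZero k n`. -/
def dualRootPolytope (k n : ℕ) : Set (Module.Dual ℝ (rowZero k n)) :=
  convexHull ℝ ((fun J => (gamma J).domRestrict (rowZero k n)) '' nonfrozen k n)

/-- The root polytope, realized in `rowZero k n` as the convex hull of the vectors `v_J`. -/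
def rootPolytope (k n : ℕ) : Set (Grid k n) := convexHull ℝ (v '' nonfrozen k n)

/-! ### Lattice and volume -/

/-- The vectors `f_{i,j}` with `1 ≤ j ≤ n - k - 1`; they form a basis of `rowZero k n`. -/
def simpleRoot (q : Fin (k - 1) × Fin (n - k - 1)) : Grid k n :=
  f (q.1, Fin.castLE (Nat.sub_le _ _) q.2)

/-- The lattice generated by the `f_{i,j}` with `1 ≤ j ≤ n - k - 1`. -/
def rootLattice (k n : ℕ) : Submodule ℤ (Grid k n) :=
  Submodule.span ℤ (Set.range simpleRoot)

/-- The `(k - 1) (n - k - 1)`-dimensional volume on `rowZero k n`, normalized so that the root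
lattice has covolume one: Lebesgue measure in the coordinates given by the lattice basis
`simpleRoot`. -/
def relVolume (S : Set (Grid k n)) : ℝ≥0∞ :=
  MeasureTheory.volume
    {c : Fin (k - 1) × Fin (n - k - 1) → ℝ | ∑ q, c q • (simpleRoot q : Grid k n) ∈ S}

/-- The normalized volume: a unimodular simplex has normalized volume one. -/
def normalizedVolume (S : Set (Grid k n)) : ℝ≥0∞ :=
  (((k - 1) * (n - k - 1))! : ℝ≥0∞) * relVolume S

/-- A simplicial complex with vertices in the root lattice is unimodular if each of its maximal
simplices has volume `1 / d!`, where `d = (k - 1) (n - k - 1)`. -/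
def IsUnimodular (K : Geometry.SimplicialComplex ℝ (Grid k n)) : Prop :=
  K.vertices ⊆ (rootLattice k n : Set (Grid k n)) ∧
    ∀ s ∈ K.facets,
      relVolume (convexHull ℝ (s : Set (Grid k n))) = 1 / (((k - 1) * (n - k - 1))! : ℝ≥0∞)

/-- A simplicial complex is flag if every finite nonempty set of vertices which are pairwise joined
by edges is the vertex set of a simplex. -/
def IsFlag {E : Type*} [AddCommGroup E] [Module ℝ E] [DecidableEq E]
    (K : Geometry.SimplicialComplex ℝ E) : Prop :=
  ∀ s : Finset E, s.Nonempty → (∀ x ∈ s, ∀ y ∈ s, ({x, y} : Finset E) ∈ K.faces) → s ∈ K.faces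

/-! ### Multidimensional Catalan numbers -/

/-- The `k`-dimensional Catalan number: the number of standard Young tableaux of rectangular shape
`k × m`, that is, of arrangements of `1, …, km` in a `k × m` array with increasing rows and
columns. -/
def multiCatalan (k m : ℕ) : ℕ :=
  Nat.card {T : Fin k × Fin m ≃ Fin (k * m) //
    (∀ i, StrictMono fun j => T (i, j)) ∧ (∀ j, StrictMono fun i => T (i, j))}

end RootPolytope

end

namespace RootPolytope

variable {k n : ℕ}

/-! ### Elements of `k`-element subsets -/

/-! Encode `J` by the 0/1 array `filt J` of size `k × (n - k)`, whose entry at `(l, c)` records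
whether the `l`-th element of `J` is at most `c + l`. Then `v J` is the image of `filt J` under a
linear map: row differences, then cyclic column differences (`fsum`). The kernel of this map is
spanned by the arrays of frozen sets. So the theorem becomes a statement about nonnegative
combinations of the arrays `filt J`, modulo frozen ones. Such a combination, together with its total
mass, records exactly the marginals of a weighting: for each `l`, the distribution of the `l`-th
element.

Two facts about weightings carry everything. Existence (`exists_ncSupport`): a crossing pair can be
replaced by the pair with exchanged tails; this keeps the marginals and lowers a quadratic weight,
so a weighting that minimizes the weight has noncrossing support. Uniqueness
(`eq_of_sameMarginals`): a nonnegative noncrossing weighting is determined by its marginals, because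
noncrossing forces a monotone coupling between each prefix and the next element. Frozen sets cross
nothing, so they can be divided out: every point of `rowZero` is a nonnegative combination of
pairwise noncrossing nonfrozen `v J` in exactly one way (`exists_isRep_of_mem_rowZero`,
`IsRep.eq_of_comb_eq`). In other words the noncrossing cones form a complete simplicial fan. The
root polytope is the set where the coefficients sum to at most 1, which gives the triangulation;
flagness is immediate, since the complex is defined by a pairwise condition. Existence also holds
with integer coefficients, so the vectors of a maximal noncrossing collection form a lattice basis,
which is unimodularity.

For the volume, let the gauge of `x` be the sum of its coefficients. Then `d!` times the volume of
the polytope is the integral of `exp (-gauge)`. Consider the cone of nonnegative monotone arrays,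
which is generated by the `filt J`. In unimodular coordinates, its fibre over `x` is an orthant
translated to the array `lift x`, whose largest entry, at the corner, is the gauge of `x`
(`mem_cone_iff`, `lift_corner`). By Fubini the integral equals that of `exp (-F corner)` over the
cone. Cutting the cone according to the order of the entries gives one chamber of integral 1 for
each linear extension, hence for each standard Young tableau. -/

theorem elt_strictMono (J : KSubset k n) : StrictMono (elt J) :=
  (J.1.orderEmbOfFin J.2).strictMono

theorem mem_iff_exists_elt (J : KSubset k n) (x : Fin n) : x ∈ J.1 ↔ ∃ a, elt J a = x := by
  have h := J.1.range_orderEmbOfFin J.2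
  rw [← Finset.mem_coe, ← h]
  rfl

theorem elt_injective : Function.Injective (elt : KSubset k n → Fin k → Fin n) := by
  intro I J h
  apply Subtype.ext
  ext x
  rw [mem_iff_exists_elt, mem_iff_exists_elt, h]

/-- The `k`-element subset with a given increasing list of elements. -/
def ofStrictMono (g : Fin k → Fin n) (hg : StrictMono g) : KSubset k n :=
  ⟨Finset.univ.image g, by simp [Finset.card_image_of_injective _ hg.injective]⟩

theorem elt_ofStrictMono (g : Fin k → Fin n) (hg : StrictMono g) :
    elt (ofStrictMono g hg) = g := by
  symm
  exact Finset.orderEmbOfFin_unique _ (fun x => by simp [ofStrictMono]) hg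

/-- The elements of `J` as natural numbers, indexed by natural numbers. -/
def el (J : KSubset k n) (l : ℕ) : ℕ := if h : l < k then elt J ⟨l, h⟩ else 0

theorem el_of_lt (J : KSubset k n) {l : ℕ} (h : l < k) : el J l = elt J ⟨l, h⟩ := dif_pos h

theorem el_val (J : KSubset k n) (l : Fin k) : el J l = elt J l := dif_pos l.2

theorem el_lt_el (J : KSubset k n) {a b : ℕ} (h : a < b) (hb : b < k) : el J a < el J b := by
  rw [el_of_lt J (h.trans hb), el_of_lt J hb]
  exact elt_strictMono J (by simpa using h)

theorem el_lt (J : KSubset k n) {l : ℕ} (h : l < k) : el J l < n := by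
  rw [el_of_lt J h]; exact Fin.is_lt _

theorem el_le (J : KSubset k n) (l : ℕ) : el J l ≤ n := by
  unfold el; split_ifs
  · exact (Fin.is_lt _).le
  · exact Nat.zero_le _

theorem ext_el {I J : KSubset k n} (h : ∀ l < k, el I l = el J l) : I = J := by
  apply elt_injective
  funext l
  have := h l l.2
  rw [el_val, el_val] at this
  exact Fin.ext this

theorem el_add_le (J : KSubset k n) {a b : ℕ} (h : a ≤ b) (hb : b < k) :
    el J a + (b - a) ≤ el J b := by
  induction b, h using Nat.le_induction with
  | base => simp
  | succ b hab ih =>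
    have := ih (by omega)
    have := el_lt_el J (lt_add_one b) hb
    omega

theorem le_el (J : KSubset k n) {l : ℕ} (h : l < k) : l ≤ el J l := by
  have := el_add_le J (Nat.zero_le l) h
  omega

theorem el_le_add (J : KSubset k n) {l : ℕ} (h : l < k) : el J l ≤ n - k + l := by
  have := el_add_le J (a := l) (b := k - 1) (by omega) (by omega)
  have := el_lt J (l := k - 1) (by omega)
  omega

/-- The subset with elements `g 0 < g 1 < ⋯`. -/
theorem exists_el (g : ℕ → ℕ) (hg : ∀ l, l + 1 < k → g l < g (l + 1)) (hn : ∀ l < k, g l < n) :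
    ∃ J : KSubset k n, ∀ l < k, el J l = g l := by
  have hmono : ∀ a b, a < b → b < k → g a < g b := by
    intro a b hab
    induction b, hab using Nat.le_induction with
    | base => intro h; exact hg a h
    | succ b _ ih => intro h; exact (ih (by omega)).trans (hg b h)
  have hs : StrictMono (fun l : Fin k => (⟨g l, hn l l.2⟩ : Fin n)) :=
    fun a b hab => Fin.lt_def.2 (hmono a b hab b.2)
  refine ⟨ofStrictMono _ hs, fun l hl => ?_⟩
  rw [el_of_lt _ hl, elt_ofStrictMono]

/-! ### Crossings -/

/-- The sequences `x`, `y` cross at the positions `a < b`. -/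
def CrossAt (x y : ℕ → ℕ) (a b : ℕ) : Prop :=
  (∀ l, a < l → l < b → x l = y l) ∧ x a < y a ∧ y a < x b ∧ x b < y b

/-- At a first disagreement the smaller of the two elements would have to occur in the other list at
an earlier position, where the lists already agree. -/
theorem elt_eq_of_interiorSegment_eq {I J : KSubset k n} {a b : Fin k}
    (h : interiorSegment I a b = interiorSegment J a b) :
    ∀ l, a < l → l < b → elt I l = elt J l := by
  have key : ∀ I J : KSubset k n, interiorSegment I a b = interiorSegment J a b →
      ∀ l, a < l → l < b → (∀ l', l' < l → a < l' → elt I l' = elt J l') →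
        ¬ elt I l < elt J l := by
    intro I J h l hal hlb ih hlt
    have : elt I l ∈ interiorSegment J a b := by
      rw [← h]; exact Finset.mem_image_of_mem _ (Finset.mem_Ioo.2 ⟨hal, hlb⟩)
    obtain ⟨l', hl', he⟩ := Finset.mem_image.1 this
    have h1 : l' < l := (elt_strictMono J).lt_iff_lt.1 (he ▸ hlt)
    have h2 := ih l' h1 (Finset.mem_Ioo.1 hl').1
    have h3 := elt_strictMono I h1
    rw [h2, he] at h3
    exact lt_irrefl _ h3
  intro l
  induction l using WellFoundedLT.induction with
  | ind l ih =>
    intro hal hlb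
    have ih' : ∀ l', l' < l → a < l' → elt I l' = elt J l' :=
      fun l' h1 h2 => ih l' h1 h2 (h1.trans hlb)
    rcases lt_trichotomy (elt I l) (elt J l) with h1 | h1 | h1
    · exact absurd h1 (key I J h l hal hlb ih')
    · exact h1
    · exact absurd h1 (key J I h.symm l hal hlb fun l' a b => (ih' l' a b).symm)

theorem interiorSegment_eq_iff {I J : KSubset k n} {a b : Fin k} :
    interiorSegment I a b = interiorSegment J a b ↔
      ∀ l, a < l → l < b → elt I l = elt J l := by
  refine ⟨elt_eq_of_interiorSegment_eq, fun h => ?_⟩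
  apply Finset.image_congr
  intro l hl
  have := Finset.mem_Ioo.1 (Finset.mem_coe.1 hl)
  exact h l this.1 this.2

theorem mem_segment_sdiff {I J : KSubset k n} {a b : Fin k}
    (h : ∀ l, a < l → l < b → elt I l = elt J l) (x : Fin n)
    (hx : x ∈ segment I a b \ segment J a b) : x = elt I a ∨ x = elt I b := by
  rw [Finset.mem_sdiff] at hx
  obtain ⟨l, hl, rfl⟩ := Finset.mem_image.1 hx.1
  rw [Finset.mem_Icc] at hl
  by_contra! hne
  have h1 : a < l := lt_of_le_of_ne hl.1 (by rintro rfl; exact hne.1 rfl)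
  have h2 : l < b := lt_of_le_of_ne hl.2 (by rintro rfl; exact hne.2 rfl)
  exact hx.2 (Finset.mem_image.2 ⟨l, Finset.mem_Icc.2 hl, (h l h1 h2).symm⟩)

/-- When the interiors agree, each set difference contains at most the two end elements, so an
alternating pattern can only be formed by the four ends. -/
theorem cross_of_pattern {I J : KSubset k n} {a b : Fin k} (hab : a < b)
    (h : ∀ l, a < l → l < b → elt I l = elt J l) {p q r s : Fin n} (hpq : p < q) (hqr : q < r)
    (hrs : r < s) (hp : p ∈ segment I a b \ segment J a b) (hq : q ∈ segment J a b \ segment I a b)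
    (hr : r ∈ segment I a b \ segment J a b) (hs : s ∈ segment J a b \ segment I a b) :
    elt I a < elt J a ∧ elt J a < elt I b ∧ elt I b < elt J b := by
  have hI := elt_strictMono I hab
  have hJ := elt_strictMono J hab
  have hp := mem_segment_sdiff h _ hp
  have hr := mem_segment_sdiff h _ hr
  have h' : ∀ l, a < l → l < b → elt J l = elt I l := fun l h1 h2 => (h l h1 h2).symm
  have hq := mem_segment_sdiff h' _ hq
  have hs := mem_segment_sdiff h' _ hs
  omega

theorem pattern_of_cross {I J : KSubset k n} {a b : Fin k} (hab : a < b)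
    (h : ∀ l, a < l → l < b → elt I l = elt J l) (h1 : elt I a < elt J a)
    (h2 : elt J a < elt I b) (h3 : elt I b < elt J b) :
    elt I a ∈ segment I a b \ segment J a b ∧ elt J a ∈ segment J a b \ segment I a b ∧
    elt I b ∈ segment I a b \ segment J a b ∧ elt J b ∈ segment J a b \ segment I a b := by
  have aux : ∀ (K : KSubset k n) (l : Fin k), l ∈ Finset.Icc a b → elt K l ∈ segment K a b :=
    fun K l hl => Finset.mem_image_of_mem _ hl
  have ha : a ∈ Finset.Icc a b := Finset.mem_Icc.2 ⟨le_rfl, hab.le⟩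
  have hb : b ∈ Finset.Icc a b := Finset.mem_Icc.2 ⟨hab.le, le_rfl⟩
  have cases : ∀ l ∈ Finset.Icc a b, l = a ∨ l = b ∨ (a < l ∧ l < b) := by
    intro l hl; rw [Finset.mem_Icc] at hl; omega
  simp only [Finset.mem_sdiff]
  refine ⟨⟨aux I a ha, ?_⟩, ⟨aux J a ha, ?_⟩, ⟨aux I b hb, ?_⟩, ⟨aux J b hb, ?_⟩⟩ <;>
  · intro hm
    obtain ⟨l, hl, he⟩ := Finset.mem_image.1 hm
    rcases cases l hl with rfl | rfl | ⟨hl1, hl2⟩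
    · omega
    · omega
    · have e1 := h l hl1 hl2
      have e2 := elt_strictMono I hl1
      have e3 := elt_strictMono I hl2
      have e4 := elt_strictMono J hl1
      have e5 := elt_strictMono J hl2
      omega

/-- Replaces weak separation of segments by interlacing of their end elements. This is the form of
the relation on which all later arguments rest. -/
theorem noncrossing_iff {I J : KSubset k n} :
    Noncrossing I J ↔ ∀ a b, a < b → b < k →
      ¬ CrossAt (el I) (el J) a b ∧ ¬ CrossAt (el J) (el I) a b := by
  have tr : ∀ (I J : KSubset k n) (a b : Fin k), CrossAt (el I) (el J) a b ↔
      (∀ l, a < l → l < b → elt I l = elt J l) ∧ elt I a < elt J a ∧ elt J a < elt I b ∧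
        elt I b < elt J b := by
    intro I J a b
    simp only [CrossAt, el_val, Fin.lt_def]
    refine and_congr_left fun _ => ⟨fun h l h1 h2 => ?_, fun h l h1 h2 => ?_⟩
    · have := h l h1 h2
      rw [el_val, el_val] at this
      exact Fin.ext this
    · rw [el_of_lt _ (h2.trans b.2), el_of_lt _ (h2.trans b.2), h ⟨l, h2.trans b.2⟩ h1 h2]
  constructor
  · intro H a b hab hb
    have H := H ⟨a, hab.trans hb⟩ ⟨b, hb⟩ hab
    rw [or_iff_not_imp_right, not_not, interiorSegment_eq_iff] at H
    have t1 := tr I J ⟨a, hab.trans hb⟩ ⟨b, hb⟩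
    have t2 := tr J I ⟨a, hab.trans hb⟩ ⟨b, hb⟩
    simp only at t1 t2
    rw [t1, t2]
    constructor
    · rintro ⟨h, h1, h2, h3⟩
      obtain ⟨m1, m2, m3, m4⟩ := pattern_of_cross hab h h1 h2 h3
      exact H h ⟨_, _, _, _, h1, h2, h3, Or.inl ⟨m1, m2, m3, m4⟩⟩
    · rintro ⟨h, h1, h2, h3⟩
      obtain ⟨m1, m2, m3, m4⟩ := pattern_of_cross hab h h1 h2 h3
      exact H (fun l a b => (h l a b).symm) ⟨_, _, _, _, h1, h2, h3, Or.inr ⟨m1, m2, m3, m4⟩⟩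
  · intro H a b hab
    rw [or_iff_not_imp_right, not_not, interiorSegment_eq_iff]
    have H := H a b hab b.2
    rw [tr, tr] at H
    rintro h ⟨p, q, r, s, hpq, hqr, hrs, ⟨m1, m2, m3, m4⟩ | ⟨m1, m2, m3, m4⟩⟩
    · exact H.1 ⟨h, cross_of_pattern hab h hpq hqr hrs m1 m2 m3 m4⟩
    · have h' : ∀ l, a < l → l < b → elt J l = elt I l := fun l h1 h2 => (h l h1 h2).symm
      exact H.2 ⟨h', cross_of_pattern hab h' hpq hqr hrs m1 m2 m3 m4⟩

theorem Noncrossing.symm {I J : KSubset k n} (h : Noncrossing I J) : Noncrossing J I := by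
  rw [noncrossing_iff] at h ⊢
  exact fun a b hab hb => (h a b hab hb).symm

theorem Noncrossing.refl (I : KSubset k n) : Noncrossing I I := by
  rw [noncrossing_iff]
  exact fun a b _ _ => ⟨fun h => lt_irrefl _ h.2.1, fun h => lt_irrefl _ h.2.1⟩

/-! ### Leading terms -/

/-- Signed base-`N` digits: the lower digits cannot outweigh one unit of the next power, so the
leading nonzero digit decides the sign. -/
theorem abs_sum_pow_mul_lt {N : ℤ} (hN : 1 ≤ N) {d : ℕ → ℤ} (hd : ∀ l, |d l| ≤ N - 1) (a : ℕ) :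
    |∑ l ∈ Finset.range a, N ^ l * d l| < N ^ a := by
  induction a with
  | zero => simp
  | succ a ih =>
    rw [Finset.sum_range_succ]
    have h0 : 0 < N ^ a := by positivity
    have h1 : |N ^ a * d a| ≤ N ^ a * (N - 1) := by
      rw [abs_mul, abs_of_pos h0]
      exact mul_le_mul_of_nonneg_left (hd a) h0.le
    have h2 := abs_add_le (∑ l ∈ Finset.range a, N ^ l * d l) (N ^ a * d a)
    rw [pow_succ]
    linarith

theorem sum_pow_mul_pos {N : ℤ} (hN : 1 ≤ N) {d : ℕ → ℤ} (hd : ∀ l, |d l| ≤ N - 1) {a b : ℕ}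
    (hab : a < b) (h0 : ∀ l, a < l → l < b → d l = 0) (ha : 0 < d a) :
    0 < ∑ l ∈ Finset.range b, N ^ l * d l := by
  have h1 : ∑ l ∈ Finset.range b, N ^ l * d l = ∑ l ∈ Finset.range (a + 1), N ^ l * d l := by
    symm
    apply Finset.sum_subset
    · intro l; simp only [Finset.mem_range]; omega
    · intro l hl hl'
      simp only [Finset.mem_range] at hl hl'
      rw [h0 l (by omega) hl, mul_zero]
  rw [h1, Finset.sum_range_succ]
  have h2 := (abs_lt.1 (abs_sum_pow_mul_lt hN hd a)).1
  have h3 : N ^ a * 1 ≤ N ^ a * d a := mul_le_mul_of_nonneg_left ha (by positivity)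
  linarith

/-- Here the lowest index `b` carries the highest power; reversing the index reduces to
`sum_pow_mul_pos`. -/
theorem sum_pow_sub_mul_pos {N : ℤ} (hN : 1 ≤ N) {d : ℕ → ℤ} (hd : ∀ l, |d l| ≤ N - 1) {b k : ℕ}
    (hbk : b < k) (hb : 0 < d b) :
    0 < ∑ l ∈ Finset.Ico b k, N ^ (k - l) * d l := by
  have h1 : ∑ l ∈ Finset.Ico b k, N ^ (k - l) * d l
      = N * ∑ i ∈ Finset.range (k - b), N ^ i * d (k - 1 - i) := by
    rw [Finset.mul_sum, Finset.sum_Ico_eq_sum_range, ← Finset.sum_range_reflect]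
    apply Finset.sum_congr rfl
    intro i hi
    rw [Finset.mem_range] at hi
    have e1 : b + (k - b - 1 - i) = k - 1 - i := by omega
    have e2 : k - (k - 1 - i) = i + 1 := by omega
    rw [e1, e2, pow_succ]; ring
  rw [h1]
  apply mul_pos (by linarith)
  apply sum_pow_mul_pos hN (fun l => hd _) (a := k - b - 1) (by omega) (fun l _ _ => by omega)
  have : k - 1 - (k - b - 1) = b := by omega
  rwa [this]

/-! ### Prefix codes -/

/-- An integer encoding the first `b` elements of `J`, later elements having more weight. -/
def code (b : ℕ) (J : KSubset k n) : ℤ := ∑ l ∈ Finset.range b, ((n : ℤ) + 1) ^ l * (el J l : ℤ)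

theorem abs_el_sub_el_le (I J : KSubset k n) (l : ℕ) :
    |(el J l : ℤ) - el I l| ≤ (n : ℤ) + 1 - 1 := by
  have h1 := el_le I l
  have h2 := el_le J l
  rw [abs_le]; omega

/-- The base `n + 1` exceeds every difference of elements, so codes compare prefixes at their last
disagreement. That is the position `a` at which a crossing `(a, b)` would begin. -/
theorem code_lt_code {b : ℕ} {I J : KSubset k n} {a : ℕ} (hab : a < b)
    (h : ∀ l, a < l → l < b → el I l = el J l) (ha : el I a < el J a) : code b I < code b J := by
  have := sum_pow_mul_pos (N := (n : ℤ) + 1) (by omega) (abs_el_sub_el_le I J) hab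
    (fun l h1 h2 => by rw [h l h1 h2, sub_self]) (by omega)
  simp only [mul_sub, Finset.sum_sub_distrib] at this
  unfold code
  linarith

theorem exists_max_ne {b : ℕ} {I J : KSubset k n} (h : ¬ ∀ l < b, el I l = el J l) :
    ∃ a < b, el I a ≠ el J a ∧ ∀ l, a < l → l < b → el I l = el J l := by
  induction b with
  | zero => exact absurd (fun l hl => absurd hl (Nat.not_lt_zero l)) h
  | succ b ih =>
    by_cases hb : el I b = el J b
    · have : ¬ ∀ l < b, el I l = el J l := by
        intro h'
        apply h
        intro l hl
        rcases Nat.lt_succ_iff_lt_or_eq.1 hl with h1 | rfl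
        · exact h' l h1
        · exact hb
      obtain ⟨a, ha, hne, he⟩ := ih this
      refine ⟨a, by omega, hne, fun l h1 h2 => ?_⟩
      rcases Nat.lt_succ_iff_lt_or_eq.1 h2 with h3 | rfl
      · exact he l h1 h3
      · exact hb
    · exact ⟨b, by omega, hb, fun l h1 h2 => by omega⟩

theorem code_eq_iff {b : ℕ} {I J : KSubset k n} :
    code b I = code b J ↔ ∀ l < b, el I l = el J l := by
  constructor
  · intro h
    by_contra hne
    obtain ⟨a, hab, hne, he⟩ := exists_max_ne hne
    rcases lt_or_gt_of_ne hne with h1 | h1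
    · exact (code_lt_code hab he h1).ne h
    · exact (code_lt_code hab (fun l a b => (he l a b).symm) h1).ne h.symm
  · intro h
    apply Finset.sum_congr rfl
    intro l hl
    rw [h l (Finset.mem_range.1 hl)]

theorem exists_of_code_lt {b : ℕ} {I J : KSubset k n} (h : code b I < code b J) :
    ∃ a < b, el I a < el J a ∧ ∀ l, a < l → l < b → el I l = el J l := by
  have : ¬ ∀ l < b, el I l = el J l := fun h' => h.ne (code_eq_iff.2 h')
  obtain ⟨a, hab, hne, he⟩ := exists_max_ne this
  refine ⟨a, hab, lt_of_le_of_ne (not_lt.1 fun h1 => ?_) hne, he⟩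
  exact lt_asymm h (code_lt_code hab (fun l a b => (he l a b).symm) h1)

/-! ### Uncrossing -/

/-- A linear weight on `k`-element subsets that drops when a crossing is resolved. -/
noncomputable def weight (k : ℕ) (N : ℤ) (x : ℕ → ℤ) : ℤ :=
  ∑ a ∈ Finset.range k, ∑ b ∈ Finset.range k,
    if a < b then N ^ a * N ^ (k - b) * (x a * x b) else 0

/-- Exchanging tails at `t` only affects pairs `a < t ≤ b`, and each contributes `(x a - y a) * (x b
- y b)` times its coefficient. The coefficient is a product, so the double sum factors. -/
theorem weight_swap (N : ℤ) {t : ℕ} (ht : t ≤ k) {x y x' y' : ℕ → ℤ}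
    (h1 : ∀ l < t, x' l = x l) (h2 : ∀ l, t ≤ l → l < k → x' l = y l)
    (h3 : ∀ l < t, y' l = y l) (h4 : ∀ l, t ≤ l → l < k → y' l = x l) :
    weight k N x + weight k N y - weight k N x' - weight k N y' =
      (∑ l ∈ Finset.range t, N ^ l * (x l - y l)) *
        ∑ l ∈ Finset.Ico t k, N ^ (k - l) * (x l - y l) := by
  have e1 : ∑ l ∈ Finset.range t, N ^ l * (x l - y l) =
      ∑ l ∈ Finset.range k, if l < t then N ^ l * (x l - y l) else 0 := by
    rw [← Finset.sum_filter]
    apply Finset.sum_congr _ fun _ _ => rfl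
    ext l; simp only [Finset.mem_range, Finset.mem_filter]; omega
  have e2 : ∑ l ∈ Finset.Ico t k, N ^ (k - l) * (x l - y l) =
      ∑ l ∈ Finset.range k, if t ≤ l then N ^ (k - l) * (x l - y l) else 0 := by
    rw [← Finset.sum_filter]
    apply Finset.sum_congr _ fun _ _ => rfl
    ext l; simp only [Finset.mem_range, Finset.mem_filter, Finset.mem_Ico]; omega
  rw [e1, e2, Finset.sum_mul_sum]
  unfold weight
  simp only [← Finset.sum_add_distrib, ← Finset.sum_sub_distrib]
  refine Finset.sum_congr rfl fun a ha => Finset.sum_congr rfl fun b hb => ?_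
  rw [Finset.mem_range] at ha hb
  by_cases hab : a < b
  · simp only [if_pos hab]
    by_cases hat : a < t
    · by_cases hbt : t ≤ b
      · rw [if_pos hat, if_pos hbt, h1 a hat, h3 a hat, h2 b hbt hb, h4 b hbt hb]; ring
      · rw [if_neg hbt, h1 a hat, h3 a hat, h1 b (by omega), h3 b (by omega)]; ring
    · rw [if_neg hat, h2 a (by omega) ha, h4 a (by omega) ha, h2 b (by omega) hb,
        h4 b (by omega) hb]; ring
  · simp only [if_neg hab]
    by_cases hat : a < t
    · rw [if_neg (by omega : ¬ t ≤ b)]; ring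
    · rw [if_neg hat]; ring

/-- The weight of a `k`-element subset. -/
noncomputable def wt (J : KSubset k n) : ℤ := weight k ((n : ℤ) + 1) fun l => (el J l : ℤ)

/-- `I'` and `J'` arise by exchanging the tails from position `b` on, so the pair of entries at each
position is kept. In `weight_swap` both factors are positive: their leading digits are the
differences at `a` and at `b`, and the crossing makes both positive. -/
theorem exists_uncross {I J : KSubset k n} {a b : ℕ} (hab : a < b) (hb : b < k)
    (h : CrossAt (el I) (el J) a b) :
    ∃ I' J' : KSubset k n, wt I' + wt J' < wt I + wt J ∧
      ∀ l < k, ∀ g : ℕ → ℝ, g (el I' l) + g (el J' l) = g (el I l) + g (el J l) := by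
  obtain ⟨h0, h1, h2, h3⟩ := h
  have aux1 : el I (b - 1) < el J b := by
    have := el_lt_el I (a := b - 1) (b := b) (by omega) hb
    omega
  -- At the seam, either `b = a + 1` and this is the middle inequality of the crossing, or the two
  -- sets agree at `b - 1`.
  have aux2 : el J (b - 1) < el I b := by
    by_cases hab' : a = b - 1
    · rw [← hab']; exact h2
    · rw [← h0 (b - 1) (by omega) (by omega)]
      exact el_lt_el I (a := b - 1) (b := b) (by omega) hb
  have swap : ∀ I J : KSubset k n, el I (b - 1) < el J b → ∃ K : KSubset k n, ∀ l < k,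
      el K l = if l < b then el I l else el J l := by
    intro I J hIJ
    apply exists_el
    · intro l hl
      have q1 := el_lt_el I (lt_add_one l) hl
      have q2 := el_lt_el J (lt_add_one l) hl
      split_ifs with c1 c2
      · exact q1
      · obtain rfl : l = b - 1 := by omega
        have : b - 1 + 1 = b := by omega
        rwa [this]
      · omega
      · exact q2
    · intro l hl
      split_ifs
      exacts [el_lt I hl, el_lt J hl]
  obtain ⟨I', hI'⟩ := swap I J aux1
  obtain ⟨J', hJ'⟩ := swap J I aux2
  refine ⟨I', J', ?_, ?_⟩
  · have key := weight_swap (k := k) ((n : ℤ) + 1) hb.le (x := fun l => (el J l : ℤ))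
      (y := fun l => (el I l : ℤ)) (x' := fun l => (el J' l : ℤ)) (y' := fun l => (el I' l : ℤ))
      (fun l hl => by simp [hJ' l (hl.trans hb), hl])
      (fun l hl hlk => by simp [hJ' l hlk, not_lt.2 hl])
      (fun l hl => by simp [hI' l (hl.trans hb), hl])
      (fun l hl hlk => by simp [hI' l hlk, not_lt.2 hl])
    have p1 := sum_pow_mul_pos (N := (n : ℤ) + 1) (by omega) (abs_el_sub_el_le I J) hab
      (fun l h1 h2 => by rw [h0 l h1 h2, sub_self]) (by omega)
    have p2 := sum_pow_sub_mul_pos (N := (n : ℤ) + 1) (by omega) (abs_el_sub_el_le I J) hb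
      (by omega)
    have p3 := mul_pos p1 p2
    rw [← key] at p3
    unfold wt
    linarith
  · intro l hl g
    rw [hI' l hl, hJ' l hl]
    split_ifs
    · rfl
    · exact add_comm _ _

/-- Two weightings of the `k`-element subsets induce the same weighting of the `l`-th elements, for
every `l`. -/
def SameMarginals (c c' : KSubset k n → ℝ) : Prop :=
  ∀ l < k, ∀ g : ℕ → ℝ, ∑ J, c J * g (el J l) = ∑ J, c' J * g (el J l)

theorem SameMarginals.sum_eq {c c' : KSubset k n → ℝ} (h : SameMarginals c c') (hk : 0 < k) :
    ∑ J, c J = ∑ J, c' J := by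
  simpa using h 0 hk fun _ => 1

/-- The sets with nonzero weight are pairwise noncrossing. -/
def NCSupport (c : KSubset k n → ℝ) : Prop :=
  ∀ I J, c I ≠ 0 → c J ≠ 0 → Noncrossing I J

/-- The weightings with the given marginals and values in `T` form a compact set; at a minimum of
the total `wt`, resolving a crossing would lower it further. Closedness of `T` gives compactness,
and the subgroup property keeps the moved mass in `T`. It is used for all reals and for the
integers. -/
theorem exists_ncSupport (T : AddSubgroup ℝ) (hT : IsClosed (T : Set ℝ)) (hk : 0 < k)
    (c : KSubset k n → ℝ) (h0 : ∀ J, 0 ≤ c J) (hcT : ∀ J, c J ∈ T) :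
    ∃ c' : KSubset k n → ℝ, (∀ J, 0 ≤ c' J) ∧ (∀ J, c' J ∈ T) ∧ NCSupport c' ∧
      SameMarginals c' c := by
  classical
  let S : Set (KSubset k n → ℝ) :=
    {c' | (∀ J, 0 ≤ c' J) ∧ (∀ J, c' J ∈ (T : Set ℝ)) ∧ SameMarginals c' c}
  have hclosed : IsClosed S := by
    simp only [S, SameMarginals, Set.ofPred_and, Set.ofPred_forall]
    refine IsClosed.inter ?_ (IsClosed.inter ?_ ?_)
    · exact isClosed_iInter fun J => isClosed_le continuous_const (continuous_apply J)
    · exact isClosed_iInter fun J => hT.preimage (continuous_apply J)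
    · refine isClosed_iInter fun l => isClosed_iInter fun _ => isClosed_iInter fun g =>
        isClosed_eq ?_ continuous_const
      fun_prop
  have hcompact : IsCompact S := by
    refine IsCompact.of_isClosed_subset
      (isCompact_univ_pi fun _ => isCompact_Icc (a := 0) (b := ∑ J, c J)) hclosed ?_
    rintro c' ⟨h1, -, h3⟩ J -
    refine ⟨h1 J, ?_⟩
    rw [← h3.sum_eq hk]
    exact Finset.single_le_sum (fun K _ => h1 K) (Finset.mem_univ J)
  obtain ⟨c', ⟨hc0, hcT', hcm⟩, hmin⟩ := hcompact.exists_isMinOn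
    (f := fun c' => ∑ J, c' J * (wt J : ℝ)) ⟨c, h0, hcT, fun _ _ _ => rfl⟩
    (by fun_prop)
  refine ⟨c', hc0, hcT', ?_, hcm⟩
  have main : ∀ I J, c' I ≠ 0 → c' J ≠ 0 → ∀ a b, a < b → b < k →
      ¬ CrossAt (el I) (el J) a b := by
    intro I J hI hJ a b hab hb hcr
    have hIJ : I ≠ J := by rintro rfl; exact lt_irrefl _ hcr.2.1
    obtain ⟨I', J', hw, hg⟩ := exists_uncross hab hb hcr
    set ε := min (c' I) (c' J) with hε
    have hεpos : 0 < ε := lt_min (lt_of_le_of_ne (hc0 I) hI.symm) (lt_of_le_of_ne (hc0 J) hJ.symm)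
    have hεT : ε ∈ T := by
      rcases min_choice (c' I) (c' J) with h | h
      · rw [hε, h]; exact hcT' I
      · rw [hε, h]; exact hcT' J
    let s : KSubset k n → KSubset k n → ℝ := fun A K => if K = A then ε else 0
    have hs0 : ∀ A K, 0 ≤ s A K := fun A K => by
      simp only [s]; split_ifs
      exacts [hεpos.le, le_rfl]
    have hsT : ∀ A K, s A K ∈ T := fun A K => by
      simp only [s]; split_ifs
      exacts [hεT, T.zero_mem]
    let c'' : KSubset k n → ℝ := fun K => c' K + (s I' K + s J' K) - (s I K + s J K)
    have hsum : ∀ g : KSubset k n → ℝ,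
        ∑ K, c'' K * g K = ∑ K, c' K * g K + ε * ((g I' + g J') - (g I + g J)) := by
      intro g
      simp only [c'', s, sub_mul, add_mul, Finset.sum_sub_distrib, Finset.sum_add_distrib,
        ite_mul, zero_mul, Finset.sum_ite_eq', Finset.mem_univ, if_true]
      ring
    have hmem : c'' ∈ S := by
      refine ⟨fun K => ?_, fun K => ?_, fun l hl g => ?_⟩
      · have h1 : s I K + s J K ≤ c' K := by
          simp only [s]
          by_cases k1 : K = I
          · subst k1; rw [if_pos rfl, if_neg hIJ, add_zero]; exact min_le_left _ _
          · rw [if_neg k1, zero_add]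
            split_ifs with k2
            · subst k2; exact min_le_right _ _
            · exact hc0 K
        have := hs0 I' K
        have := hs0 J' K
        simp only [c'']; linarith
      · exact T.sub_mem (T.add_mem (hcT' K) (T.add_mem (hsT _ _) (hsT _ _)))
          (T.add_mem (hsT _ _) (hsT _ _))
      · rw [hsum, hg l hl g, sub_self, mul_zero, add_zero]
        exact hcm l hl g
    have h1 := hmin hmem
    simp only [Set.mem_ofPred_eq] at h1
    rw [hsum] at h1
    have h2 : (wt I' : ℝ) + wt J' < wt I + wt J := by exact_mod_cast hw
    nlinarith
  intro I J hI hJ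
  rw [noncrossing_iff]
  exact fun a b hab hb => ⟨main I J hI hJ a b hab hb, main J I hJ hI a b hab hb⟩

/-! ### Uniqueness of noncrossing weightings -/

section Joint

variable {ι : Type*} [Fintype ι]

open Classical in
/-- The total weight of the elements where `p` and `q` take the given values. -/
noncomputable def joint (c : ι → ℝ) (p : ι → ℤ) (q : ι → ℕ) (x : ℤ) (z : ℕ) : ℝ :=
  ∑ J, if p J = x ∧ q J = z then c J else 0

theorem exists_of_joint_pos {c : ι → ℝ} {p : ι → ℤ} {q : ι → ℕ} {x : ℤ} {z : ℕ}
    (h : 0 < joint c p q x z) : ∃ J, c J ≠ 0 ∧ p J = x ∧ q J = z := by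
  obtain ⟨J, -, hJ⟩ := Finset.exists_ne_zero_of_sum_ne_zero h.ne'
  by_cases hc : p J = x ∧ q J = z
  · rw [if_pos hc] at hJ; exact ⟨J, hJ, hc⟩
  · rw [if_neg hc] at hJ; exact absurd rfl hJ

theorem joint_nonneg {c : ι → ℝ} (hc : ∀ J, 0 ≤ c J) (p : ι → ℤ) (q : ι → ℕ) (x : ℤ) (z : ℕ) :
    0 ≤ joint c p q x z :=
  Finset.sum_nonneg fun J _ => by split_ifs <;> simp [hc J]

open Classical in
theorem sum_joint_left (c : ι → ℝ) (p : ι → ℤ) (q : ι → ℕ) (z : ℕ) :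
    ∑ x ∈ Finset.univ.image p, joint c p q x z = ∑ J, if q J = z then c J else 0 := by
  unfold joint
  rw [Finset.sum_comm]
  refine Finset.sum_congr rfl fun J _ => ?_
  rw [Finset.sum_eq_single (p J)]
  · simp
  · intro x _ hx; simp [hx.symm]
  · intro h; exact absurd (Finset.mem_image_of_mem _ (Finset.mem_univ J)) h

open Classical in
theorem sum_joint_right (c : ι → ℝ) (p : ι → ℤ) (q : ι → ℕ) (x : ℤ) :
    ∑ z ∈ Finset.univ.image q, joint c p q x z = ∑ J, if p J = x then c J else 0 := by
  unfold joint
  rw [Finset.sum_comm]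
  refine Finset.sum_congr rfl fun J _ => ?_
  rw [Finset.sum_eq_single (q J)]
  · simp
  · intro x _ hx; simp [hx.symm]
  · intro h; exact absurd (Finset.mem_image_of_mem _ (Finset.mem_univ J)) h

-- The corner argument for couplings. An excess of `c` at `(x, z)` must be compensated by an excess
-- of `c'` at some `(x', z)` and at some `(x, z')`. The agreement already known forces `x' < x` and
-- `z < z'`, so the support of `c'` contains an increasing pair, which `hnc` forbids. The element
-- `K` comes from the support of `c`, not of `c'`, and certifies that `(x, z)` is realized by an
-- actual set.
open Classical in
theorem not_joint_lt {c c' : ι → ℝ} {p : ι → ℤ} {q : ι → ℕ}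
    (hc : ∀ J, 0 ≤ c J) (hc' : ∀ J, 0 ≤ c' J)
    (hp : ∀ x, (∑ J, if p J = x then c J else 0) = ∑ J, if p J = x then c' J else 0)
    (hq : ∀ z, (∑ J, if q J = z then c J else 0) = ∑ J, if q J = z then c' J else 0)
    (hnc : ∀ I J K, c' I ≠ 0 → c' J ≠ 0 → p I < p J → p K = p J → q K = q I → q J ≤ q I)
    {x : ℤ} {z : ℕ} (hx : ∀ x', x < x' → joint c p q x' z = joint c' p q x' z)
    (hz : ∀ x', ∀ z' < z, joint c p q x' z' = joint c' p q x' z') :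
    ¬ joint c' p q x z < joint c p q x z := by
  intro hlt
  obtain ⟨K, -, hKp, hKq⟩ := exists_of_joint_pos ((joint_nonneg hc' p q x z).trans_lt hlt)
  obtain ⟨x', -, hx'⟩ : ∃ x' ∈ Finset.univ.image p, joint c p q x' z < joint c' p q x' z := by
    by_contra! hcon
    have := Finset.sum_lt_sum hcon
      ⟨x, Finset.mem_image.2 ⟨K, Finset.mem_univ _, hKp⟩, hlt⟩
    rw [sum_joint_left, sum_joint_left, hq] at this
    exact lt_irrefl _ this
  obtain ⟨z', -, hz'⟩ : ∃ z' ∈ Finset.univ.image q, joint c p q x z' < joint c' p q x z' := by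
    by_contra! hcon
    have := Finset.sum_lt_sum hcon
      ⟨z, Finset.mem_image.2 ⟨K, Finset.mem_univ _, hKq⟩, hlt⟩
    rw [sum_joint_right, sum_joint_right, hp] at this
    exact lt_irrefl _ this
  have h1 : x' < x := by
    rcases lt_trichotomy x' x with h | rfl | h
    · exact h
    · exact absurd hx' hlt.not_gt
    · exact absurd hx' (hx x' h).not_lt
  have h2 : z < z' := by
    rcases lt_trichotomy z' z with h | rfl | h
    · exact absurd hz' (hz x z' h).not_lt
    · exact absurd hz' hlt.not_gt
    · exact h
  obtain ⟨I, hI, hIp, hIq⟩ := exists_of_joint_pos ((joint_nonneg hc p q x' z).trans_lt hx')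
  obtain ⟨J, hJ, hJp, hJq⟩ := exists_of_joint_pos ((joint_nonneg hc p q x z').trans_lt hz')
  have := hnc I J K hI hJ (by omega) (by omega) (by omega)
  omega

open Classical in
/-- A weighting without crossings is determined by its two marginals. -/
theorem joint_eq {c c' : ι → ℝ} {p : ι → ℤ} {q : ι → ℕ}
    (hc : ∀ J, 0 ≤ c J) (hc' : ∀ J, 0 ≤ c' J)
    (hp : ∀ x, (∑ J, if p J = x then c J else 0) = ∑ J, if p J = x then c' J else 0)
    (hq : ∀ z, (∑ J, if q J = z then c J else 0) = ∑ J, if q J = z then c' J else 0)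
    (hnc : ∀ I J K, c I ≠ 0 → c J ≠ 0 → p I < p J → p K = p J → q K = q I → q J ≤ q I)
    (hnc' : ∀ I J K, c' I ≠ 0 → c' J ≠ 0 → p I < p J → p K = p J → q K = q I → q J ≤ q I)
    (x : ℤ) (z : ℕ) : joint c p q x z = joint c' p q x z := by
  -- At the least `z` with a discrepancy, the largest discrepant `x` is a corner to which
  -- `not_joint_lt` applies, whichever side is larger.
  induction z using Nat.strong_induction_on generalizing x with
  | _ z ihz =>
    by_contra hne
    let B := (Finset.univ.image p).filter fun x => joint c p q x z ≠ joint c' p q x z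
    have hB : ∀ x, joint c p q x z ≠ joint c' p q x z → x ∈ B := by
      intro x hx
      refine Finset.mem_filter.2 ⟨?_, hx⟩
      by_contra hx'
      apply hx
      unfold joint
      refine Finset.sum_congr rfl fun J _ => ?_
      have : p J ≠ x := fun h => hx' (Finset.mem_image.2 ⟨J, Finset.mem_univ _, h⟩)
      simp [this]
    obtain ⟨y, hyB, hy⟩ := Finset.exists_max_image B id ⟨x, hB x hne⟩
    have hmax : ∀ x', y < x' → joint c p q x' z = joint c' p q x' z := by
      intro x' hx'
      by_contra h
      exact absurd (hy x' (hB x' h)) (not_le.2 hx')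
    rcases lt_or_gt_of_ne (Finset.mem_filter.1 hyB).2 with h | h
    · exact not_joint_lt hc' hc (fun x => (hp x).symm) (fun z => (hq z).symm) hnc
        (fun x' h => (hmax x' h).symm) (fun x' z' h => (ihz z' h x').symm) h
    · exact not_joint_lt hc hc' hp hq hnc' hmax (fun x' z' h => ihz z' h x') h

end Joint

/-- If both the prefix code and the `b`-th element increased from `I` to `J`, then `I` and `J` would
cross at `(a, b)`, with `a` the last disagreement of the prefixes. The middle inequality `j_a < i_b`
is read off from `K`, which has the prefix of `J` and the `b`-th element of `I`. -/
theorem NCSupport.el_le_of_code_lt {c : KSubset k n → ℝ} (hnc : NCSupport c) {b : ℕ} (hb : b < k)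
    (I J K : KSubset k n) (hI : c I ≠ 0) (hJ : c J ≠ 0) (hIJ : code b I < code b J)
    (hKJ : code b K = code b J) (hKI : el K b = el I b) : el J b ≤ el I b := by
  obtain ⟨a, hab, hlt, he⟩ := exists_of_code_lt hIJ
  by_contra! hgt
  refine (noncrossing_iff.1 (hnc I J hI hJ) a b hab hb).1 ⟨he, hlt, ?_, hgt⟩
  rw [← hKI, ← code_eq_iff.1 hKJ a hab]
  exact el_lt_el K hab hb

open Classical in
/-- A noncrossing weighting is determined by its marginals. -/
theorem eq_of_sameMarginals (hk : 0 < k) {c c' : KSubset k n → ℝ} (h0 : ∀ J, 0 ≤ c J)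
    (h0' : ∀ J, 0 ≤ c' J) (hnc : NCSupport c) (hnc' : NCSupport c') (hm : SameMarginals c c') :
    c = c' := by
  -- Induction on the prefix length: `joint_eq` recovers the joint distribution of a prefix and the
  -- next element from the two marginals, and this is the distribution of the longer prefix.
  have key : ∀ b ≤ k, ∀ x, (∑ J, if code b J = x then c J else 0) =
      ∑ J, if code b J = x then c' J else 0 := by
    intro b
    induction b with
    | zero =>
      intro _ x
      by_cases hx : (0 : ℤ) = x
      · simpa [code, hx] using hm.sum_eq hk
      · simp [code, hx]
    | succ b ih =>
      intro hb x
      have hq : ∀ z : ℕ, (∑ J, if el J b = z then c J else 0) =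
          ∑ J, if el J b = z then c' J else 0 := by
        intro z
        simpa using hm b hb fun t => if t = z then 1 else 0
      have hj := joint_eq h0 h0' (ih (by omega)) hq (hnc.el_le_of_code_lt hb)
        (hnc'.el_le_of_code_lt hb)
      by_cases hx : ∃ K : KSubset k n, code (b + 1) K = x
      · obtain ⟨K, rfl⟩ := hx
        have e : ∀ J : KSubset k n, code (b + 1) J = code (b + 1) K ↔
            code b J = code b K ∧ el J b = el K b := by
          intro J
          rw [code_eq_iff, code_eq_iff]
          constructor
          · exact fun h => ⟨fun l hl => h l (by omega), h b (by omega)⟩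
          · rintro ⟨h1, h2⟩ l hl
            rcases Nat.lt_succ_iff_lt_or_eq.1 hl with h3 | rfl
            exacts [h1 l h3, h2]
        simp only [e]
        exact hj _ _
      · push Not at hx
        simp [hx]
  funext K
  have hK := key k le_rfl (code k K)
  have e : ∀ J : KSubset k n, code k J = code k K ↔ J = K :=
    fun J => ⟨fun h => ext_el (code_eq_iff.1 h), fun h => by rw [h]⟩
  simpa [e] using hK

/-! ### Arrays and linear combinations of the vectors `f` -/

/-- The linear combination of the vectors `f q` with given coefficients. -/
noncomputable def fsum : Grid k n →ₗ[ℝ] Grid k n := Fintype.linearCombination ℝ f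

theorem fsum_def (a : Grid k n) : fsum a = ∑ q, a q • f q :=
  Fintype.linearCombination_apply ℝ f a

/-- `f q` has `+1` in its own column and `-1` in the cyclically next one, so `fsum` takes cyclic
differences along rows. Hence its kernel consists of the arrays that are constant along rows. -/
theorem fsum_apply_rotate (a : Grid k n) (i : Fin (k - 1)) (j : Fin (n - k)) :
    fsum a (i, finRotate _ j) = a (i, finRotate _ j) - a (i, j) := by
  classical
  simp only [fsum_def, Finset.sum_apply, Pi.smul_apply, f, e, Pi.sub_apply, smul_eq_mul, mul_sub,
    Finset.sum_sub_distrib, Pi.single_apply, mul_ite, mul_one, mul_zero]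
  congr 1
  · simp
  · rw [Finset.sum_eq_single (i, j)]
    · simp
    · rintro ⟨i', j'⟩ - hne
      rw [if_neg]
      intro h
      simp only [Prod.mk.injEq, EmbeddingLike.apply_eq_iff_eq] at h
      exact hne (by rw [h.1, h.2])
    · intro h; exact absurd (Finset.mem_univ _) h

theorem forall_eq_of_rotate {m : ℕ} {b : Fin m → ℝ} (h : ∀ j, b (finRotate m j) = b j)
    (j j' : Fin m) : b j = b j' := by
  obtain _ | m := m
  · exact j.elim0
  have key : ∀ t (ht : t < m + 1), b ⟨t, ht⟩ = b 0 := by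
    intro t
    induction t with
    | zero => intro _; rfl
    | succ t ih =>
      intro ht
      rw [← ih (by omega), ← h ⟨t, by omega⟩, finRotate_of_lt (by omega)]
  exact (key j j.2).trans (key j' j'.2).symm

theorem fsum_eq_zero_iff {a : Grid k n} : fsum a = 0 ↔ ∀ i j j', a (i, j) = a (i, j') := by
  constructor
  · intro h i
    apply forall_eq_of_rotate
    intro j
    have := congrFun h (i, finRotate _ j)
    rw [fsum_apply_rotate, Pi.zero_apply, sub_eq_zero] at this
    exact this
  · intro h
    funext ⟨i, j⟩
    obtain ⟨j, rfl⟩ := (finRotate (n - k)).surjective j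
    rw [fsum_apply_rotate, h i _ j, sub_self]; rfl

theorem f_mem_rowZero (q : Fin (k - 1) × Fin (n - k)) : f q ∈ rowZero k n := by
  intro i
  simp only [f, e, Pi.sub_apply, Finset.sum_sub_distrib, Pi.single_apply, Prod.mk.injEq]
  by_cases h : i = q.1
  · simp [h, Prod.ext_iff]
  · simp [h, Prod.ext_iff]

theorem fsum_mem_rowZero (a : Grid k n) : fsum a ∈ rowZero k n := by
  rw [fsum_def]
  exact Submodule.sum_mem _ fun q _ => Submodule.smul_mem _ _ (f_mem_rowZero q)

theorem sum_ite_le_sub (h : ℕ → ℝ) {l K : ℕ} (hl : l ≤ K) :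
    ∑ i ∈ Finset.range K, (if l ≤ i then h i - h (i + 1) else 0) = h l - h K := by
  induction K, hl using Nat.le_induction with
  | base =>
    rw [sub_self]
    refine Finset.sum_eq_zero fun i hi => if_neg ?_
    rw [Finset.mem_range] at hi; omega
  | succ K hK ih => rw [Finset.sum_range_succ, ih, if_pos hK]; ring

theorem sum_ite_ge_sub (h : ℕ → ℝ) {c m : ℕ} (hc : c < m) :
    ∑ i ∈ Finset.range m, (if i ≤ c then h i - (if i = 0 then 0 else h (i - 1)) else 0) = h c := by
  have key : ∀ c, ∑ i ∈ Finset.range (c + 1), (h i - (if i = 0 then 0 else h (i - 1))) = h c := by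
    intro c
    induction c with
    | zero => simp
    | succ c ih => rw [Finset.sum_range_succ, ih]; simp
  rw [← key c, ← Finset.sum_filter]
  apply Finset.sum_congr _ fun _ _ => rfl
  ext i; simp only [Finset.mem_filter, Finset.mem_range]; omega

theorem coe_finRotate_cases {m : ℕ} (j : Fin m) :
    ((finRotate m j : ℕ) = j + 1 ∧ (j : ℕ) + 1 < m) ∨
      ((finRotate m j : ℕ) = 0 ∧ (j : ℕ) + 1 = m) := by
  obtain _ | m := m
  · exact j.elim0
  rw [coe_finRotate]
  split_ifs with h
  · right; rw [h]; simp
  · left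
    have : (j : ℕ) ≠ m := fun h' => h (Fin.ext h')
    omega

theorem exists_fsum_eq {y : Grid k n} (hy : y ∈ rowZero k n) : ∃ a, fsum a = y := by
  -- Partial row sums; the vanishing of the full row sum makes the difference correct at the
  -- wraparound.
  refine ⟨fun q => ∑ j, if j ≤ q.2 then y (q.1, j) else 0, ?_⟩
  funext ⟨i, j⟩
  obtain ⟨j, rfl⟩ := (finRotate (n - k)).surjective j
  rw [fsum_apply_rotate]
  simp only
  rcases coe_finRotate_cases j with ⟨h1, h2⟩ | ⟨h1, h2⟩
  · rw [← Finset.sum_sub_distrib, Finset.sum_eq_single (finRotate (n - k) j)]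
    · rw [if_pos le_rfl, if_neg (by rw [Fin.le_def]; omega), sub_zero]
    · intro b _ hb
      have : (b : ℕ) ≠ finRotate (n - k) j := fun h => hb (Fin.ext h)
      by_cases hbj : b ≤ j
      · rw [if_pos hbj, if_pos (by rw [Fin.le_def] at *; omega), sub_self]
      · rw [if_neg hbj, if_neg (by rw [Fin.le_def] at *; omega), sub_self]
    · intro h; exact absurd (Finset.mem_univ _) h
  · have e1 : (∑ b, if b ≤ j then y (i, b) else 0) = ∑ b, y (i, b) :=
      Finset.sum_congr rfl fun b _ => if_pos (by rw [Fin.le_def]; omega)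
    rw [e1, hy i, sub_zero, Finset.sum_eq_single (finRotate (n - k) j)]
    · rw [if_pos le_rfl]
    · intro b _ hb
      have : (b : ℕ) ≠ finRotate (n - k) j := fun h => hb (Fin.ext h)
      exact if_neg (by rw [Fin.le_def]; omega)
    · intro h; exact absurd (Finset.mem_univ _) h

/-- The space of real `k × (n - k)` arrays. -/
abbrev Arr (k n : ℕ) : Type := Fin k × Fin (n - k) → ℝ

/-- Differences of consecutive rows. -/
def rowDiff : Arr k n →ₗ[ℝ] Grid k n where
  toFun F q := F (⟨q.1, by omega⟩, q.2) - F (⟨q.1 + 1, by omega⟩, q.2)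
  map_add' F F' := by funext q; simp; ring
  map_smul' r F := by funext q; simp; ring

theorem rowDiff_apply (F : Arr k n) (q : Fin (k - 1) × Fin (n - k)) :
    rowDiff F q = F (⟨q.1, by omega⟩, q.2) - F (⟨q.1 + 1, by omega⟩, q.2) := rfl

/-- The indicator array of the order filter that corresponds to `J`. -/
noncomputable def filt (J : KSubset k n) : Arr k n := fun p =>
  if el J p.1 ≤ p.2 + p.1 then 1 else 0

/-- The filter rows are nested, and `cells J` collects the places that lie in one row of the filter
but not in the next. This makes `v J` a linear image of `filt J`. -/
theorem rowDiff_filt (J : KSubset k n) (q : Fin (k - 1) × Fin (n - k)) :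
    rowDiff (filt J) q = if q ∈ cells J then 1 else 0 := by
  have h := el_lt_el J (a := q.1) (b := q.1 + 1) (by omega) (by omega)
  rw [rowDiff_apply]
  simp only [filt, cells, Finset.mem_filter, Finset.mem_univ, true_and]
  rw [← el_of_lt, ← el_of_lt]
  by_cases h1 : el J q.1 ≤ q.2 + q.1 <;> by_cases h2 : el J (q.1 + 1) ≤ q.2 + (q.1 + 1)
  · rw [if_pos h1, if_pos h2, if_neg (by omega)]; norm_num
  · rw [if_pos h1, if_neg h2, if_pos (by omega)]; norm_num
  · omega
  · rw [if_neg h1, if_neg h2, if_neg (by omega)]; norm_num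

theorem v_eq_fsum (J : KSubset k n) : v J = fsum (rowDiff (filt J)) := by
  simp only [fsum_def, rowDiff_filt, ite_smul, one_smul, zero_smul]
  rw [Finset.sum_ite_mem, Finset.univ_inter]
  rfl

/-- The linear combination of the vectors `v J` with given coefficients. -/
noncomputable def comb : (KSubset k n → ℝ) →ₗ[ℝ] Grid k n := Fintype.linearCombination ℝ v

theorem comb_def (c : KSubset k n → ℝ) : comb c = ∑ J, c J • v J :=
  Fintype.linearCombination_apply ℝ v c

/-- The linear combination of the arrays `filt J` with given coefficients. -/
noncomputable def filtComb : (KSubset k n → ℝ) →ₗ[ℝ] Arr k n := Fintype.linearCombination ℝ filt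

theorem filtComb_def (c : KSubset k n → ℝ) : filtComb c = ∑ J, c J • filt J :=
  Fintype.linearCombination_apply ℝ filt c

theorem filtComb_apply (c : KSubset k n → ℝ) (p : Fin k × Fin (n - k)) :
    filtComb c p = ∑ J, c J * filt J p := by
  simp [filtComb_def]

theorem comb_eq (c : KSubset k n → ℝ) : comb c = fsum (rowDiff (filtComb c)) := by
  simp only [comb_def, filtComb_def, v_eq_fsum, map_sum, map_smul]

theorem comb_mem_rowZero (c : KSubset k n → ℝ) : comb c ∈ rowZero k n := by
  rw [comb_eq]; exact fsum_mem_rowZero _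

theorem SameMarginals.filtComb_eq {c c' : KSubset k n → ℝ} (h : SameMarginals c c') :
    filtComb c = filtComb c' := by
  funext p
  rw [filtComb_apply, filtComb_apply]
  exact h p.1 p.1.2 fun t => if t ≤ p.2 + p.1 then 1 else 0

/-- Row `l` of `filtComb c` is the cumulative distribution of the `l`-th element on its range from
`l` to `n - k + l`, except for the last value, which is the total mass. Differences give the point
masses, and these determine the sum against every `g`. -/
theorem sameMarginals_of_filtComb_eq {c c' : KSubset k n → ℝ} (hF : filtComb c = filtComb c')
    (hs : ∑ J, c J = ∑ J, c' J) : SameMarginals c c' := by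
  classical
  intro l hl g
  rw [← sub_eq_zero, ← Finset.sum_sub_distrib]
  have hle : ∀ q : ℕ, ∑ J, (c J - c' J) * (if el J l ≤ q then 1 else 0) = 0 := by
    intro q
    by_cases h1 : q < l
    · refine Finset.sum_eq_zero fun J _ => ?_
      have := le_el J hl
      rw [if_neg (by omega), mul_zero]
    by_cases h2 : n - k + l ≤ q
    · rw [← sub_eq_zero, ← Finset.sum_sub_distrib] at hs
      rw [← hs]
      refine Finset.sum_congr rfl fun J _ => ?_
      have := el_le_add J hl
      rw [if_pos (by omega), mul_one]
    · have := congrFun hF (⟨l, hl⟩, ⟨q - l, by omega⟩)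
      rw [filtComb_apply, filtComb_apply, ← sub_eq_zero, ← Finset.sum_sub_distrib] at this
      refine (Finset.sum_congr rfl fun J _ => ?_).trans this
      have e : q - l + l = q := by omega
      simp only [filt, e]; ring
  have heq : ∀ q : ℕ, ∑ J, (c J - c' J) * (if el J l = q then 1 else 0) = 0 := by
    intro q
    obtain _ | q := q
    · refine (Finset.sum_congr rfl fun J _ => ?_).trans (hle 0)
      simp
    · have := congrArg₂ (· - ·) (hle (q + 1)) (hle q)
      simp only [sub_self, ← Finset.sum_sub_distrib] at this
      refine (Finset.sum_congr rfl fun J _ => ?_).trans this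
      rw [← mul_sub]
      congr 1
      split_ifs <;> first | omega | norm_num
  have expand : ∀ J : KSubset k n, c J * g (el J l) - c' J * g (el J l) =
      ∑ q ∈ Finset.range (n + 1), g q * ((c J - c' J) * (if el J l = q then 1 else 0)) := by
    intro J
    rw [Finset.sum_eq_single (el J l)]
    · simp; ring
    · intro q _ hq; rw [if_neg hq.symm]; ring
    · intro h
      have := el_le J l
      rw [Finset.mem_range] at h; omega
  simp only [expand]
  rw [Finset.sum_comm]
  refine Finset.sum_eq_zero fun q _ => ?_
  rw [← Finset.mul_sum, heq, mul_zero]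

/-! ### Frozen subsets -/

/-- `J` is the interval that starts at `c`. -/
def IsCol (J : KSubset k n) (c : ℕ) : Prop := ∀ l < k, el J l = c + l

/-- `J` consists of the first `p` and the last `k - p` elements. -/
def IsRow (J : KSubset k n) (p : ℕ) : Prop := ∀ l < k, el J l = if l < p then l else n - k + l

theorem exists_isCol (hkn : k ≤ n) {c : ℕ} (hc : c ≤ n - k) : ∃ J : KSubset k n, IsCol J c :=
  exists_el _ (fun l _ => by omega) (fun l hl => by omega)

theorem exists_isRow (hkn : k ≤ n) (p : ℕ) : ∃ J : KSubset k n, IsRow J p :=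
  exists_el _ (fun l _ => by split_ifs <;> omega) (fun l hl => by split_ifs <;> omega)

theorem mem_iff_exists_el (J : KSubset k n) (x : Fin n) : x ∈ J.1 ↔ ∃ l < k, el J l = x := by
  rw [mem_iff_exists_elt]
  constructor
  · rintro ⟨a, rfl⟩; exact ⟨a, a.2, el_val J a⟩
  · rintro ⟨l, hl, h⟩
    rw [el_of_lt J hl] at h
    exact ⟨⟨l, hl⟩, Fin.ext h⟩

theorem eq_of_mem_iff {I J : KSubset k n} (h : ∀ x, x ∈ I.1 ↔ x ∈ J.1) : I = J :=
  Subtype.ext (Finset.ext h)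

theorem IsCol.mem_iff {J : KSubset k n} {c : ℕ} (h : IsCol J c) (x : Fin n) :
    x ∈ J.1 ↔ c ≤ x ∧ (x : ℕ) < c + k := by
  rw [mem_iff_exists_el]
  constructor
  · rintro ⟨l, hl, hx⟩; rw [h l hl] at hx; omega
  · intro hx; exact ⟨x - c, by omega, by rw [h _ (by omega)]; omega⟩

theorem IsRow.mem_iff {J : KSubset k n} {p : ℕ} (hpk : p ≤ k) (hkn : k ≤ n)
    (h : IsRow J p) (x : Fin n) : x ∈ J.1 ↔ (x : ℕ) < p ∨ n - k + p ≤ x := by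
  rw [mem_iff_exists_el]
  constructor
  · rintro ⟨l, hl, hx⟩; rw [h l hl] at hx; split_ifs at hx <;> omega
  · rintro (hx | hx)
    · exact ⟨x, by omega, by rw [h _ (by omega), if_pos hx]⟩
    · have := x.2
      exact ⟨x - (n - k), by omega, by rw [h _ (by omega), if_neg (by omega)]; omega⟩

theorem IsCol.frozen {J : KSubset k n} {c : ℕ} (h : IsCol J c) (hc : c ≤ n - k) (hkn : k ≤ n) :
    Frozen J := by
  refine ⟨c, fun x => ?_⟩
  rw [h.mem_iff]
  constructor
  · intro hx
    refine ⟨x - c, by omega, ?_⟩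
    rw [Nat.mod_eq_of_lt] <;> omega
  · rintro ⟨t, ht, hx⟩
    rw [Nat.mod_eq_of_lt (by omega)] at hx
    omega

theorem mod_eq_sub_of_le {a n : ℕ} (h1 : n ≤ a) (h2 : a < 2 * n) : a % n = a - n := by
  rw [Nat.mod_eq_sub_mod h1, Nat.mod_eq_of_lt (by omega)]

theorem IsRow.frozen {J : KSubset k n} {p : ℕ} (h : IsRow J p) (hpk : p < k)
    (hkn : k ≤ n) : Frozen J := by
  refine ⟨n - k + p, fun x => ?_⟩
  rw [h.mem_iff hpk.le hkn]
  have hxn := x.2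
  constructor
  · rintro (hx | hx)
    · refine ⟨x + (k - p), by omega, ?_⟩
      rw [mod_eq_sub_of_le] <;> omega
    · refine ⟨x - (n - k + p), by omega, ?_⟩
      rw [Nat.mod_eq_of_lt] <;> omega
  · rintro ⟨t, ht, hx⟩
    by_cases hlt : n - k + p + t < n
    · rw [Nat.mod_eq_of_lt hlt] at hx; omega
    · rw [mod_eq_sub_of_le (by omega) (by omega)] at hx; omega

theorem Frozen.isCol_or_isRow {J : KSubset k n} (h : Frozen J) (hkn : k ≤ n) (hn : 0 < n) :
    (∃ c ≤ n - k, IsCol J c) ∨ ∃ p < k, IsRow J p := by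
  obtain ⟨s, hs⟩ := h
  wlog hsn : s < n generalizing s
  · refine this (s % n) (fun x => ?_) (Nat.mod_lt _ hn)
    rw [hs x]
    simp only [Nat.mod_add_mod]
  by_cases hsk : s + k ≤ n
  · left
    refine ⟨s, by omega, ?_⟩
    obtain ⟨J', hJ'⟩ := exists_isCol (k := k) hkn (c := s) (by omega)
    have : J = J' := by
      apply eq_of_mem_iff
      intro x
      rw [hs, hJ'.mem_iff]
      constructor
      · rintro ⟨t, ht, hx⟩
        rw [Nat.mod_eq_of_lt (by omega)] at hx; omega
      · intro hx
        refine ⟨x - s, by omega, ?_⟩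
        rw [Nat.mod_eq_of_lt] <;> omega
    rwa [this]
  · right
    refine ⟨s + k - n, by omega, ?_⟩
    obtain ⟨J', hJ'⟩ := exists_isRow (k := k) hkn (s + k - n)
    have : J = J' := by
      apply eq_of_mem_iff
      intro x
      rw [hs, hJ'.mem_iff (by omega) hkn]
      have hxn := x.2
      constructor
      · rintro ⟨t, ht, hx⟩
        by_cases hlt : s + t < n
        · rw [Nat.mod_eq_of_lt hlt] at hx; omega
        · rw [mod_eq_sub_of_le (by omega) (by omega)] at hx; omega
      · rintro (hx | hx)
        · refine ⟨x + (n - s), by omega, ?_⟩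
          rw [mod_eq_sub_of_le] <;> omega
        · refine ⟨x - s, by omega, ?_⟩
          rw [Nat.mod_eq_of_lt] <;> omega
    rwa [this]

/-- A crossing at `a < b` forces gaps after `a` in one set and before `b` in the other one. -/
theorem CrossAt.gaps {I J : KSubset k n} {a b : ℕ} (hab : a < b) (hb : b < k)
    (h : CrossAt (el I) (el J) a b) :
    el I a + 1 < el I (a + 1) ∧ el J (b - 1) + 1 < el J b := by
  obtain ⟨h0, h1, h2, h3⟩ := h
  rcases Nat.lt_or_ge (a + 1) b with hlt | hge
  · have e1 := h0 (a + 1) (by omega) hlt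
    have e2 := h0 (b - 1) (by omega) (by omega)
    have := el_lt_el J (lt_add_one a) (by omega)
    have := el_lt_el I (a := b - 1) (b := b) (by omega) hb
    omega
  · obtain rfl : b = a + 1 := by omega
    simp only [Nat.add_sub_cancel]
    omega

/-- By `CrossAt.gaps` a crossing needs a gap in `J`. An interval has none. In the wrapped case the
elements before the only gap are as small as possible and those after it as large as possible, which
contradicts an outer inequality of the crossing. -/
theorem Frozen.noncrossing {J : KSubset k n} (h : Frozen J) (hkn : k ≤ n) (hn : 0 < n)
    (I : KSubset k n) : Noncrossing J I := by
  rw [noncrossing_iff]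
  intro a b hab hb
  rcases h.isCol_or_isRow hkn hn with ⟨c, -, hc⟩ | ⟨p, hp, hr⟩
  · constructor <;> intro hcr
    · have := (hcr.gaps hab hb).1
      rw [hc _ (by omega), hc _ (by omega)] at this; omega
    · have := (hcr.gaps hab hb).2
      rw [hc _ (by omega), hc _ (by omega)] at this; omega
  · constructor <;> intro hcr
    · have g := (hcr.gaps hab hb).1
      have h3 := hcr.2.2.2
      have := el_le_add I hb
      rw [hr b hb] at h3
      rw [hr _ (by omega), hr _ (by omega)] at g
      split_ifs at * <;> omega
    · have g := (hcr.gaps hab hb).2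
      have h1 := hcr.2.1
      have := le_el I (hab.trans hb)
      rw [hr a (by omega)] at h1
      rw [hr _ (by omega), hr _ (by omega)] at g
      split_ifs at * <;> omega

theorem IsCol.filt_apply {J : KSubset k n} {c : ℕ} (h : IsCol J c) (p : Fin k × Fin (n - k)) :
    filt J p = if c ≤ p.2 then 1 else 0 := by
  simp only [filt, h p.1 p.1.2, add_le_add_iff_right]

theorem IsRow.filt_apply {J : KSubset k n} {r : ℕ} (h : IsRow J r) (p : Fin k × Fin (n - k)) :
    filt J p = if (p.1 : ℕ) < r then 1 else 0 := by
  simp only [filt, h p.1 p.1.2]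
  have := p.2.2
  split_ifs <;> first | rfl | omega

/-- The array of a frozen set depends on the row only or on the column only, so its row differences
are constant along rows. -/
theorem Frozen.v_eq_zero {J : KSubset k n} (h : Frozen J) (hkn : k ≤ n) (hn : 0 < n) :
    v J = 0 := by
  rw [v_eq_fsum, fsum_eq_zero_iff]
  intro i j j'
  rw [rowDiff_apply, rowDiff_apply]
  rcases h.isCol_or_isRow hkn hn with ⟨c, -, hc⟩ | ⟨p, hp, hr⟩
  · simp only [hc.filt_apply, sub_self]
  · simp only [hr.filt_apply]

/-- A first element this large forces the last interval. Consequently the filter of a nonfrozen set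
contains the corner, so the corner entry counts total mass. -/
theorem el_zero_lt_of_nonfrozen {J : KSubset k n} (h : J ∈ nonfrozen k n) (hkn : k ≤ n) :
    el J 0 < n - k := by
  by_contra! h0
  refine h (IsCol.frozen (c := n - k) (fun l hl => ?_) le_rfl hkn)
  have h1 := el_add_le J (Nat.zero_le l) hl
  have h2 := el_le_add J hl
  omega

/-! ### Coordinates adapted to the frozen subsets -/

/-- The last column. -/
def lastCol (hn : k < n) : Fin (n - k) := ⟨n - k - 1, by omega⟩

/-- The last row. -/
def lastRow (hk : 0 < k) : Fin k := ⟨k - 1, by omega⟩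

/-- The coordinates of an array modulo those of the frozen subsets. -/
def coordY (hn : k < n) (F : Arr k n) : Fin (k - 1) × Fin (n - k - 1) → ℝ := fun q =>
  rowDiff F (q.1, Fin.castLE (Nat.sub_le _ _) q.2) - rowDiff F (q.1, lastCol hn)

/-- The differences in the last column. -/
def coordB (hn : k < n) (F : Arr k n) : Fin (k - 1) → ℝ := fun l => rowDiff F (l, lastCol hn)

/-- The differences in the last row. -/
def coordA (hk : 0 < k) (F : Arr k n) : Fin (n - k) → ℝ := fun c =>
  F (lastRow hk, c) - if (c : ℕ) = 0 then 0 else F (lastRow hk, ⟨c - 1, by omega⟩)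

/-- The array with given coordinates. -/
noncomputable def recon (y : Fin (k - 1) × Fin (n - k - 1) → ℝ) (b : Fin (k - 1) → ℝ)
    (a : Fin (n - k) → ℝ) : Arr k n := fun p =>
  (∑ l : Fin (k - 1), if (p.1 : ℕ) ≤ l then
      (if h : (p.2 : ℕ) < n - k - 1 then y (l, ⟨p.2, h⟩) else 0) + b l else 0) +
    ∑ c : Fin (n - k), if c ≤ p.2 then a c else 0

/-- Telescoping down the column `c` to the last row, and then along the last row to its start. -/
theorem recon_coord (hk : 0 < k) (hn : k < n) (F : Arr k n) :
    recon (coordY hn F) (coordB hn F) (coordA hk F) = F := by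
  funext ⟨l, c⟩
  let hr : ℕ → ℝ := fun i => if h : i < k then F (⟨i, h⟩, c) else 0
  let hc : ℕ → ℝ := fun i => if h : i < n - k then F (lastRow hk, ⟨i, h⟩) else 0
  have e1 := sum_ite_le_sub hr (l := l) (K := k - 1) (by omega)
  have e2 := sum_ite_ge_sub hc c.2
  rw [← Fin.sum_univ_eq_sum_range (fun i => if (l : ℕ) ≤ i then hr i - hr (i + 1) else 0)] at e1
  rw [← Fin.sum_univ_eq_sum_range (fun i => if i ≤ (c : ℕ) then
    hc i - (if i = 0 then 0 else hc (i - 1)) else 0)] at e2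
  have e3 : hr l - hr (k - 1) + hc c = F (l, c) := by
    simp only [hr, hc, dif_pos l.2, dif_pos c.2, dif_pos (show k - 1 < k by omega), lastRow]
    ring
  rw [← e3, ← e1, ← e2]
  unfold recon
  congr 1
  · refine Finset.sum_congr rfl fun i _ => if_congr Iff.rfl ?_ rfl
    have h1 : hr i - hr (i + 1) = rowDiff F (i, c) := by
      simp only [hr, dif_pos (show (i : ℕ) < k by omega), dif_pos (show (i : ℕ) + 1 < k by omega),
        rowDiff_apply]
    rw [h1]
    simp only [coordY, coordB]
    split_ifs with h
    · simp
    · have : c = lastCol hn := Fin.ext (by simp only [lastCol]; omega)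
      rw [this, zero_add]
  · refine Finset.sum_congr rfl fun i _ => if_congr Iff.rfl ?_ rfl
    have : (i : ℕ) - 1 < n - k := by omega
    simp only [coordA, hc, dif_pos i.2, dif_pos this]

/-- The coordinates `coordB` and `coordA` of `Z` are its coefficients on the frozen row and column
filters, since `coordY` vanishes by `hZ`. -/
theorem exists_frozen_combination (hk : 0 < k) (hn : k < n) (Z : Arr k n)
    (hZ : ∀ l c c', rowDiff Z (l, c) = rowDiff Z (l, c')) (t : ℝ) :
    ∃ r : KSubset k n → ℝ, (∀ J, r J ≠ 0 → Frozen J) ∧ filtComb r = Z ∧ ∑ J, r J = t := by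
  classical
  choose R hR using fun l : Fin (k - 1) => exists_isRow (k := k) hn.le ((l : ℕ) + 1)
  choose C hC using fun c : Fin (n - k) => exists_isCol (k := k) hn.le c.2.le
  -- The last interval has the zero array, so its coefficient can be used to adjust the total mass
  -- to `t`.
  obtain ⟨O, hO⟩ := exists_isCol (k := k) hn.le le_rfl
  set b := coordB hn Z
  set a := coordA hk Z
  have hrec := recon_coord hk hn Z
  have hy : coordY hn Z = 0 := by
    funext q; simp only [coordY, Pi.zero_apply, hZ q.1 _ (lastCol hn), sub_self]
  rw [hy] at hrec
  let r : KSubset k n → ℝ := ∑ l, b l • Pi.single (R l) 1 + ∑ c, a c • Pi.single (C c) 1 +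
    (t - ∑ l, b l - ∑ c, a c) • Pi.single O 1
  have hlin : ∀ {E : Type} [AddCommGroup E] [Module ℝ E] (L : (KSubset k n → ℝ) →ₗ[ℝ] E),
      L r = ∑ l, b l • L (Pi.single (R l) 1) + ∑ c, a c • L (Pi.single (C c) 1) +
        (t - ∑ l, b l - ∑ c, a c) • L (Pi.single O 1) := by
    intro E _ _ L
    simp only [r, map_add, map_sum, map_smul]
  have hf : ∀ J : KSubset k n, filtComb (Pi.single J (1 : ℝ)) = filt J := by
    intro J
    simp [filtComb]
  refine ⟨r, fun J hJ => ?_, ?_, ?_⟩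
  · by_contra hfr
    apply hJ
    have h1 : ∀ I : KSubset k n, Frozen I → (Pi.single I (1 : ℝ) : KSubset k n → ℝ) J = 0 := by
      intro I hI
      exact Pi.single_eq_of_ne (by rintro rfl; exact hfr hI) _
    have := hlin (LinearMap.proj J : (KSubset k n → ℝ) →ₗ[ℝ] ℝ)
    simp only [LinearMap.proj_apply] at this
    rw [this, h1 O (hO.frozen le_rfl hn.le), Finset.sum_eq_zero, Finset.sum_eq_zero]
    · simp
    · intro c _
      rw [h1 _ ((hC c).frozen c.2.le hn.le), smul_zero]
    · intro l _
      rw [h1 _ ((hR l).frozen (by omega) hn.le), smul_zero]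
  · rw [hlin, hf, ← hrec]
    funext p
    simp only [Pi.add_apply, Finset.sum_apply, Pi.smul_apply, hf, (hR _).filt_apply,
      (hC _).filt_apply, hO.filt_apply, recon, smul_eq_mul]
    rw [if_neg (by omega), mul_zero, add_zero]
    congr 1
    · refine Finset.sum_congr rfl fun l _ => ?_
      by_cases h : (p.1 : ℕ) ≤ l
      · rw [if_pos (by omega), if_pos h]; simp [b]
      · rw [if_neg (by omega), if_neg h, mul_zero]
    · refine Finset.sum_congr rfl fun c _ => ?_
      rw [mul_ite, mul_one, mul_zero]
      exact if_congr Fin.le_def.symm rfl rfl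
  · have := hlin (∑ J, (LinearMap.proj J : (KSubset k n → ℝ) →ₗ[ℝ] ℝ))
    simpa [Finset.sum_pi_single'] using this

/-! ### Noncrossing representations -/

/-- `c` is a nonnegative weighting supported on pairwise noncrossing nonfrozen subsets. -/
def IsRep (c : KSubset k n → ℝ) : Prop :=
  (∀ J, 0 ≤ c J) ∧ (∀ J, c J ≠ 0 → J ∈ nonfrozen k n) ∧ NCSupport c

theorem IsRep.zero : IsRep (0 : KSubset k n → ℝ) :=
  ⟨fun _ => le_rfl, fun _ h => absurd rfl h, fun _ _ h => absurd rfl h⟩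

theorem IsRep.of_mem_NC {𝒥 : Finset (KSubset k n)} (h : 𝒥 ∈ NC k n) {c : KSubset k n → ℝ}
    (h0 : ∀ J, 0 ≤ c J) (hc : ∀ J, c J ≠ 0 → J ∈ 𝒥) : IsRep c :=
  ⟨h0, fun J hJ => h.1 J (hc J hJ), fun I J hI hJ => h.2 I (hc I hI) J (hc J hJ)⟩

theorem IsRep.filter_mem_NC {c : KSubset k n → ℝ} (h : IsRep c) :
    (Finset.univ.filter fun J => c J ≠ 0) ∈ NC k n := by
  refine ⟨fun J hJ => h.2.1 J (Finset.mem_filter.1 hJ).2, fun I hI J hJ => ?_⟩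
  exact h.2.2 I J (Finset.mem_filter.1 hI).2 (Finset.mem_filter.1 hJ).2

/-- The arrays of `c` and `c'` differ by a frozen combination `r` that also matches the difference
of total masses. Adding the negative part of `r` to `c` and its positive part to `c'` gives
nonnegative weightings with equal marginals. They are still noncrossing, because frozen sets cross
nothing, so `eq_of_sameMarginals` applies. -/
theorem IsRep.eq_of_comb_eq (hk : 0 < k) (hn : k < n) {c c' : KSubset k n → ℝ} (h : IsRep c)
    (h' : IsRep c') (he : comb c = comb c') : c = c' := by
  have hZ : fsum (rowDiff (filtComb (c - c'))) = 0 := by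
    rw [← comb_eq, map_sub, he, sub_self]
  obtain ⟨r, hr, hrZ, hrt⟩ := exists_frozen_combination hk hn _ (fsum_eq_zero_iff.1 hZ)
    (∑ J, (c - c') J)
  have hnc : ∀ (c : KSubset k n → ℝ) (g : ℝ → ℝ), IsRep c → g 0 = 0 →
      NCSupport fun J => c J + g (r J) := by
    intro c g hc hg I J hI hJ
    by_cases h1 : Frozen I
    · exact h1.noncrossing hn.le (by omega) J
    by_cases h2 : Frozen J
    · exact (h2.noncrossing hn.le (by omega) I).symm
    have e1 : r I = 0 := by by_contra h; exact h1 (hr I h)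
    have e2 : r J = 0 := by by_contra h; exact h2 (hr J h)
    simp only [e1, hg, add_zero] at hI
    simp only [e2, hg, add_zero] at hJ
    exact hc.2.2 I J hI hJ
  have hdiff : (fun J => c J + max (-r J) 0) = (fun J => c' J + max (r J) 0) + ((c - c') - r) := by
    funext J
    simp only [Pi.add_apply, Pi.sub_apply]
    rcases le_total 0 (r J) with h | h
    · rw [max_eq_right (by linarith), max_eq_left h]; ring
    · rw [max_eq_left (by linarith), max_eq_right h]; ring
  have hm : SameMarginals (fun J => c J + max (-r J) 0) (fun J => c' J + max (r J) 0) := by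
    apply sameMarginals_of_filtComb_eq
    · rw [hdiff, map_add, map_sub _ (c - c') r, hrZ, sub_self, add_zero]
    · rw [hdiff]
      simp only [Pi.add_apply, Pi.sub_apply, Finset.sum_add_distrib, Finset.sum_sub_distrib] at hrt ⊢
      rw [hrt]; ring
  have key := eq_of_sameMarginals hk
    (fun J => add_nonneg (h.1 J) (le_max_right _ _)) (fun J => add_nonneg (h'.1 J) (le_max_right _ _))
    (hnc c (fun x => max (-x) 0) h (by simp)) (hnc c' (fun x => max x 0) h' (by simp)) hm
  funext J
  by_cases hJ : Frozen J
  · have e : ∀ c : KSubset k n → ℝ, IsRep c → c J = 0 := by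
      intro c hc; by_contra hne; exact hc.2.1 J hne hJ
    rw [e c h, e c' h']
  · have e1 : r J = 0 := by by_contra h; exact hJ (hr J h)
    have := congrFun key J
    simpa [e1] using this

open Classical in
/-- The nonfrozen part of a weighting. -/
noncomputable def nonfrozenPart (c : KSubset k n → ℝ) : KSubset k n → ℝ := fun J =>
  if Frozen J then 0 else c J

theorem isRep_nonfrozenPart {c : KSubset k n → ℝ} (h0 : ∀ J, 0 ≤ c J) (hnc : NCSupport c) :
    IsRep (nonfrozenPart c) := by
  have aux : ∀ J, nonfrozenPart c J ≠ 0 → ¬ Frozen J ∧ c J ≠ 0 := by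
    intro J hJ
    unfold nonfrozenPart at hJ
    split_ifs at hJ with h
    · exact absurd rfl hJ
    · exact ⟨h, hJ⟩
  refine ⟨fun J => ?_, fun J hJ => (aux J hJ).1, fun I J hI hJ => hnc I J (aux I hI).2 (aux J hJ).2⟩
  unfold nonfrozenPart
  split_ifs
  exacts [le_rfl, h0 J]

theorem comb_nonfrozenPart (hn : k < n) (c : KSubset k n → ℝ) :
    comb (nonfrozenPart c) = comb c := by
  rw [comb_def, comb_def]
  refine Finset.sum_congr rfl fun J _ => ?_
  unfold nonfrozenPart
  split_ifs with h
  · rw [h.v_eq_zero hn.le (by omega), smul_zero, smul_zero]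
  · rfl

theorem nonfrozenPart_le {c : KSubset k n → ℝ} (h0 : ∀ J, 0 ≤ c J) (J : KSubset k n) :
    nonfrozenPart c J ≤ c J := by
  unfold nonfrozenPart
  split_ifs
  exacts [h0 J, le_rfl]

/-- Uncrossing keeps the total mass; discarding the frozen part keeps the point, since frozen `v J`
vanish, and can only lower the mass. -/
theorem exists_isRep (hk : 0 < k) (hn : k < n) (T : AddSubgroup ℝ) (hT : IsClosed (T : Set ℝ))
    (c : KSubset k n → ℝ) (h0 : ∀ J, 0 ≤ c J) (hcT : ∀ J, c J ∈ T) :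
    ∃ c', IsRep c' ∧ (∀ J, c' J ∈ T) ∧ comb c' = comb c ∧ ∑ J, c' J ≤ ∑ J, c J := by
  obtain ⟨c', h0', hT', hnc, hm⟩ := exists_ncSupport T hT hk c h0 hcT
  refine ⟨nonfrozenPart c', isRep_nonfrozenPart h0' hnc, fun J => ?_, ?_, ?_⟩
  · unfold nonfrozenPart
    split_ifs
    exacts [T.zero_mem, hT' J]
  · rw [comb_nonfrozenPart hn, comb_eq, comb_eq, hm.filtComb_eq]
  · rw [← hm.sum_eq hk]
    exact Finset.sum_le_sum fun J _ => nonfrozenPart_le h0' J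

theorem exists_v_eq_f (hkn : k ≤ n) (q : Fin (k - 1) × Fin (n - k)) :
    ∃ J : KSubset k n, v J = f q := by
  -- An interval with one element skipped after position `q.1`: it has the single cell `q`.
  obtain ⟨J, hJ⟩ := exists_el (k := k) (n := n)
    (fun i => if i ≤ (q.1 : ℕ) then (q.2 : ℕ) + i else q.2 + i + 1)
    (fun l _ => by split_ifs <;> omega) (fun l hl => by split_ifs <;> omega)
  refine ⟨J, ?_⟩
  have : cells J = {q} := by
    ext p
    simp only [cells, Finset.mem_filter, Finset.mem_univ, true_and, Finset.mem_singleton]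
    rw [← el_of_lt, ← el_of_lt, hJ _ (by omega), hJ _ (by omega), Prod.ext_iff, Fin.ext_iff,
      Fin.ext_iff]
    split_ifs <;> omega
  rw [v, this, Finset.sum_singleton]

theorem comb_single [DecidableEq (KSubset k n)] (J : KSubset k n) (x : ℝ) :
    comb (Pi.single J x) = x • v J := by
  simp [comb]

theorem exists_comb_eq_fsum (hn : k < n) (T : AddSubgroup ℝ) (a : Grid k n)
    (ha : ∀ q, a q ∈ T) :
    ∃ c : KSubset k n → ℝ, (∀ J, 0 ≤ c J) ∧ (∀ J, c J ∈ T) ∧ comb c = fsum a := by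
  classical
  let s : Fin (k - 1) → ℝ := fun i => ∑ j, |a (i, j)|
  -- Adding a constant to each row makes the coefficients nonnegative without changing `fsum`.
  let a' : Grid k n := fun q => a q + s q.1
  have hs : ∀ i, s i ∈ T := by
    intro i
    refine T.sum_mem fun j _ => ?_
    rcases abs_choice (a (i, j)) with h | h
    · rw [h]; exact ha _
    · rw [h]; exact T.neg_mem (ha _)
  have ha' : fsum a' = fsum a := by
    have h1 : a' = a + fun q => s q.1 := rfl
    have h2 : fsum (fun q : Fin (k - 1) × Fin (n - k) => s q.1) = 0 :=
      fsum_eq_zero_iff.2 fun _ _ _ => rfl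
    rw [h1, map_add, h2, add_zero]
  choose S hS using exists_v_eq_f (k := k) hn.le
  refine ⟨∑ q, Pi.single (S q) (a' q), fun J => ?_, fun J => ?_, ?_⟩
  · rw [Finset.sum_apply]
    refine Finset.sum_nonneg fun q _ => ?_
    have hnn : 0 ≤ a' q := by
      have h1 : |a q| ≤ s q.1 := Finset.single_le_sum
        (f := fun j => |a (q.1, j)|) (fun _ _ => abs_nonneg _) (Finset.mem_univ q.2)
      have := neg_abs_le (a q)
      simp only [a']; linarith
    rw [Pi.single_apply]
    split_ifs
    exacts [hnn, le_rfl]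
  · rw [Finset.sum_apply]
    refine T.sum_mem fun q _ => ?_
    rw [Pi.single_apply]
    split_ifs
    exacts [T.add_mem (ha q) (hs _), T.zero_mem]
  · rw [map_sum, ← ha', fsum_def]
    refine Finset.sum_congr rfl fun q _ => ?_
    rw [comb_single, hS]

theorem exists_isRep_of_mem_rowZero (hk : 0 < k) (hn : k < n) {y : Grid k n}
    (hy : y ∈ rowZero k n) : ∃ c, IsRep c ∧ comb c = y := by
  obtain ⟨a, rfl⟩ := exists_fsum_eq hy
  obtain ⟨c, h0, -, hc⟩ := exists_comb_eq_fsum hn ⊤ a fun _ => trivial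
  obtain ⟨c', h1, -, h2, -⟩ := exists_isRep hk hn ⊤ isClosed_univ c h0 fun _ => trivial
  exact ⟨c', h1, h2.trans hc⟩

theorem exists_int_isRep (hk : 0 < k) (hn : k < n) (a : Grid k n)
    (ha : ∀ q, ∃ z : ℤ, (z : ℝ) = a q) :
    ∃ c, IsRep c ∧ (∀ J, ∃ z : ℤ, (z : ℝ) = c J) ∧ comb c = fsum a := by
  have hT : IsClosed ((Int.castAddHom ℝ).range : Set ℝ) :=
    Int.isClosedEmbedding_coe_real.isClosed_range
  obtain ⟨c, h0, h1, hc⟩ := exists_comb_eq_fsum hn (Int.castAddHom ℝ).range a ha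
  obtain ⟨c', h1, h2, h3, -⟩ := exists_isRep hk hn _ hT c h0 h1
  exact ⟨c', h1, h2, h3.trans hc⟩

open Classical in
theorem isRep_single {J : KSubset k n} (hJ : J ∈ nonfrozen k n) {x : ℝ} (hx : 0 ≤ x) :
    IsRep (Pi.single J x) := by
  have : ∀ I, (Pi.single J x : KSubset k n → ℝ) I ≠ 0 → I = J := by
    intro I hI
    by_contra h
    exact hI (Pi.single_eq_of_ne h _)
  refine ⟨fun I => ?_, fun I hI => by rw [this I hI]; exact hJ, fun I I' hI hI' => ?_⟩
  · rw [Pi.single_apply]; split_ifs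
    exacts [hx, le_rfl]
  · rw [this I hI, this I' hI']; exact Noncrossing.refl J

theorem v_injOn (hk : 0 < k) (hn : k < n) : Set.InjOn v (nonfrozen k n) := by
  classical
  intro I hI J hJ h
  have := (isRep_single hI zero_le_one).eq_of_comb_eq hk hn (isRep_single hJ zero_le_one)
    (by rw [comb_single, comb_single, h])
  have h1 := congrFun this I
  rw [Pi.single_eq_same] at h1
  by_contra hne
  rw [Pi.single_eq_of_ne hne] at h1
  exact one_ne_zero h1

theorem v_ne_zero (hk : 0 < k) (hn : k < n) {J : KSubset k n} (hJ : J ∈ nonfrozen k n) :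
    v J ≠ 0 := by
  classical
  intro h
  have := (isRep_single hJ zero_le_one).eq_of_comb_eq hk hn IsRep.zero
    (by rw [comb_single, h, smul_zero, map_zero])
  have h1 := congrFun this J
  rw [Pi.single_eq_same] at h1
  exact one_ne_zero h1

/-! ### The simplicial complex -/

open Classical in
/-- The weighting of the nonfrozen subsets given by a function on the points `v J`. -/
noncomputable def pull (w : Grid k n → ℝ) : KSubset k n → ℝ := fun J =>
  if Frozen J then 0 else w (v J)

theorem pull_ne_zero (hk : 0 < k) (hn : k < n) {𝒥 : Finset (KSubset k n)}
    (h𝒥 : 𝒥 ∈ NC k n) {s : Finset (Grid k n)} (hs : s ⊆ insert 0 (𝒥.image v)) {w : Grid k n → ℝ}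
    (hw : ∀ x, x ∉ s → w x = 0) {J : KSubset k n} (hJ : pull w J ≠ 0) : J ∈ 𝒥 := by
  unfold pull at hJ
  split_ifs at hJ with h
  · exact absurd rfl hJ
  · have h1 : v J ∈ s := by by_contra h'; exact hJ (hw _ h')
    rcases Finset.mem_insert.1 (hs h1) with h2 | h2
    · exact absurd h2 (v_ne_zero hk hn h)
    · obtain ⟨I, hI, he⟩ := Finset.mem_image.1 h2
      rwa [← v_injOn hk hn (h𝒥.1 I hI) h he]

/-- Separates the weight of the vertex `0` from the others. It is applied to the identity and to the
constant 1. Since `pull` vanishes on frozen sets, whose `v` is `0`, the weight at `0` is not counted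
again. -/
theorem sum_smul_eq_pull (hk : 0 < k) (hn : k < n) {𝒥 : Finset (KSubset k n)}
    (h𝒥 : 𝒥 ∈ NC k n) {s : Finset (Grid k n)} (hs : s ⊆ insert 0 (𝒥.image v)) {w : Grid k n → ℝ}
    (hw : ∀ x, x ∉ s → w x = 0) {M : Type*} [AddCommGroup M] [Module ℝ M] (g : Grid k n → M) :
    ∑ x ∈ s, w x • g x = w 0 • g 0 + ∑ J, pull w J • g (v J) := by
  rw [Finset.sum_subset hs fun x _ hx => by rw [hw x hx, zero_smul], Finset.sum_insert]
  · congr 1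
    rw [Finset.sum_image fun I hI J hJ => v_injOn hk hn (h𝒥.1 I hI) (h𝒥.1 J hJ)]
    rw [← Finset.sum_subset (Finset.subset_univ 𝒥)]
    · refine Finset.sum_congr rfl fun J hJ => ?_
      rw [pull, if_neg (h𝒥.1 J hJ)]
    · intro J _ hJ
      have : pull w J = 0 := by by_contra h; exact hJ (pull_ne_zero hk hn h𝒥 hs hw h)
      rw [this, zero_smul]
  · intro h
    obtain ⟨I, hI, he⟩ := Finset.mem_image.1 h
    exact v_ne_zero hk hn (h𝒥.1 I hI) he

/-- The faces of the triangulation. -/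
def ncFaces (k n : ℕ) : Set (Finset (Grid k n)) :=
  {s | s.Nonempty ∧ ∃ 𝒥 ∈ NC k n, s ⊆ insert 0 (𝒥.image v)}

/-- The positive and negative parts of `c` are both representations of one point, so they coincide.
-/
theorem comb_injOn_support (hk : 0 < k) (hn : k < n) {𝒥 : Finset (KSubset k n)}
    (h𝒥 : 𝒥 ∈ NC k n) {c : KSubset k n → ℝ} (hc : ∀ J, c J ≠ 0 → J ∈ 𝒥) (h : comb c = 0) :
    c = 0 := by
  have h1 : IsRep fun J => max (c J) 0 := by
    refine IsRep.of_mem_NC h𝒥 (fun J => le_max_right _ _) fun J hJ => hc J fun h => hJ ?_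
    rw [h, max_self]
  have h2 : IsRep fun J => max (-c J) 0 := by
    refine IsRep.of_mem_NC h𝒥 (fun J => le_max_right _ _) fun J hJ => hc J fun h => hJ ?_
    rw [h, neg_zero, max_self]
  have hsub : (fun J => max (c J) 0) - (fun J => max (-c J) 0) = c := by
    funext J
    rw [Pi.sub_apply]
    rcases le_total 0 (c J) with h | h
    · rw [max_eq_left h, max_eq_right (by linarith), sub_zero]
    · rw [max_eq_right h, max_eq_left (by linarith)]; ring
  have h3 := h1.eq_of_comb_eq hk hn h2 (by rw [← sub_eq_zero, ← map_sub, hsub, h])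
  rw [← hsub, h3, sub_self]

theorem eq_of_pull_eq {s t : Finset (Grid k n)} (hs : s ∈ ncFaces k n)
    (ht : t ∈ ncFaces k n) {w w' : Grid k n → ℝ} (hw : ∀ x, x ∉ s → w x = 0)
    (hw' : ∀ x, x ∉ t → w' x = 0) (h0 : w 0 = w' 0) (hp : pull w = pull w') : w = w' := by
  funext x
  have aux : ∀ s ∈ ncFaces k n, x ∈ s → x = 0 ∨ ∃ J ∈ nonfrozen k n, v J = x := by
    rintro s ⟨-, 𝒥, h𝒥, hs⟩ hx
    rcases Finset.mem_insert.1 (hs hx) with h | h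
    · exact Or.inl h
    · obtain ⟨J, hJ, he⟩ := Finset.mem_image.1 h
      exact Or.inr ⟨J, h𝒥.1 J hJ, he⟩
  have main : (x = 0 ∨ ∃ J ∈ nonfrozen k n, v J = x) → w x = w' x := by
    rintro (rfl | ⟨J, hJ, rfl⟩)
    · exact h0
    · have := congrFun hp J
      have hJ' : ¬ Frozen J := hJ
      simpa [pull, hJ'] using this
  by_cases h1 : x ∈ s
  · exact main (aux s hs h1)
  by_cases h2 : x ∈ t
  · exact main (aux t ht h2)
  rw [hw x h1, hw' x h2]

theorem affineIndependent_of_mem_ncFaces (hk : 0 < k) (hn : k < n) {s : Finset (Grid k n)}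
    (hs : s ∈ ncFaces k n) : AffineIndependent ℝ ((↑) : s → Grid k n) := by
  classical
  rw [affineIndependent_iff_of_fintype]
  intro w hw0 hw1
  rw [Finset.univ.weightedVSub_eq_linear_combination hw0] at hw1
  obtain ⟨-, 𝒥, h𝒥, hsub⟩ := id hs
  let w' : Grid k n → ℝ := fun x => if h : x ∈ s then w ⟨x, h⟩ else 0
  have hw' : ∀ x, x ∉ s → w' x = 0 := fun x hx => dif_neg hx
  have e : ∀ i : s, w i = w' i := fun i => by simp [w']
  simp only [e] at hw0 hw1
  rw [Finset.sum_coe_sort s w'] at hw0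
  rw [Finset.sum_coe_sort s fun x => w' x • x] at hw1
  have e1 := sum_smul_eq_pull hk hn h𝒥 hsub hw' (fun x => x)
  have e2 := sum_smul_eq_pull hk hn h𝒥 hsub hw' (fun _ => (1 : ℝ))
  rw [hw1, smul_zero, zero_add, ← comb_def] at e1
  simp only [smul_eq_mul, mul_one] at e2
  have hp := comb_injOn_support hk hn h𝒥 (fun J hJ => pull_ne_zero hk hn h𝒥 hsub hw' hJ) e1.symm
  rw [hw0, hp] at e2
  have hz : w' = 0 := by
    refine eq_of_pull_eq hs hs hw' (fun _ _ => rfl) ?_ ?_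
    · simpa using e2.symm
    · rw [hp]; funext J; simp [pull]
  intro i
  rw [e, hz]; rfl

theorem exists_weight_of_mem_convexHull (hk : 0 < k) (hn : k < n) {𝒥 : Finset (KSubset k n)}
    (h𝒥 : 𝒥 ∈ NC k n) {s : Finset (Grid k n)} (hsub : s ⊆ insert 0 (𝒥.image v)) {x : Grid k n}
    (hx : x ∈ convexHull ℝ (s : Set (Grid k n))) :
    ∃ w : Grid k n → ℝ, (∀ y, 0 ≤ w y) ∧ (∀ y, y ∉ s → w y = 0) ∧ ∑ y ∈ s, w y = 1 ∧
      ∑ y ∈ s, w y • y = x ∧ (∀ J, 0 ≤ pull w J) ∧ (∀ J, pull w J ≠ 0 → J ∈ 𝒥) ∧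
        comb (pull w) = x ∧ 1 = w 0 + ∑ J, pull w J := by
  obtain ⟨w, h0, h1, h2⟩ := Finset.mem_convexHull'.1 hx
  let w' : Grid k n → ℝ := fun x => if x ∈ s then w x else 0
  have hw' : ∀ x, x ∉ s → w' x = 0 := fun x hx => if_neg hx
  have hw0 : ∀ y, 0 ≤ w' y := by
    intro y; simp only [w']; split_ifs with h
    exacts [h0 y h, le_rfl]
  have h1' : ∑ y ∈ s, w' y = 1 := by
    rw [← h1]; exact Finset.sum_congr rfl fun y hy => if_pos hy
  have h2' : ∑ y ∈ s, w' y • y = x := by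
    rw [← h2]
    exact Finset.sum_congr rfl fun y hy => by simp only [w', if_pos hy]
  have e1 := sum_smul_eq_pull hk hn h𝒥 hsub hw' (fun x => x)
  have e2 := sum_smul_eq_pull hk hn h𝒥 hsub hw' (fun _ => (1 : ℝ))
  rw [h2', smul_zero, zero_add, ← comb_def] at e1
  simp only [smul_eq_mul, mul_one] at e2
  rw [h1'] at e2
  refine ⟨w', hw0, hw', h1', h2', fun J => ?_, fun J hJ => pull_ne_zero hk hn h𝒥 hsub hw' hJ,
    e1.symm, e2⟩
  unfold pull
  split_ifs
  exacts [le_rfl, hw0 _]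

/-- Barycentric coordinates of a common point in the two simplices give two noncrossing
representations. They agree, and the weight of `0` is the remaining mass, so the weights are
supported on the common vertices. -/
theorem inter_subset_convexHull_of_mem_ncFaces (hk : 0 < k) (hn : k < n)
    {s t : Finset (Grid k n)} (hs : s ∈ ncFaces k n) (ht : t ∈ ncFaces k n) :
    convexHull ℝ (s : Set (Grid k n)) ∩ convexHull ℝ (t : Set (Grid k n)) ⊆
      convexHull ℝ (s ∩ t : Set (Grid k n)) := by
  rintro x ⟨hxs, hxt⟩
  obtain ⟨-, 𝒥, h𝒥, hsub⟩ := id hs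
  obtain ⟨-, 𝒥', h𝒥', hsub'⟩ := id ht
  obtain ⟨w, a1, a2, a3, a4, a0, a5, a6, a7⟩ :=
    exists_weight_of_mem_convexHull hk hn h𝒥 hsub hxs
  obtain ⟨w', b1, b2, b3, b4, b0, b5, b6, b7⟩ :=
    exists_weight_of_mem_convexHull hk hn h𝒥' hsub' hxt
  have hp := (IsRep.of_mem_NC h𝒥 a0 a5).eq_of_comb_eq hk hn (IsRep.of_mem_NC h𝒥' b0 b5)
    (a6.trans b6.symm)
  have hww : w = w' := by
    refine eq_of_pull_eq hs ht a2 b2 ?_ hp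
    rw [hp] at a7
    linarith
  rw [← Finset.coe_inter]
  have hzero : ∀ y ∈ s, y ∉ s ∩ t → w y = 0 := by
    intro y hy hyt
    rw [hww]
    exact b2 y fun h => hyt (Finset.mem_inter.2 ⟨hy, h⟩)
  refine Finset.mem_convexHull'.2 ⟨w, fun y _ => a1 y, ?_, ?_⟩
  · rw [← a3]
    exact Finset.sum_subset Finset.inter_subset_left hzero
  · rw [← a4]
    exact Finset.sum_subset Finset.inter_subset_left fun y h1 h2 => by
      rw [hzero y h1 h2, zero_smul]

/-- The triangulation by the noncrossing complex. -/
def ncComplex (hk : 0 < k) (hn : k < n) : Geometry.SimplicialComplex ℝ (Grid k n) where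
  faces := ncFaces k n
  isRelLowerSet_faces := by
    intro s hs
    exact ⟨hs.1, fun t hts ht => ⟨ht, hs.2.imp fun 𝒥 h => ⟨h.1, hts.trans h.2⟩⟩⟩
  indep := affineIndependent_of_mem_ncFaces hk hn
  inter_subset_convexHull := inter_subset_convexHull_of_mem_ncFaces hk hn

theorem isFlag_ncComplex (hk : 0 < k) (hn : k < n) : IsFlag (ncComplex hk hn) := by
  classical
  intro s hne hs
  refine ⟨hne, Finset.univ.filter fun J => J ∈ nonfrozen k n ∧ v J ∈ s, ⟨?_, ?_⟩, ?_⟩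
  · intro J hJ; exact (Finset.mem_filter.1 hJ).2.1
  · intro I hI J hJ
    obtain ⟨hI, hIs⟩ := (Finset.mem_filter.1 hI).2
    obtain ⟨hJ, hJs⟩ := (Finset.mem_filter.1 hJ).2
    obtain ⟨-, 𝒥, h𝒥, hsub⟩ := hs _ hIs _ hJs
    have aux : ∀ K ∈ nonfrozen k n, v K ∈ ({v I, v J} : Finset (Grid k n)) → K ∈ 𝒥 := by
      intro K hK hKm
      rcases Finset.mem_insert.1 (hsub hKm) with h | h
      · exact absurd h (v_ne_zero hk hn hK)
      · obtain ⟨L, hL, he⟩ := Finset.mem_image.1 h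
        rwa [← v_injOn hk hn (h𝒥.1 L hL) hK he]
    exact h𝒥.2 I (aux I hI (by simp)) J (aux J hJ (by simp))
  · intro x hx
    obtain ⟨-, 𝒥, h𝒥, hsub⟩ := hs x hx x hx
    rcases Finset.mem_insert.1 (hsub (Finset.mem_insert_self _ _)) with h | h
    · exact Finset.mem_insert.2 (Or.inl h)
    · obtain ⟨J, hJ, rfl⟩ := Finset.mem_image.1 h
      refine Finset.mem_insert_of_mem (Finset.mem_image_of_mem _ ?_)
      exact Finset.mem_filter.2 ⟨Finset.mem_univ _, h𝒥.1 J hJ, hx⟩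

/-! ### The space of the complex -/

/-- The missing mass `1 - ∑ c J` is placed at `0`; points with zero coefficient, which may lie
outside `s`, are also replaced by `0`. -/
theorem comb_mem_of_convex {s : Set (Grid k n)} (hs : Convex ℝ s) (h0 : 0 ∈ s)
    {c : KSubset k n → ℝ} (hc0 : ∀ J, 0 ≤ c J) (hc : ∀ J, c J ≠ 0 → v J ∈ s)
    (h1 : ∑ J, c J ≤ 1) : comb c ∈ s := by
  classical
  have := hs.sum_mem (t := Finset.univ)
    (w := fun o : Option (KSubset k n) => o.elim (1 - ∑ J, c J) c)
    (z := fun o => o.elim 0 fun J => if c J = 0 then 0 else v J)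
    (by rintro (_ | J) -
        · exact sub_nonneg.2 h1
        · exact hc0 J)
    (by simp [Fintype.sum_option])
    (by rintro (_ | J) -
        · exact h0
        · simp only [Option.elim]
          split_ifs with h
          exacts [h0, hc J h])
  rw [Fintype.sum_option] at this
  simp only [Option.elim, smul_zero, zero_add, smul_ite] at this
  rw [comb_def]
  convert! this using 2 with J
  split_ifs with h
  · rw [h, zero_smul]
  · rfl

theorem f_ne_zero (hn : k + 2 ≤ n) (q : Fin (k - 1) × Fin (n - k)) : f q ≠ 0 := by
  classical
  have h1 : (f q : Grid k n) = fsum (Pi.single q 1) := by simp [fsum]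
  rw [h1, Ne, fsum_eq_zero_iff]
  intro h
  have h2 := h q.1 q.2 (finRotate _ q.2)
  rw [Pi.single_eq_same, Pi.single_eq_of_ne] at h2
  · exact one_ne_zero h2
  · intro h3
    have h4 : finRotate _ q.2 = q.2 := congrArg Prod.snd h3
    have h5 := congrArg Fin.val h4
    rcases coe_finRotate_cases q.2 with h | h <;> omega

/-- The origin is the average of the vectors `f (i, j)` over one row. Each is some `v J`, and `J` is
nonfrozen because `f (i, j) ≠ 0` when there are at least two columns. -/
theorem zero_mem_rootPolytope (hk : 2 ≤ k) (hn : k + 2 ≤ n) :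
    (0 : Grid k n) ∈ rootPolytope k n := by
  have hm : (0 : ℝ) < (n - k : ℕ) := by
    have : 0 < n - k := by omega
    exact_mod_cast this
  let i : Fin (k - 1) := ⟨0, by omega⟩
  have h := (convex_convexHull ℝ (v '' nonfrozen k n)).sum_mem (t := Finset.univ)
    (w := fun _ : Fin (n - k) => ((n - k : ℕ) : ℝ)⁻¹) (z := fun j => f (i, j))
    (fun _ _ => by positivity)
    (by simp [hm.ne'])
    (by intro j _
        obtain ⟨J, hJ⟩ := exists_v_eq_f (k := k) (n := n) (by omega) (i, j)
        rw [← hJ]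
        refine subset_convexHull ℝ _ ⟨J, fun hfr => ?_, rfl⟩
        apply f_ne_zero hn (i, j)
        rw [← hJ, hfr.v_eq_zero (by omega) (by omega)])
  have h0 : ∑ j : Fin (n - k), ((n - k : ℕ) : ℝ)⁻¹ • (f (i, j) : Grid k n) = 0 := by
    have : fsum (fun q : Fin (k - 1) × Fin (n - k) => if q.1 = i then ((n - k : ℕ) : ℝ)⁻¹ else 0)
        = 0 := fsum_eq_zero_iff.2 fun _ _ _ => rfl
    rw [fsum_def, Fintype.sum_prod_type, Finset.sum_eq_single i] at this
    · simpa using this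
    · intro b _ hb; simp [hb]
    · intro h; exact absurd (Finset.mem_univ _) h
  rwa [h0] at h

/-- The right-hand side is convex because re-representing a convex combination does not increase the
coefficient sum. -/
theorem mem_rootPolytope_iff (hk : 2 ≤ k) (hn : k + 2 ≤ n) {x : Grid k n} :
    x ∈ rootPolytope k n ↔ ∃ c, IsRep c ∧ comb c = x ∧ ∑ J, c J ≤ 1 := by
  classical
  constructor
  · intro hx
    refine convexHull_min (t := {x | ∃ c, IsRep c ∧ comb c = x ∧ ∑ J, c J ≤ 1}) ?_ ?_ hx
    · rintro _ ⟨J, hJ, rfl⟩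
      exact ⟨Pi.single J 1, isRep_single hJ zero_le_one, by rw [comb_single, one_smul], by simp⟩
    · rintro _ ⟨c, hc, rfl, hc1⟩ _ ⟨c', hc', rfl, hc1'⟩ a b ha hb hab
      obtain ⟨d, h1, -, h2, h3⟩ := exists_isRep (k := k) (n := n) (by omega) (by omega) ⊤
        isClosed_univ (a • c + b • c')
        (fun J => add_nonneg (mul_nonneg ha (hc.1 J)) (mul_nonneg hb (hc'.1 J)))
        fun _ => trivial
      refine ⟨d, h1, by rw [h2, map_add, map_smul, map_smul], h3.trans ?_⟩
      simp only [Pi.add_apply, Pi.smul_apply, smul_eq_mul, Finset.sum_add_distrib,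
        ← Finset.mul_sum]
      nlinarith
  · rintro ⟨c, hc, rfl, hc1⟩
    exact comb_mem_of_convex (convex_convexHull ℝ _) (zero_mem_rootPolytope hk hn) hc.1
      (fun J hJ => subset_convexHull ℝ _ ⟨J, hc.2.1 J hJ, rfl⟩) hc1

theorem space_ncComplex (hk : 2 ≤ k) (hn : k + 2 ≤ n) :
    (ncComplex (k := k) (n := n) (by omega) (by omega)).space = rootPolytope k n := by
  ext x
  rw [Geometry.SimplicialComplex.mem_space_iff]
  constructor
  · rintro ⟨s, ⟨-, 𝒥, h𝒥, hs⟩, hx⟩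
    refine convexHull_min ?_ (convex_convexHull ℝ _) hx
    intro y hy
    rcases Finset.mem_insert.1 (hs hy) with h | h
    · rw [h]; exact zero_mem_rootPolytope hk hn
    · obtain ⟨J, hJ, rfl⟩ := Finset.mem_image.1 h
      exact subset_convexHull ℝ _ ⟨J, h𝒥.1 J hJ, rfl⟩
  · intro hx
    obtain ⟨c, hc, rfl, hc1⟩ := (mem_rootPolytope_iff hk hn).1 hx
    refine ⟨insert 0 ((Finset.univ.filter fun J => c J ≠ 0).image v),
      ⟨Finset.insert_nonempty _ _, _, hc.filter_mem_NC, subset_rfl⟩, ?_⟩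
    refine comb_mem_of_convex (convex_convexHull ℝ _) (subset_convexHull ℝ _ (by simp)) hc.1
      (fun J hJ => subset_convexHull ℝ _ ?_) hc1
    rw [Finset.mem_coe]
    exact Finset.mem_insert_of_mem (Finset.mem_image_of_mem _ (by simpa using hJ))

end RootPolytope

namespace RootPolytope

open MeasureTheory
open scoped Pointwise

/-! ### Integral linear maps and volume -/

section Unimodular

variable {ι κ : Type*} [Fintype ι] [Fintype κ]

theorem exists_int_det_eq [DecidableEq ι] (M : Matrix ι ι ℝ) (h : ∀ i j, ∃ z : ℤ, (z : ℝ) = M i j) :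
    ∃ z : ℤ, (z : ℝ) = M.det := by
  choose Z hZ using h
  refine ⟨(Matrix.of Z).det, ?_⟩
  have : M = (Matrix.of Z).map (Int.castRingHom ℝ) := by
    ext i j; simp [hZ]
  rw [this]
  exact (Int.castRingHom ℝ).map_det _

/-- A linear map with integral entries and an integral inverse preserves the volume. -/
theorem measurePreserving_of_int [DecidableEq ι] [DecidableEq κ] (A : (ι → ℝ) →ₗ[ℝ] κ → ℝ)
    (B : (κ → ℝ) →ₗ[ℝ] ι → ℝ) (hBA : B ∘ₗ A = LinearMap.id)
    (hcard : Fintype.card ι = Fintype.card κ)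
    (hA : ∀ i j, ∃ z : ℤ, (z : ℝ) = A (Pi.single i 1) j)
    (hB : ∀ j i, ∃ z : ℤ, (z : ℝ) = B (Pi.single j 1) i) :
    MeasurePreserving A volume volume := by
  obtain ⟨σ⟩ := Fintype.card_eq.1 hcard
  let R : (κ → ℝ) ≃ₗ[ℝ] (ι → ℝ) := LinearEquiv.funCongrLeft ℝ ℝ σ
  have hR : ∀ x i, R x i = x (σ i) := fun _ _ => rfl
  have hRs : ∀ i, R.symm (Pi.single i 1) = Pi.single (σ i) 1 := by
    intro i
    rw [LinearEquiv.symm_apply_eq]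
    funext i'
    rw [hR, Pi.single_apply, Pi.single_apply]
    simp
  let A' : (ι → ℝ) →ₗ[ℝ] ι → ℝ := R.toLinearMap ∘ₗ A
  let B' : (ι → ℝ) →ₗ[ℝ] ι → ℝ := B ∘ₗ R.symm.toLinearMap
  -- After reindexing by `σ` both maps are square; their determinants are integers with product 1,
  -- hence `±1`.
  have hmul : LinearMap.det B' * LinearMap.det A' = 1 := by
    rw [← LinearMap.det_comp]
    have : B' ∘ₗ A' = LinearMap.id := by
      rw [← hBA]; ext; simp [A', B']
    rw [this, LinearMap.det_id]
  obtain ⟨a, ha⟩ := exists_int_det_eq (LinearMap.toMatrix' A') fun i j => by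
    rw [LinearMap.toMatrix'_apply]; exact hA j (σ i)
  obtain ⟨b, hb⟩ := exists_int_det_eq (LinearMap.toMatrix' B') fun i j => by
    rw [LinearMap.toMatrix'_apply]
    simp only [B', LinearMap.comp_apply, LinearEquiv.coe_coe]
    have := hB (σ j) i
    rwa [← hRs j] at this
  rw [LinearMap.det_toMatrix'] at ha hb
  have hab : b * a = 1 := by
    rw [← ha, ← hb] at hmul; exact_mod_cast hmul
  have hdet : |LinearMap.det A'| = 1 := by
    rw [← ha]
    have : |a| = 1 := Int.isUnit_iff_abs_eq.1 (IsUnit.of_mul_eq_one_right b hab)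
    exact_mod_cast this
  have hdet0 : LinearMap.det A' ≠ 0 := by
    intro h; rw [h, abs_zero] at hdet; exact zero_ne_one hdet
  have h1 : MeasurePreserving A' volume volume := by
    refine ⟨(LinearMap.continuous_on_pi A').measurable, ?_⟩
    rw [Real.map_linearMap_volume_pi_eq_smul_volume_pi hdet0, abs_inv, hdet, inv_one,
      ENNReal.ofReal_one, one_smul]
  have h2 := volume_measurePreserving_piCongrLeft (fun _ : κ => ℝ) σ
  have h3 := h2.comp h1
  convert! h3 using 1
  funext x
  funext j
  obtain ⟨i, rfl⟩ := σ.surjective j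
  simp only [Function.comp_apply]
  rw [MeasurableEquiv.coe_piCongrLeft, Equiv.piCongrLeft_apply_apply]
  rfl

end Unimodular

/-! ### Exponential integrals -/

section Exponential

variable {ι : Type*} [Fintype ι]

theorem lintegral_exp_neg_Ici (a : ℝ) :
    ∫⁻ t in Set.Ici a, ENNReal.ofReal (Real.exp (-t)) = ENNReal.ofReal (Real.exp (-a)) := by
  rw [← setLIntegral_congr Ioi_ae_eq_Ici, ← integral_exp_neg_Ioi a,
    ofReal_integral_eq_lintegral_ofReal]
  · exact integrableOn_exp_neg_Ioi a
  · exact Filter.Eventually.of_forall fun _ => (Real.exp_pos _).le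

theorem lintegral_exp_neg_mul_pow (d : ℕ) :
    ∫⁻ t in Set.Ioi (0 : ℝ), ENNReal.ofReal (Real.exp (-t)) * ENNReal.ofReal (t ^ d) = d ! := by
  have h1 : ((d ! : ℕ) : ℝ) = ∫ t in Set.Ioi (0 : ℝ), Real.exp (-t) * t ^ d := by
    rw [← Real.Gamma_nat_eq_factorial, Real.Gamma_eq_integral (by positivity)]
    simp
  have h2 : IntegrableOn (fun t : ℝ => Real.exp (-t) * t ^ d) (Set.Ioi 0) := by
    have := Real.GammaIntegral_convergent (s := d + 1) (by positivity)
    simpa using this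
  rw [← ENNReal.ofReal_natCast, h1, ofReal_integral_eq_lintegral_ofReal h2]
  · exact lintegral_congr fun t => (ENNReal.ofReal_mul (Real.exp_pos _).le).symm
  · refine (ae_restrict_iff' measurableSet_Ioi).2 (Filter.Eventually.of_forall fun t ht => ?_)
    have : (0 : ℝ) < t := ht
    simp only [Pi.zero_apply]
    positivity

/-- The volume of a sublevel set of a homogeneous function as an exponential integral. -/
theorem lintegral_exp_neg_eq_factorial_mul {D : Set (ι → ℝ)} (hD : MeasurableSet D)
    {g : (ι → ℝ) → ℝ} (hg : Measurable g) (hDs : ∀ s > (0 : ℝ), ∀ x ∈ D, s • x ∈ D)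
    (hgs : ∀ s > (0 : ℝ), ∀ x ∈ D, g (s • x) = s * g x) (hg0 : ∀ x ∈ D, 0 ≤ g x) :
    ∫⁻ x in D, ENNReal.ofReal (Real.exp (-g x)) =
      ((Fintype.card ι) ! : ℕ) * volume {x | x ∈ D ∧ g x ≤ 1} := by
  classical
  set d := Fintype.card ι
  have hvol : ∀ t > (0 : ℝ), volume {x | x ∈ D ∧ g x ≤ t} =
      ENNReal.ofReal (t ^ d) * volume {x | x ∈ D ∧ g x ≤ 1} := by
    intro t ht
    have : {x | x ∈ D ∧ g x ≤ t} = t • {x | x ∈ D ∧ g x ≤ 1} := by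
      ext x
      rw [Set.mem_smul_set_iff_inv_smul_mem₀ ht.ne']
      constructor
      · rintro ⟨h1, h2⟩
        refine ⟨hDs _ (inv_pos.2 ht) x h1, ?_⟩
        rw [hgs _ (inv_pos.2 ht) x h1, inv_mul_le_iff₀ ht, mul_one]
        exact h2
      · rintro ⟨h1, h2⟩
        have h3 := hDs t ht _ h1
        have h4 := hgs t ht _ h1
        rw [smul_inv_smul₀ ht.ne'] at h3 h4
        refine ⟨h3, ?_⟩
        rw [h4]
        nlinarith
    rw [this, Measure.addHaar_smul, Module.finrank_fintype_fun_eq_card, abs_of_pos (by positivity)]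
  have hneg : ∀ t < (0 : ℝ), volume {x | x ∈ D ∧ g x ≤ t} = 0 := by
    intro t ht
    have : {x | x ∈ D ∧ g x ≤ t} = ∅ := by
      ext x
      simp only [Set.mem_ofPred_eq, Set.mem_empty_iff_false, iff_false, not_and, not_le]
      exact fun hx => ht.trans_le (hg0 x hx)
    rw [this, measure_empty]
  let h : (ι → ℝ) → ℝ → ℝ≥0∞ := fun x t =>
    Set.indicator {p : (ι → ℝ) × ℝ | p.1 ∈ D ∧ g p.1 ≤ p.2}
      (fun p => ENNReal.ofReal (Real.exp (-p.2))) (x, t)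
  have hset : MeasurableSet {p : (ι → ℝ) × ℝ | p.1 ∈ D ∧ g p.1 ≤ p.2} :=
    (measurable_fst hD).inter (measurableSet_le (hg.comp measurable_fst) measurable_snd)
  have hmeas : Measurable (Function.uncurry h) := by
    have : Function.uncurry h = Set.indicator {p : (ι → ℝ) × ℝ | p.1 ∈ D ∧ g p.1 ≤ p.2}
      (fun p => ENNReal.ofReal (Real.exp (-p.2))) := rfl
    rw [this]
    refine Measurable.indicator ?_ hset
    fun_prop
  -- Layer cake: `exp (-g x)` is the integral of `exp (-t)` over `t ≥ g x`. After the swap,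
  -- homogeneity turns the inner volume into `t ^ d` times a constant, and the Gamma integral gives
  -- `d!`.
  have e1 : ∫⁻ x in D, ENNReal.ofReal (Real.exp (-g x)) = ∫⁻ x, ∫⁻ t, h x t := by
    rw [← lintegral_indicator hD]
    refine lintegral_congr fun x => ?_
    by_cases hx : x ∈ D
    · rw [Set.indicator_of_mem hx, ← lintegral_exp_neg_Ici, ← lintegral_indicator measurableSet_Ici]
      refine lintegral_congr fun t => ?_
      simp only [h, Set.indicator_apply, Set.mem_Ici, Set.mem_ofPred_eq, hx, true_and]
    · rw [Set.indicator_of_notMem hx]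
      simp [h, Set.indicator_apply, hx]
  have e2 : ∀ t, ∫⁻ x, h x t =
      ENNReal.ofReal (Real.exp (-t)) * volume {x | x ∈ D ∧ g x ≤ t} := by
    intro t
    have hst : MeasurableSet {x | x ∈ D ∧ g x ≤ t} :=
      hD.inter (measurableSet_le hg measurable_const)
    rw [← setLIntegral_const, ← lintegral_indicator hst]
    rfl
  rw [e1, lintegral_lintegral_swap hmeas.aemeasurable]
  simp only [e2]
  have e3 : ∫⁻ t, ENNReal.ofReal (Real.exp (-t)) * volume {x | x ∈ D ∧ g x ≤ t} =
      ∫⁻ t in Set.Ioi (0 : ℝ), ENNReal.ofReal (Real.exp (-t)) * ENNReal.ofReal (t ^ d) *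
        volume {x | x ∈ D ∧ g x ≤ 1} := by
    rw [← lintegral_indicator measurableSet_Ioi]
    refine lintegral_congr_ae ?_
    have hne : ∀ᵐ t : ℝ, t ≠ 0 := by
      rw [ae_iff]; simp
    filter_upwards [hne] with t ht
    rcases lt_or_gt_of_ne ht with h | h
    · rw [Set.indicator_of_notMem (by simpa using h.le), hneg t h, mul_zero]
    · rw [Set.indicator_of_mem (by simpa using h), hvol t h, mul_assoc]
  rw [e3, lintegral_mul_const _ (by fun_prop), lintegral_exp_neg_mul_pow]

theorem lintegral_exp_neg_sum (a : ι → ℝ) :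
    ∫⁻ x in {x : ι → ℝ | ∀ i, a i ≤ x i}, ENNReal.ofReal (Real.exp (-∑ i, x i)) =
      ENNReal.ofReal (Real.exp (-∑ i, a i)) := by
  classical
  have hS : MeasurableSet {x : ι → ℝ | ∀ i, a i ≤ x i} := by
    rw [Set.ofPred_forall]
    exact MeasurableSet.iInter fun i => measurableSet_le measurable_const (measurable_pi_apply i)
  let h : ι → ℝ → ℝ := fun i => Set.indicator (Set.Ici (a i)) fun t => Real.exp (-t)
  have hInt : ∀ i, Integrable (h i) := by
    intro i
    rw [integrable_indicator_iff measurableSet_Ici, integrableOn_Ici_iff_integrableOn_Ioi]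
    exact integrableOn_exp_neg_Ioi _
  have hval : ∀ i, ∫ t, h i t = Real.exp (-a i) := by
    intro i
    rw [integral_indicator measurableSet_Ici, integral_Ici_eq_integral_Ioi, integral_exp_neg_Ioi]
  have hprod : ∀ x : ι → ℝ, Set.indicator {x : ι → ℝ | ∀ i, a i ≤ x i}
      (fun x => ENNReal.ofReal (Real.exp (-∑ i, x i))) x = ENNReal.ofReal (∏ i, h i (x i)) := by
    intro x
    by_cases hx : ∀ i, a i ≤ x i
    · rw [Set.indicator_of_mem (show x ∈ {x : ι → ℝ | ∀ i, a i ≤ x i} from hx),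
        ← Finset.sum_neg_distrib, Real.exp_sum]
      congr 1
      refine Finset.prod_congr rfl fun i _ => ?_
      exact (Set.indicator_of_mem (Set.mem_Ici.2 (hx i)) fun t => Real.exp (-t)).symm
    · rw [Set.indicator_of_notMem (show x ∉ {x : ι → ℝ | ∀ i, a i ≤ x i} from hx)]
      push Not at hx
      obtain ⟨i, hi⟩ := hx
      rw [Finset.prod_eq_zero (Finset.mem_univ i), ENNReal.ofReal_zero]
      exact Set.indicator_of_notMem (by simpa using hi) _
  have hnn : ∀ i t, 0 ≤ h i t := fun i t =>
    Set.indicator_nonneg (fun _ _ => (Real.exp_pos _).le) t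
  rw [← lintegral_indicator hS]
  simp only [hprod]
  rw [← ofReal_integral_eq_lintegral_ofReal, integral_fintype_prod_volume_eq_prod]
  · simp only [hval, ← Real.exp_sum, Finset.sum_neg_distrib]
  · exact Integrable.fintype_prod hInt
  · exact Filter.Eventually.of_forall fun x => Finset.prod_nonneg fun i _ => hnn i _

theorem volume_simplex :
    volume {x : ι → ℝ | (∀ i, 0 ≤ x i) ∧ ∑ i, x i ≤ 1} = 1 / ((Fintype.card ι) ! : ℕ) := by
  have hS : MeasurableSet {x : ι → ℝ | ∀ i, 0 ≤ x i} := by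
    rw [Set.ofPred_forall]
    exact MeasurableSet.iInter fun i => measurableSet_le measurable_const (measurable_pi_apply i)
  have h1 := lintegral_exp_neg_eq_factorial_mul hS (g := fun x : ι → ℝ => ∑ i, x i) (by fun_prop)
    (fun s hs x hx i => mul_nonneg hs.le (hx i))
    (fun s _ x _ => by simp [Finset.mul_sum])
    (fun x hx => Finset.sum_nonneg fun i _ => hx i)
  have h2 := lintegral_exp_neg_sum (fun _ : ι => (0 : ℝ))
  simp only [Finset.sum_const_zero, neg_zero, Real.exp_zero, ENNReal.ofReal_one] at h2
  rw [h2] at h1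
  rw [ENNReal.eq_div_iff (by exact_mod_cast (Nat.factorial_pos _).ne') (ENNReal.natCast_ne_top _)]
  exact h1.symm

end Exponential

/-! ### Order cones -/

section OrderCone

variable {P : Type*} {N : ℕ}

theorem ae_injective [Fintype P] : ∀ᵐ F : P → ℝ, Function.Injective F := by
  classical
  have key : ∀ p q : P, p ≠ q → ∀ᵐ F : P → ℝ, F p ≠ F q := by
    intro p q hpq
    rw [ae_iff]
    let L : (P → ℝ) →ₗ[ℝ] ℝ :=
      (LinearMap.proj p : (P → ℝ) →ₗ[ℝ] ℝ) - (LinearMap.proj q : (P → ℝ) →ₗ[ℝ] ℝ)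
    have h1 : {F : P → ℝ | ¬ F p ≠ F q} = (LinearMap.ker L : Set (P → ℝ)) := by
      ext F
      simp [L, sub_eq_zero]
    rw [h1]
    apply Measure.addHaar_submodule
    intro htop
    have : Pi.single p (1 : ℝ) ∈ LinearMap.ker L := by rw [htop]; trivial
    simp [L, hpq.symm] at this
  have h2 : ∀ᵐ F : P → ℝ, ∀ p q : P, p ≠ q → F p ≠ F q := by
    rw [ae_all_iff]; intro p
    rw [ae_all_iff]; intro q
    by_cases h : p = q
    · exact Filter.Eventually.of_forall fun _ h' => absurd h h'
    · filter_upwards [key p q h] with F hF _ using hF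
  filter_upwards [h2] with F hF p q h
  by_contra hne
  exact hF p q hne h

/-- The functions that are nonnegative and increasing along the enumeration `T`. -/
def chamber (T : P ≃ Fin N) : Set (P → ℝ) := {F | (∀ p, 0 ≤ F p) ∧ Monotone (F ∘ T.symm)}

theorem measurableSet_monotone {α : Type*} [Preorder α] [Finite α] (s : α → P) :
    MeasurableSet {F : P → ℝ | Monotone (F ∘ s)} := by
  have := Fintype.ofFinite α
  simp only [Monotone, Set.ofPred_forall]
  exact MeasurableSet.iInter fun i => MeasurableSet.iInter fun j => MeasurableSet.iInter fun _ =>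
    measurableSet_le (measurable_pi_apply _) (measurable_pi_apply _)

theorem measurableSet_nonneg [Finite P] : MeasurableSet {F : P → ℝ | ∀ p, 0 ≤ F p} := by
  rw [Set.ofPred_forall]
  exact MeasurableSet.iInter fun i => measurableSet_le measurable_const (measurable_pi_apply i)

theorem measurableSet_chamber [Finite P] (T : P ≃ Fin N) : MeasurableSet (chamber T) :=
  measurableSet_nonneg.inter (measurableSet_monotone _)

/-- Successive increments are unimodular coordinates in which the chamber is the orthant and the
largest value is the sum of all coordinates. -/
theorem lintegral_chamber [Fintype P] (hN : 0 < N) (T : P ≃ Fin N) :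
    ∫⁻ F in chamber T, ENNReal.ofReal (Real.exp (-F (T.symm ⟨N - 1, by omega⟩))) = 1 := by
  classical
  let A : (Fin N → ℝ) →ₗ[ℝ] P → ℝ :=
    { toFun := fun z p => ∑ i, if i ≤ T p then z i else 0
      map_add' := fun z z' => by
        funext p
        simp only [Pi.add_apply, ← Finset.sum_add_distrib]
        exact Finset.sum_congr rfl fun i _ => by split_ifs <;> simp
      map_smul' := fun r z => by
        funext p
        simp [Finset.mul_sum] }
  let B : (P → ℝ) →ₗ[ℝ] Fin N → ℝ :=
    { toFun := fun F i => F (T.symm i) - if (i : ℕ) = 0 then 0 else F (T.symm ⟨i - 1, by omega⟩)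
      map_add' := fun F F' => by
        funext i
        simp only [Pi.add_apply]
        split_ifs <;> ring
      map_smul' := fun r F => by
        funext i
        simp only [Pi.smul_apply, smul_eq_mul, RingHom.id_apply]
        split_ifs <;> ring }
  have hA : ∀ z p, A z p = ∑ i, if i ≤ T p then z i else 0 := fun _ _ => rfl
  have hB : ∀ F i, B F i = F (T.symm i) - if (i : ℕ) = 0 then 0 else
    F (T.symm ⟨i - 1, by omega⟩) := fun _ _ => rfl
  have hBA : B ∘ₗ A = LinearMap.id := by
    refine LinearMap.ext fun z => funext fun i => ?_
    rw [LinearMap.comp_apply, hB, hA, hA, LinearMap.id_apply]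
    simp only [Equiv.apply_symm_apply]
    by_cases hi : (i : ℕ) = 0
    · rw [if_pos hi, sub_zero, Finset.sum_eq_single i]
      · simp
      · intro j _ hj
        have : (j : ℕ) ≠ i := fun h => hj (Fin.ext h)
        exact if_neg (by rw [Fin.le_def]; omega)
      · intro h; exact absurd (Finset.mem_univ _) h
    · rw [if_neg hi, ← Finset.sum_sub_distrib, Finset.sum_eq_single i]
      · rw [if_pos le_rfl, if_neg (by rw [Fin.le_def]; simp only; omega), sub_zero]
      · intro j _ hj
        have : (j : ℕ) ≠ i := fun h => hj (Fin.ext h)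
        by_cases hji : j ≤ i
        · rw [if_pos hji, if_pos (by rw [Fin.le_def] at *; simp only; omega), sub_self]
        · rw [if_neg hji, if_neg (by rw [Fin.le_def] at *; simp only; omega), sub_self]
      · intro h; exact absurd (Finset.mem_univ _) h
  have hmp : MeasurePreserving A volume volume := by
    refine measurePreserving_of_int A B hBA (Fintype.card_congr T).symm (fun i p => ?_)
      fun p i => ?_
    · rw [hA]
      refine ⟨∑ j, if j ≤ T p then (Pi.single i 1 : Fin N → ℤ) j else 0, ?_⟩
      push_cast
      refine Finset.sum_congr rfl fun j _ => ?_
      simp only [Pi.single_apply]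
      split_ifs <;> simp
    · rw [hB]
      refine ⟨(Pi.single p 1 : P → ℤ) (T.symm i) - if (i : ℕ) = 0 then 0 else
        (Pi.single p 1 : P → ℤ) (T.symm ⟨i - 1, by omega⟩), ?_⟩
      simp only [Pi.single_apply]
      split_ifs <;> simp
  have hpre : A ⁻¹' chamber T = {z | ∀ i, 0 ≤ z i} := by
    ext z
    constructor
    · rintro ⟨h0, hm⟩ i
      have h1 : z i = B (A z) i := by rw [← LinearMap.comp_apply, hBA, LinearMap.id_apply]
      rw [h1, hB]
      split_ifs with hi
      · rw [sub_zero]; exact h0 _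
      · exact sub_nonneg.2 (hm (Fin.le_def.2 (Nat.sub_le _ _)))
    · intro hz
      refine ⟨fun p => ?_, fun i j hij => ?_⟩
      · rw [hA]
        exact Finset.sum_nonneg fun i _ => by split_ifs; exacts [hz i, le_rfl]
      · simp only [Function.comp_apply]
        rw [hA, hA]
        refine Finset.sum_le_sum fun l _ => ?_
        simp only [Equiv.apply_symm_apply]
        split_ifs with h1 h2
        · exact le_rfl
        · exact absurd (h1.trans hij) h2
        · exact hz l
        · exact le_rfl
  have h1 := hmp.setLIntegral_comp_preimage (measurableSet_chamber T)
    (f := fun F => ENNReal.ofReal (Real.exp (-F (T.symm ⟨N - 1, by omega⟩)))) (by fun_prop)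
  rw [← h1, hpre]
  have h2 := lintegral_exp_neg_sum (fun _ : Fin N => (0 : ℝ))
  simp only [Finset.sum_const_zero, neg_zero, Real.exp_zero, ENNReal.ofReal_one] at h2
  rw [← h2]
  refine lintegral_congr fun z => ?_
  have : A z (T.symm ⟨N - 1, by omega⟩) = ∑ i, z i := by
    rw [hA]
    refine Finset.sum_congr rfl fun i _ => ?_
    rw [Equiv.apply_symm_apply, if_pos (by rw [Fin.le_def]; simp only; omega)]
  rw [this]

theorem exists_strictMono_comp_symm (σ : P ≃ Fin N) {F : P → ℝ} (hF : Function.Injective F) :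
    ∃ T : P ≃ Fin N, StrictMono (F ∘ T.symm) := by
  let τ := Tuple.sort (F ∘ σ.symm)
  have h : Monotone ((F ∘ σ.symm) ∘ τ) := Tuple.monotone_sort _
  refine ⟨σ.trans τ.symm, ?_⟩
  exact h.strictMono_of_injective (hF.comp (σ.symm.injective.comp τ.injective))

theorem eq_of_strictMono_comp_symm {T T' : P ≃ Fin N} {F : P → ℝ} (h : StrictMono (F ∘ T.symm))
    (h' : StrictMono (F ∘ T'.symm)) : T = T' := by
  have h1 : StrictMono (T.symm.trans T' : Fin N → Fin N) := by
    intro i j hij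
    have := h hij
    rw [← h'.lt_iff_lt]
    simpa using this
  have h2 : (T.symm.trans T' : Fin N → Fin N) = id := by
    have := Subsingleton.elim (h1.orderIsoOfSurjective _ (T.symm.trans T').surjective)
      (OrderIso.refl (Fin N))
    funext i
    exact congrArg (fun e : Fin N ≃o Fin N => e i) this
  ext p
  have := congrFun h2 (T p)
  simp only [Equiv.trans_apply, Equiv.symm_apply_apply, id] at this
  rw [this]

variable [Fintype P] [PartialOrder P]

/-- The exponential integral over the cone of nonnegative increasing functions on a poset counts
the linear extensions. -/
theorem lintegral_orderCone (hN : 0 < N) (σ : P ≃ Fin N) (top : P) (htop : ∀ p, p ≤ top) :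
    ∫⁻ F in {F : P → ℝ | (∀ p, 0 ≤ F p) ∧ Monotone F}, ENNReal.ofReal (Real.exp (-F top)) =
      Nat.card {T : P ≃ Fin N // StrictMono T} := by
  classical
  let S : {T : P ≃ Fin N // StrictMono T} → Set (P → ℝ) := fun T =>
    chamber T.1 ∩ {F | StrictMono (F ∘ T.1.symm)}
  have hae : ∀ T : P ≃ Fin N, (chamber T ∩ {F | StrictMono (F ∘ T.symm)} : Set (P → ℝ)) =ᵐ[volume]
      chamber T := by
    intro T
    filter_upwards [ae_injective (P := P)] with F hF
    apply propext
    constructor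
    · exact fun h => h.1
    · exact fun h => ⟨h, h.2.strictMono_of_injective (hF.comp T.symm.injective)⟩
  -- Almost every `F` is injective, so sorting its values gives exactly one enumeration, and this is
  -- a linear extension when `F` is monotone.
  have hunion : ({F : P → ℝ | (∀ p, 0 ≤ F p) ∧ Monotone F} : Set (P → ℝ)) =ᵐ[volume]
      ⋃ T, S T := by
    filter_upwards [ae_injective (P := P)] with F hF
    apply propext
    constructor
    · rintro ⟨h0, hm⟩
      obtain ⟨T, hT⟩ := exists_strictMono_comp_symm σ hF
      refine Set.mem_iUnion.2 ⟨⟨T, fun p q hpq => ?_⟩, ⟨h0, hT.monotone⟩, hT⟩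
      have h1 := (hm.strictMono_of_injective hF) hpq
      rw [← hT.lt_iff_lt]
      simpa using h1
    · intro h
      obtain ⟨T, ⟨h0, hm⟩, hT⟩ := Set.mem_iUnion.1 h
      refine ⟨h0, fun p q hpq => ?_⟩
      have := hm (T.2.monotone hpq)
      simpa using this
  rw [setLIntegral_congr hunion, lintegral_iUnion₀]
  · have : ∀ T, ∫⁻ F in S T, ENNReal.ofReal (Real.exp (-F top)) = 1 := by
      intro T
      rw [setLIntegral_congr (hae T.1), ← lintegral_chamber hN T.1]
      have e : top = T.1.symm ⟨N - 1, by omega⟩ := by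
        rw [Equiv.eq_symm_apply]
        have h1 := T.2.monotone (htop (T.1.symm ⟨N - 1, by omega⟩))
        rw [Equiv.apply_symm_apply, Fin.le_def] at h1
        apply Fin.ext
        simp only at h1 ⊢
        omega
      rw [← e]
    simp only [this, tsum_fintype, Finset.sum_const, Finset.card_univ, nsmul_eq_mul, mul_one,
      Nat.card_eq_fintype_card]
  · intro T
    exact (measurableSet_chamber T.1).nullMeasurableSet.congr (hae T.1).symm
  · intro T T' hne
    apply Disjoint.aedisjoint
    rw [Set.disjoint_left]
    intro F h h'
    exact hne (Subtype.ext (eq_of_strictMono_comp_symm h.2 h'.2))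

end OrderCone

end RootPolytope

namespace RootPolytope

open MeasureTheory

variable {k n : ℕ}

/-! ### Coordinates with respect to the simple roots -/

/-- The linear combination of the simple roots with given coefficients. -/
noncomputable def rootSum : (Fin (k - 1) × Fin (n - k - 1) → ℝ) →ₗ[ℝ] Grid k n :=
  Fintype.linearCombination ℝ simpleRoot

theorem rootSum_def (x : Fin (k - 1) × Fin (n - k - 1) → ℝ) :
    rootSum x = ∑ q, x q • (simpleRoot q : Grid k n) :=
  Fintype.linearCombination_apply ℝ simpleRoot x

/-- Extension of an array by a zero column. -/
noncomputable def extendCol (x : Fin (k - 1) × Fin (n - k - 1) → ℝ) : Grid k n := fun q =>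
  if h : (q.2 : ℕ) < n - k - 1 then x (q.1, ⟨q.2, h⟩) else 0

theorem rootSum_eq_fsum (x : Fin (k - 1) × Fin (n - k - 1) → ℝ) :
    rootSum x = fsum (extendCol x) := by
  rw [rootSum_def, fsum_def]
  refine Fintype.sum_of_injective
    (fun q => (q.1, Fin.castLE (Nat.sub_le _ _) q.2)) ?_ _ _ ?_ ?_
  · rintro ⟨a, b⟩ ⟨a', b'⟩ h
    simp only [Prod.mk.injEq, Fin.castLE_inj] at h
    rw [h.1, h.2]
  · rintro ⟨i, j⟩ hj
    have : ¬ (j : ℕ) < n - k - 1 := fun h => hj ⟨(i, ⟨j, h⟩), rfl⟩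
    simp [extendCol, this]
  · rintro ⟨i, j⟩
    simp [extendCol, simpleRoot]

theorem fsum_eq_rootSum (hn : k < n) (a : Grid k n) :
    fsum a = rootSum fun q =>
      a (q.1, Fin.castLE (Nat.sub_le _ _) q.2) - a (q.1, lastCol hn) := by
  rw [rootSum_eq_fsum, ← sub_eq_zero, ← map_sub, fsum_eq_zero_iff]
  have key : ∀ i j, (a - extendCol fun q : Fin (k - 1) × Fin (n - k - 1) =>
      a (q.1, Fin.castLE (Nat.sub_le _ _) q.2) - a (q.1, lastCol hn)) (i, j) =
        a (i, lastCol hn) := by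
    intro i j
    simp only [Pi.sub_apply, extendCol]
    split_ifs with h
    · simp
    · have : j = lastCol hn := Fin.ext (by simp only [lastCol]; omega)
      rw [this, sub_zero]
  intro i j j'
  rw [key, key]

theorem rootSum_injective (hn : k < n) :
    Function.Injective (rootSum : (Fin (k - 1) × Fin (n - k - 1) → ℝ) → Grid k n) := by
  intro x y hxy
  rw [← sub_eq_zero, ← map_sub, rootSum_eq_fsum, fsum_eq_zero_iff] at hxy
  funext ⟨i, j⟩
  have := hxy i (Fin.castLE (Nat.sub_le _ _) j) (lastCol hn)
  simpa [extendCol, lastCol, sub_eq_zero] using this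

theorem rootSum_mem_rowZero (x : Fin (k - 1) × Fin (n - k - 1) → ℝ) :
    (rootSum x : Grid k n) ∈ rowZero k n := by
  rw [rootSum_eq_fsum]; exact fsum_mem_rowZero _

theorem fsum_rowDiff (hn : k < n) (F : Arr k n) : fsum (rowDiff F) = rootSum (coordY hn F) :=
  fsum_eq_rootSum hn _

theorem v_eq_rootSum (hn : k < n) (J : KSubset k n) : v J = rootSum (coordY hn (filt J)) := by
  rw [v_eq_fsum, fsum_rowDiff hn]

theorem comb_eq_rootSum (hn : k < n) (c : KSubset k n → ℝ) :
    comb c = rootSum (coordY hn (filtComb c)) := by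
  rw [comb_eq, fsum_rowDiff hn]

theorem exists_int_filt (J : KSubset k n) (p : Fin k × Fin (n - k)) :
    ∃ z : ℤ, (z : ℝ) = filt J p := by
  unfold filt
  split_ifs
  exacts [⟨1, by simp⟩, ⟨0, by simp⟩]

theorem exists_int_sub {a b : ℝ} (ha : ∃ z : ℤ, (z : ℝ) = a) (hb : ∃ z : ℤ, (z : ℝ) = b) :
    ∃ z : ℤ, (z : ℝ) = a - b := by
  obtain ⟨x, rfl⟩ := ha
  obtain ⟨y, rfl⟩ := hb
  exact ⟨x - y, by push_cast; rfl⟩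

theorem exists_int_rowDiff {F : Arr k n} (hF : ∀ p, ∃ z : ℤ, (z : ℝ) = F p)
    (q : Fin (k - 1) × Fin (n - k)) : ∃ z : ℤ, (z : ℝ) = rowDiff F q := by
  rw [rowDiff_apply]
  exact exists_int_sub (hF _) (hF _)

theorem exists_int_coordY (hn : k < n) {F : Arr k n} (hF : ∀ p, ∃ z : ℤ, (z : ℝ) = F p)
    (q : Fin (k - 1) × Fin (n - k - 1)) : ∃ z : ℤ, (z : ℝ) = coordY hn F q :=
  exists_int_sub (exists_int_rowDiff hF _) (exists_int_rowDiff hF _)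

theorem v_mem_rootLattice (hn : k < n) (J : KSubset k n) : v J ∈ rootLattice k n := by
  rw [v_eq_rootSum hn, rootSum_def]
  refine Submodule.sum_mem _ fun q _ => ?_
  obtain ⟨z, hz⟩ := exists_int_coordY hn (exists_int_filt J) q
  rw [← hz, Int.cast_smul_eq_zsmul]
  exact Submodule.smul_mem _ _ (Submodule.subset_span ⟨q, rfl⟩)

/-! ### Maximal noncrossing collections are lattice bases -/

open Classical in
/-- The indicator function of a collection of subsets. -/
noncomputable def ind (𝒥 : Finset (KSubset k n)) : KSubset k n → ℝ := fun J =>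
  if J ∈ 𝒥 then 1 else 0

theorem ind_ne_zero {𝒥 : Finset (KSubset k n)} {J : KSubset k n} (h : ind 𝒥 J ≠ 0) : J ∈ 𝒥 := by
  unfold ind at h
  split_ifs at h with h1
  · exact h1
  · exact absurd rfl h

theorem ind_nonneg (𝒥 : Finset (KSubset k n)) (J : KSubset k n) : 0 ≤ ind 𝒥 J := by
  unfold ind; split_ifs <;> norm_num

/-- Moves `z` far in the direction of the interior point `comb (ind 𝒥)` of the cone of `𝒥`. The
translates `N • comb (ind 𝒥) + z` are representable, and infinitely many of them share one support
bound `𝒥'`; maximality forces it into `𝒥`. -/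
theorem exists_comb_of_maximal (hk : 0 < k) (hn : k < n) {𝒥 : Finset (KSubset k n)}
    (h𝒥 : 𝒥 ∈ NC k n) (hmax : ∀ 𝒥' ∈ NC k n, 𝒥 ⊆ 𝒥' → 𝒥' ⊆ 𝒥) {z : Grid k n}
    (hz : z ∈ rowZero k n) : ∃ β : KSubset k n → ℝ, (∀ J, β J ≠ 0 → J ∈ 𝒥) ∧ comb β = z := by
  classical
  have hrep : ∀ N : ℕ, ∃ c, IsRep c ∧ comb c = (N : ℝ) • comb (ind 𝒥) + z := fun N =>
    exists_isRep_of_mem_rowZero hk hn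
      (Submodule.add_mem _ (Submodule.smul_mem _ _ (comb_mem_rowZero _)) hz)
  choose c hc hcz using hrep
  obtain ⟨𝒥', hinf⟩ := Finite.exists_infinite_fiber
    fun N : ℕ => Finset.univ.filter fun J => c N J ≠ 0
  rw [Set.infinite_coe_iff] at hinf
  have hmem : ∀ N ∈ (fun N : ℕ => Finset.univ.filter fun J => c N J ≠ 0) ⁻¹' {𝒥'},
      ∀ J, c N J ≠ 0 → J ∈ 𝒥' := by
    intro N hN J hJ
    have : (Finset.univ.filter fun J => c N J ≠ 0) = 𝒥' := hN
    rw [← this]; simpa using hJ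
  obtain ⟨N₀, hN₀, -⟩ := hinf.exists_gt 0
  obtain ⟨N₁, hN₁, hlt⟩ := hinf.exists_gt N₀
  have h𝒥' : 𝒥' ∈ NC k n := by
    have : (Finset.univ.filter fun J => c N₀ J ≠ 0) = 𝒥' := hN₀
    rw [← this]; exact (hc N₀).filter_mem_NC
  have hpos : (0 : ℝ) < (N₁ : ℝ) - N₀ := by
    have : (N₀ : ℝ) < N₁ := by exact_mod_cast hlt
    linarith
  -- The coefficients of the translates in the fibre are affine in `N` with slope `α`. Staying
  -- nonnegative for unbounded `N` forces `α ≥ 0`, so `α` represents `comb (ind 𝒥)` and equals `ind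
  -- 𝒥`.
  let α : KSubset k n → ℝ := ((N₁ : ℝ) - N₀)⁻¹ • (c N₁ - c N₀)
  have hα : comb α = comb (ind 𝒥) := by
    simp only [α, map_smul, map_sub, hcz]
    rw [add_sub_add_right_eq_sub, ← sub_smul, smul_smul, inv_mul_cancel₀ hpos.ne', one_smul]
  have hαs : ∀ J, α J ≠ 0 → J ∈ 𝒥' := by
    intro J hJ
    by_contra hJ'
    have e1 : c N₁ J = 0 := by by_contra h; exact hJ' (hmem N₁ hN₁ J h)
    have e0 : c N₀ J = 0 := by by_contra h; exact hJ' (hmem N₀ hN₀ J h)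
    exact hJ (by simp [α, e1, e0])
  have haff : ∀ N ∈ (fun N : ℕ => Finset.univ.filter fun J => c N J ≠ 0) ⁻¹' {𝒥'},
      c N = c N₀ + ((N : ℝ) - N₀) • α := by
    intro N hN
    rw [← sub_eq_zero]
    refine comb_injOn_support hk hn h𝒥' (fun J hJ => ?_) ?_
    · by_contra hJ'
      have e1 : c N J = 0 := by by_contra h; exact hJ' (hmem N hN J h)
      have e0 : c N₀ J = 0 := by by_contra h; exact hJ' (hmem N₀ hN₀ J h)
      have e2 : α J = 0 := by by_contra h; exact hJ' (hαs J h)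
      exact hJ (by simp [e1, e0, e2])
    · simp only [map_sub, map_add, map_smul, hα, hcz]
      module
  have hα0 : ∀ J, 0 ≤ α J := by
    intro J
    by_contra! hneg
    obtain ⟨M, hM⟩ := exists_nat_gt ((N₀ : ℝ) + c N₀ J / (-α J))
    obtain ⟨N, hN, hMN⟩ := hinf.exists_gt M
    have h1 := congrFun (haff N hN) J
    have h2 := (hc N).1 J
    rw [h1, Pi.add_apply, Pi.smul_apply, smul_eq_mul] at h2
    have h3 : (M : ℝ) < N := by exact_mod_cast hMN
    have h4 : c N₀ J / (-α J) < (N : ℝ) - N₀ := by linarith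
    rw [div_lt_iff₀ (by linarith)] at h4
    linarith
  have heq := (IsRep.of_mem_NC h𝒥' hα0 hαs).eq_of_comb_eq hk hn
    (IsRep.of_mem_NC h𝒥 (ind_nonneg 𝒥) fun J hJ => ind_ne_zero hJ) hα
  have hsub : 𝒥' ⊆ 𝒥 := hmax 𝒥' h𝒥' fun J hJ => hαs J (by rw [heq]; simp [ind, hJ])
  refine ⟨c N₀ - (N₀ : ℝ) • α, fun J hJ => hsub ?_, ?_⟩
  · by_contra hJ'
    have e0 : c N₀ J = 0 := by by_contra h; exact hJ' (hmem N₀ hN₀ J h)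
    have e2 : α J = 0 := by by_contra h; exact hJ' (hαs J h)
    exact hJ (by simp [e0, e2])
  · simp only [map_sub, map_smul, hα, hcz]
    module

/-- Adding a large integer multiple of `ind 𝒥` makes `β` a nonnegative representation of a lattice
point; such a point also has an integral representation, and the two coincide. -/
theorem exists_int_of_comb_eq (hk : 0 < k) (hn : k < n) {𝒥 : Finset (KSubset k n)}
    (h𝒥 : 𝒥 ∈ NC k n) {β : KSubset k n → ℝ} (hβ : ∀ J, β J ≠ 0 → J ∈ 𝒥)
    {a : Grid k n} (ha : ∀ q, ∃ z : ℤ, (z : ℝ) = a q) (h : comb β = fsum a) (J : KSubset k n) :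
    ∃ z : ℤ, (z : ℝ) = β J := by
  classical
  obtain ⟨N, hN⟩ := exists_nat_gt (∑ J, |β J|)
  have hrep : IsRep (β + (N : ℝ) • ind 𝒥) := by
    refine IsRep.of_mem_NC h𝒥 (fun J => ?_) fun J hJ => ?_
    · by_cases hJ : J ∈ 𝒥
      · have h1 : |β J| ≤ ∑ J, |β J| :=
          Finset.single_le_sum (f := fun J => |β J|) (fun _ _ => abs_nonneg _) (Finset.mem_univ J)
        have h2 := neg_abs_le (β J)
        simp only [Pi.add_apply, Pi.smul_apply, ind, if_pos hJ, smul_eq_mul, mul_one]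
        linarith
      · have : β J = 0 := by by_contra h; exact hJ (hβ J h)
        simp [this, ind, hJ]
    · by_contra hJ'
      have : β J = 0 := by by_contra h; exact hJ' (hβ J h)
      exact hJ (by simp [this, ind, hJ'])
  have hInt : ∀ p, ∃ z : ℤ, (z : ℝ) = filtComb (ind 𝒥) p := by
    intro p
    choose Z hZ using fun J : KSubset k n => exists_int_filt J p
    refine ⟨∑ J, (if J ∈ 𝒥 then 1 else 0) * Z J, ?_⟩
    rw [filtComb_apply]
    push_cast
    refine Finset.sum_congr rfl fun J _ => ?_
    rw [hZ]; rfl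
  obtain ⟨c, hc, hcz, hce⟩ := exists_int_isRep hk hn (a + (N : ℝ) • rowDiff (filtComb (ind 𝒥)))
    fun q => by
      obtain ⟨x, hx⟩ := ha q
      obtain ⟨y, hy⟩ := exists_int_rowDiff hInt q
      refine ⟨x + N * y, ?_⟩
      push_cast
      rw [hx, hy]; rfl
  have heq := hc.eq_of_comb_eq hk hn hrep (by
    rw [hce, map_add, map_add, map_smul, map_smul, h, comb_eq (ind 𝒥)])
  obtain ⟨x, hx⟩ := hcz J
  by_cases hJ : J ∈ 𝒥
  · refine ⟨x - N, ?_⟩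
    push_cast
    rw [hx, heq]
    simp [ind, hJ]
  · refine ⟨0, ?_⟩
    by_contra h
    exact hJ (hβ J fun h' => h (by rw [h']; simp))

/-- The vectors of `𝒥` form a lattice basis by the two preceding lemmas, so the coefficient map is
unimodular and carries the standard simplex onto this one. -/
theorem relVolume_convexHull_of_maximal (hk : 0 < k) (hn : k < n) {𝒥 : Finset (KSubset k n)}
    (h𝒥 : 𝒥 ∈ NC k n) (hmax : ∀ 𝒥' ∈ NC k n, 𝒥 ⊆ 𝒥' → 𝒥' ⊆ 𝒥) :
    relVolume (convexHull ℝ ((insert 0 (𝒥.image v) : Finset (Grid k n)) : Set (Grid k n))) =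
      1 / (((k - 1) * (n - k - 1)) ! : ℝ≥0∞) := by
  classical
  let A : (𝒥 → ℝ) →ₗ[ℝ] (Fin (k - 1) × Fin (n - k - 1) → ℝ) :=
    Fintype.linearCombination ℝ fun J : 𝒥 => coordY hn (filt J.1)
  let ext : (𝒥 → ℝ) → KSubset k n → ℝ := fun c J => if h : J ∈ 𝒥 then c ⟨J, h⟩ else 0
  have hext : ∀ c J, ext c J ≠ 0 → J ∈ 𝒥 := by
    intro c J hJ
    by_contra h
    exact hJ (dif_neg h)
  have hext_sum : ∀ {M : Type} [AddCommGroup M] [Module ℝ M] (c : 𝒥 → ℝ) (g : KSubset k n → M),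
      ∑ J, ext c J • g J = ∑ J : 𝒥, c J • g J := by
    intro M _ _ c g
    rw [← Finset.sum_subset (Finset.subset_univ 𝒥), ← Finset.sum_coe_sort 𝒥]
    · exact Finset.sum_congr rfl fun J _ => by simp [ext]
    · intro J _ hJ
      rw [show ext c J = 0 from dif_neg hJ, zero_smul]
  have hSA : ∀ c, rootSum (A c) = comb (ext c) := by
    intro c
    rw [comb_def, hext_sum, Fintype.linearCombination_apply, map_sum]
    exact Finset.sum_congr rfl fun J _ => by rw [map_smul, ← v_eq_rootSum]
  have hinj : Function.Injective A := by
    intro c c' h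
    have h1 : comb (ext c - ext c') = 0 := by rw [map_sub, ← hSA, ← hSA, h, sub_self]
    have h2 := comb_injOn_support hk hn h𝒥 (fun J hJ => by
      by_contra hJ'
      exact hJ (by simp [ext, hJ'])) h1
    funext J
    have := congrFun h2 J.1
    simpa [ext, sub_eq_zero] using this
  have hsol : ∀ x β, (∀ J, β J ≠ 0 → J ∈ 𝒥) → comb β = rootSum x →
      A (fun J => β J.1) = x := by
    intro x β hβ hβx
    apply rootSum_injective hn
    rw [hSA, ← hβx]
    congr 1
    funext J
    by_cases hJ : J ∈ 𝒥
    · simp [ext, hJ]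
    · have : β J = 0 := by by_contra h; exact hJ (hβ J h)
      simp [ext, hJ, this]
  have hsurj : Function.Surjective A := by
    intro x
    obtain ⟨β, hβ, hβx⟩ := exists_comb_of_maximal hk hn h𝒥 hmax (rootSum_mem_rowZero x)
    exact ⟨_, hsol x β hβ hβx⟩
  let A' := LinearEquiv.ofBijective A ⟨hinj, hsurj⟩
  have hcard : Fintype.card 𝒥 = Fintype.card (Fin (k - 1) × Fin (n - k - 1)) := by
    have := A'.finrank_eq
    rwa [Module.finrank_fintype_fun_eq_card, Module.finrank_fintype_fun_eq_card] at this
  have hmp : MeasurePreserving A volume volume := by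
    refine measurePreserving_of_int A A'.symm.toLinearMap ?_ hcard (fun J q => ?_) fun q J => ?_
    · ext x; exact congrFun (A'.symm_apply_apply _) _
    · have : A (Pi.single J 1) = coordY hn (filt J.1) := by simp [A]
      rw [this]
      exact exists_int_coordY hn (exists_int_filt _) q
    · obtain ⟨β, hβ, hβx⟩ := exists_comb_of_maximal hk hn h𝒥 hmax
        (rootSum_mem_rowZero (Pi.single q 1))
      have h1 : A'.symm (Pi.single q 1) = fun J => β J.1 := by
        rw [LinearEquiv.symm_apply_eq]
        exact (hsol _ β hβ hβx).symm
      rw [LinearEquiv.coe_coe, h1]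
      refine exists_int_of_comb_eq hk hn h𝒥 hβ (a := extendCol (Pi.single q 1)) (fun p => ?_)
        (by rw [hβx, rootSum_eq_fsum]) J.1
      unfold extendCol
      split_ifs with h
      · rw [Pi.single_apply]
        split_ifs
        exacts [⟨1, by simp⟩, ⟨0, by simp⟩]
      · exact ⟨0, by simp⟩
  set H := convexHull ℝ ((insert 0 (𝒥.image v) : Finset (Grid k n)) : Set (Grid k n)) with hH
  have hclosed : IsClosed H := (Finset.finite_toSet _).isCompact_convexHull (𝕜 := ℝ) |>.isClosed
  have hrel : relVolume H = volume {x | rootSum x ∈ H} := by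
    simp only [relVolume, rootSum_def]
  have hmeas : MeasurableSet {x : Fin (k - 1) × Fin (n - k - 1) → ℝ | (rootSum x : Grid k n) ∈ H} :=
    (hclosed.preimage (LinearMap.continuous_on_pi rootSum)).measurableSet
  have hpre : A ⁻¹' {x | rootSum x ∈ H} = {c | (∀ J, 0 ≤ c J) ∧ ∑ J, c J ≤ 1} := by
    ext c
    have hs : ∑ J, ext c J = ∑ J, c J := by simpa using hext_sum c fun _ => (1 : ℝ)
    rw [Set.mem_preimage, Set.mem_ofPred_eq, hSA, Set.mem_ofPred_eq, ← hs]
    constructor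
    · intro hm
      obtain ⟨w, w0, -, -, -, p0, p1, p2, p3⟩ :=
        exists_weight_of_mem_convexHull hk hn h𝒥 subset_rfl hm
      have h1 : ext c - pull w = 0 := by
        refine comb_injOn_support hk hn h𝒥 (fun J hJ => ?_) (by rw [map_sub, p2, sub_self])
        by_contra hJ'
        have e : pull w J = 0 := by by_contra h; exact hJ' (p1 J h)
        exact hJ (by simp [ext, hJ', e])
      rw [sub_eq_zero] at h1
      refine ⟨fun J => ?_, ?_⟩
      · have := p0 J.1
        rw [← h1] at this
        simpa [ext] using this
      · rw [h1]
        have := w0 0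
        linarith
    · rintro ⟨h0, h1⟩
      refine comb_mem_of_convex (convex_convexHull ℝ _) (subset_convexHull ℝ _ (by simp))
        (fun J => ?_) (fun J hJ => subset_convexHull ℝ _ ?_) h1
      · simp only [ext]; split_ifs
        exacts [h0 _, le_rfl]
      · rw [Finset.mem_coe]
        exact Finset.mem_insert_of_mem (Finset.mem_image_of_mem _ (hext c J hJ))
  rw [hrel, ← hmp.measure_preimage hmeas.nullMeasurableSet, hpre, volume_simplex, hcard,
    Fintype.card_prod, Fintype.card_fin, Fintype.card_fin]

theorem isUnimodular_ncComplex (hk : 0 < k) (hn : k < n) : IsUnimodular (ncComplex hk hn) := by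
  constructor
  · rintro x ⟨-, 𝒥, h𝒥, hsub⟩
    rcases Finset.mem_insert.1 (hsub (Finset.mem_singleton_self x)) with h | h
    · rw [h]; exact Submodule.zero_mem _
    · obtain ⟨J, -, rfl⟩ := Finset.mem_image.1 h
      exact v_mem_rootLattice hn J
  · intro s hs
    rw [Geometry.SimplicialComplex.mem_facets] at hs
    obtain ⟨⟨-, 𝒥, h𝒥, hsub⟩, hfacet⟩ := hs
    have hface : ∀ 𝒥' ∈ NC k n, insert 0 (𝒥'.image v) ∈ (ncComplex hk hn).faces :=
      fun 𝒥' h => ⟨Finset.insert_nonempty _ _, 𝒥', h, subset_rfl⟩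
    -- A facet contains `0` and all `v J` with `J ∈ 𝒥`; any larger collection would give a larger
    -- face, so `𝒥` is maximal.
    have hs := hfacet _ (hface 𝒥 h𝒥) hsub
    rw [hs]
    refine relVolume_convexHull_of_maximal hk hn h𝒥 fun 𝒥' h𝒥' h => ?_
    have h1 := hfacet _ (hface 𝒥' h𝒥')
      (hsub.trans (Finset.insert_subset_insert _ (Finset.image_subset_image h)))
    rw [hs] at h1
    intro J hJ
    have h2 : v J ∈ insert 0 (𝒥.image v) := by
      rw [h1]; exact Finset.mem_insert_of_mem (Finset.mem_image_of_mem _ hJ)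
    rcases Finset.mem_insert.1 h2 with h3 | h3
    · exact absurd h3 (v_ne_zero hk hn (h𝒥'.1 J hJ))
    · obtain ⟨I, hI, he⟩ := Finset.mem_image.1 h3
      rwa [← v_injOn hk hn (h𝒥.1 I hI) (h𝒥'.1 J hJ) he]

/-! ### The gauge of the root polytope -/

/-- The coefficients of the noncrossing representation of a point. -/
noncomputable def coef (hk : 0 < k) (hn : k < n) (x : Fin (k - 1) × Fin (n - k - 1) → ℝ) :
    KSubset k n → ℝ :=
  (exists_isRep_of_mem_rowZero hk hn (rootSum_mem_rowZero x)).choose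

theorem isRep_coef (hk : 0 < k) (hn : k < n) (x : Fin (k - 1) × Fin (n - k - 1) → ℝ) :
    IsRep (coef hk hn x) :=
  (exists_isRep_of_mem_rowZero hk hn (rootSum_mem_rowZero x)).choose_spec.1

theorem comb_coef (hk : 0 < k) (hn : k < n) (x : Fin (k - 1) × Fin (n - k - 1) → ℝ) :
    comb (coef hk hn x) = rootSum x :=
  (exists_isRep_of_mem_rowZero hk hn (rootSum_mem_rowZero x)).choose_spec.2

theorem IsRep.smul {c : KSubset k n → ℝ} (h : IsRep c) {s : ℝ} (hs : 0 ≤ s) : IsRep (s • c) :=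
  ⟨fun J => mul_nonneg hs (h.1 J), fun J hJ => h.2.1 J (right_ne_zero_of_mul hJ),
    fun I J hI hJ => h.2.2 I J (right_ne_zero_of_mul hI) (right_ne_zero_of_mul hJ)⟩

theorem coef_smul (hk : 0 < k) (hn : k < n) {s : ℝ} (hs : 0 ≤ s)
    (x : Fin (k - 1) × Fin (n - k - 1) → ℝ) : coef hk hn (s • x) = s • coef hk hn x :=
  (isRep_coef hk hn _).eq_of_comb_eq hk hn ((isRep_coef hk hn x).smul hs)
    (by rw [comb_coef, map_smul, map_smul, comb_coef])

/-- The sum of the coefficients of the noncrossing representation. -/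
noncomputable def gauge (hk : 0 < k) (hn : k < n) (x : Fin (k - 1) × Fin (n - k - 1) → ℝ) : ℝ :=
  ∑ J, coef hk hn x J

theorem gauge_nonneg (hk : 0 < k) (hn : k < n) (x : Fin (k - 1) × Fin (n - k - 1) → ℝ) :
    0 ≤ gauge hk hn x := Finset.sum_nonneg fun J _ => (isRep_coef hk hn x).1 J

theorem gauge_smul (hk : 0 < k) (hn : k < n) {s : ℝ} (hs : 0 ≤ s)
    (x : Fin (k - 1) × Fin (n - k - 1) → ℝ) : gauge hk hn (s • x) = s * gauge hk hn x := by
  simp [gauge, coef_smul hk hn hs, Finset.mul_sum]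

theorem gauge_le_one_iff (hk : 2 ≤ k) (hn : k + 2 ≤ n)
    (x : Fin (k - 1) × Fin (n - k - 1) → ℝ) :
    gauge (k := k) (n := n) (by omega) (by omega) x ≤ 1 ↔ rootSum x ∈ rootPolytope k n := by
  rw [mem_rootPolytope_iff hk hn]
  constructor
  · intro h
    exact ⟨_, isRep_coef _ _ x, comb_coef _ _ x, h⟩
  · rintro ⟨c, hc, hcx, h1⟩
    have : c = coef (by omega) (by omega) x :=
      hc.eq_of_comb_eq (by omega) (by omega) (isRep_coef _ _ x) (by rw [hcx, comb_coef])
    rwa [gauge, ← this]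

theorem gauge_eq_zero_iff (hk : 0 < k) (hn : k < n) (x : Fin (k - 1) × Fin (n - k - 1) → ℝ) :
    gauge hk hn x ≤ 0 ↔ x = 0 := by
  constructor
  · intro h
    have h0 : gauge hk hn x = 0 := le_antisymm h (gauge_nonneg hk hn x)
    have h1 : coef hk hn x = 0 := by
      funext J
      exact (Finset.sum_eq_zero_iff_of_nonneg fun J _ => (isRep_coef hk hn x).1 J).1 h0 J
        (Finset.mem_univ J)
    apply rootSum_injective hn
    rw [← comb_coef hk hn, h1, map_zero, map_zero]
  · rintro rfl
    have := gauge_smul hk hn (s := 0) le_rfl 0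
    rw [zero_smul, zero_mul] at this
    exact this.le

theorem isClosed_rootPolytope : IsClosed (rootPolytope k n) :=
  ((Set.toFinite _).isCompact_convexHull (𝕜 := ℝ)).isClosed

theorem measurable_gauge (hk : 2 ≤ k) (hn : k + 2 ≤ n) :
    Measurable (gauge (k := k) (n := n) (by omega) (by omega)) := by
  refine measurable_of_Iic fun t => ?_
  rcases lt_trichotomy t 0 with ht | rfl | ht
  · convert! MeasurableSet.empty using 1
    ext x
    have := gauge_nonneg (k := k) (n := n) (by omega) (by omega) x
    simp only [Set.mem_preimage, Set.mem_Iic, Set.mem_empty_iff_false, iff_false]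
    linarith
  · convert! measurableSet_singleton (0 : Fin (k - 1) × Fin (n - k - 1) → ℝ) using 1
    ext x
    exact gauge_eq_zero_iff _ _ x
  -- By homogeneity, the sublevel sets at positive levels are dilates of the closed root polytope.
  · have : gauge (k := k) (n := n) (by omega) (by omega) ⁻¹' Set.Iic t =
        (fun x => rootSum (t⁻¹ • x)) ⁻¹' rootPolytope k n := by
      ext x
      rw [Set.mem_preimage, Set.mem_preimage, ← gauge_le_one_iff hk hn,
        gauge_smul _ _ (inv_nonneg.2 ht.le), inv_mul_le_iff₀ ht, mul_one]
      rfl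
    rw [this]
    refine (isClosed_rootPolytope.preimage ?_).measurableSet
    exact (LinearMap.continuous_on_pi rootSum).comp (continuous_const_smul _)

theorem normalizedVolume_eq_lintegral (hk : 2 ≤ k) (hn : k + 2 ≤ n) :
    normalizedVolume (rootPolytope k n) =
      ∫⁻ x, ENNReal.ofReal (Real.exp (-gauge (k := k) (n := n) (by omega) (by omega) x)) := by
  have := lintegral_exp_neg_eq_factorial_mul MeasurableSet.univ (measurable_gauge hk hn)
    (fun _ _ _ _ => trivial) (fun s hs x _ => gauge_smul _ _ hs.le x)
    (fun x _ => gauge_nonneg _ _ x)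
  rw [Measure.restrict_univ] at this
  rw [this, normalizedVolume, relVolume, Fintype.card_prod, Fintype.card_fin, Fintype.card_fin]
  congr 2
  ext x
  simp only [Set.mem_ofPred_eq, Set.mem_univ, true_and]
  rw [gauge_le_one_iff hk hn, rootSum_def]

/-! ### The cone of monotone arrays -/

/-- The nonnegative arrays that decrease along columns and increase along rows. -/
def cone (k n : ℕ) : Set (Arr k n) :=
  {F | (∀ p, 0 ≤ F p) ∧ ∀ p p' : Fin k × Fin (n - k), p'.1 ≤ p.1 → p.2 ≤ p'.2 → F p ≤ F p'}

theorem cone_add {F F' : Arr k n} (h : F ∈ cone k n) (h' : F' ∈ cone k n) : F + F' ∈ cone k n :=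
  ⟨fun p => add_nonneg (h.1 p) (h'.1 p),
    fun p p' h1 h2 => add_le_add (h.2 p p' h1 h2) (h'.2 p p' h1 h2)⟩

theorem cone_smul {F : Arr k n} (h : F ∈ cone k n) {s : ℝ} (hs : 0 ≤ s) : s • F ∈ cone k n :=
  ⟨fun p => mul_nonneg hs (h.1 p),
    fun p p' h1 h2 => mul_le_mul_of_nonneg_left (h.2 p p' h1 h2) hs⟩

theorem zero_mem_cone : (0 : Arr k n) ∈ cone k n := ⟨fun _ => le_rfl, fun _ _ _ _ => le_rfl⟩

theorem filt_mem_cone (J : KSubset k n) : filt J ∈ cone k n := by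
  constructor
  · intro p; unfold filt; split_ifs <;> norm_num
  · intro p p' h1 h2
    have := el_add_le J (a := p'.1) (b := p.1) h1 p.1.2
    rw [Fin.le_def] at h1 h2
    unfold filt
    split_ifs with c1 c2
    · exact le_rfl
    · omega
    · norm_num
    · exact le_rfl

theorem filtComb_mem_cone {c : KSubset k n → ℝ} (hc : ∀ J, 0 ≤ c J) : filtComb c ∈ cone k n := by
  rw [filtComb_def]
  exact Finset.sum_induction _ (· ∈ cone k n) (fun _ _ => cone_add) zero_mem_cone
    fun J _ => cone_smul (filt_mem_cone J) (hc J)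

/-- In row `l` the support starts at a first column `u l`, and monotonicity makes `u` weakly
increasing; the set has the elements `u l + l`. -/
theorem exists_filt_eq_support (hkn : k ≤ n) {F : Arr k n} (hF : F ∈ cone k n) :
    ∃ J : KSubset k n, ∀ p, filt J p = if F p = 0 then 0 else 1 := by
  classical
  have hex : ∀ l : Fin k, ∃ c, ∀ h : c < n - k, F (l, ⟨c, h⟩) ≠ 0 :=
    fun l => ⟨n - k, fun h => absurd h (lt_irrefl _)⟩
  let u : ℕ → ℕ := fun l => if h : l < k then Nat.find (hex ⟨l, h⟩) else 0
  have hu : ∀ l (h : l < k), u l = Nat.find (hex ⟨l, h⟩) := fun l h => dif_pos h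
  have hum : ∀ l (h : l < k), u l ≤ n - k := by
    intro l h
    rw [hu l h]
    exact Nat.find_min' _ fun h => absurd h (lt_irrefl _)
  have hmono : ∀ l, l + 1 < k → u l ≤ u (l + 1) := by
    intro l h
    rw [hu l (by omega)]
    refine Nat.find_min' _ fun hc => ?_
    have h1 := Nat.find_spec (hex ⟨l + 1, h⟩)
    rw [← hu (l + 1) h] at h1
    have h2 := hF.2 (⟨l + 1, h⟩, ⟨u (l + 1), hc⟩) (⟨l, by omega⟩, ⟨u (l + 1), hc⟩)
      (Fin.le_def.2 (Nat.le_succ l)) le_rfl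
    have h3 := lt_of_le_of_ne (hF.1 _) (h1 hc).symm
    exact (h3.trans_le h2).ne'
  obtain ⟨J, hJ⟩ := exists_el (k := k) (n := n) (fun l => u l + l)
    (fun l hl => by have := hmono l hl; omega) (fun l hl => by have := hum l hl; omega)
  refine ⟨J, fun p => ?_⟩
  have hiff : el J p.1 ≤ p.2 + p.1 ↔ F p ≠ 0 := by
    rw [hJ _ p.1.2, add_le_add_iff_right]
    constructor
    · intro h
      have h1 := Nat.find_spec (hex p.1)
      rw [← hu p.1 p.1.2] at h1
      have hlt : u p.1 < n - k := lt_of_le_of_lt h p.2.2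
      have h3 := lt_of_le_of_ne (hF.1 _) (h1 hlt).symm
      exact (h3.trans_le (hF.2 _ p le_rfl (Fin.le_def.2 h))).ne'
    · intro h
      rw [hu p.1 p.1.2]
      exact Nat.find_min' _ fun _ => h
  unfold filt
  by_cases h : F p = 0
  · rw [if_pos h, if_neg (by rw [hiff]; exact not_not.2 h)]
  · rw [if_neg h, if_pos (hiff.2 h)]

/-- Subtracting the least nonzero value times the filter of the support stays in the cone and
shrinks the support, so induction on its size applies. -/
theorem exists_filtComb_eq (hkn : k ≤ n) {F : Arr k n} (hF : F ∈ cone k n) :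
    ∃ c : KSubset k n → ℝ, (∀ J, 0 ≤ c J) ∧ filtComb c = F := by
  classical
  induction hs : (Finset.univ.filter fun p => F p ≠ 0).card using Nat.strong_induction_on
    generalizing F with
  | _ s ih =>
    subst hs
    by_cases hne : (Finset.univ.filter fun p => F p ≠ 0).Nonempty
    · obtain ⟨p₀, hp₀, hmin⟩ := Finset.exists_min_image _ F hne
      obtain ⟨J, hJ⟩ := exists_filt_eq_support hkn hF
      have hp₀' : F p₀ ≠ 0 := (Finset.mem_filter.1 hp₀).2
      have hval : ∀ p, (F - F p₀ • filt J) p = if F p = 0 then 0 else F p - F p₀ := by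
        intro p
        simp only [Pi.sub_apply, Pi.smul_apply, hJ, smul_eq_mul]
        split_ifs with h <;> simp [h]
      have hle : ∀ p, F p ≠ 0 → F p₀ ≤ F p := fun p hp => hmin p (by simpa using hp)
      have hnn : ∀ p, 0 ≤ (F - F p₀ • filt J) p := by
        intro p
        rw [hval]
        split_ifs with h
        · exact le_rfl
        · exact sub_nonneg.2 (hle p h)
      have hcone : F - F p₀ • filt J ∈ cone k n := by
        refine ⟨hnn, fun p p' h1 h2 => ?_⟩
        by_cases h : F p = 0
        · rw [hval p, if_pos h]; exact hnn p'
        · have h3 := hF.2 p p' h1 h2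
          have h4 := lt_of_le_of_ne (hF.1 p) (Ne.symm h)
          rw [hval, hval, if_neg h, if_neg (h4.trans_le h3).ne']
          linarith
      obtain ⟨c, hc0, hc⟩ := ih _ (Finset.card_lt_card (by
        rw [Finset.ssubset_iff_of_subset]
        · refine ⟨p₀, hp₀, ?_⟩
          simp [hval]
        · intro p hp
          rw [Finset.mem_filter] at hp ⊢
          refine ⟨hp.1, fun h => hp.2 ?_⟩
          rw [hval, if_pos h])) hcone rfl
      refine ⟨c + F p₀ • Pi.single J 1, fun K => add_nonneg (hc0 K) (mul_nonneg (hF.1 _) ?_), ?_⟩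
      · rw [Pi.single_apply]; split_ifs <;> norm_num
      · have : filtComb (Pi.single J (1 : ℝ)) = filt J := by simp [filtComb]
        rw [map_add, map_smul, this, hc, sub_add_cancel]
    · refine ⟨0, fun _ => le_rfl, ?_⟩
      rw [map_zero]
      funext p
      by_contra h
      exact hne ⟨p, by simpa using Ne.symm h⟩

theorem measurableSet_cone : MeasurableSet (cone k n) := by
  unfold cone
  simp only [Set.ofPred_and, Set.ofPred_forall]
  refine MeasurableSet.inter ?_ ?_
  · exact MeasurableSet.iInter fun p => measurableSet_le measurable_const (measurable_pi_apply p)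
  · exact MeasurableSet.iInter fun p => MeasurableSet.iInter fun p' => MeasurableSet.iInter fun _ =>
      MeasurableSet.iInter fun _ => measurableSet_le (measurable_pi_apply p) (measurable_pi_apply p')

/-! ### The adapted coordinates as a unimodular change of variables -/

/-- The index set of the adapted coordinates. -/
abbrev CoordIndex (k n : ℕ) : Type :=
  (Fin (k - 1) × Fin (n - k - 1)) ⊕ (Fin (k - 1) ⊕ Fin (n - k))

/-- The adapted coordinates as a linear map. -/
noncomputable def coordL (hk : 0 < k) (hn : k < n) : Arr k n →ₗ[ℝ] (CoordIndex k n → ℝ) where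
  toFun F := Sum.elim (coordY hn F) (Sum.elim (coordB hn F) (coordA hk F))
  map_add' F F' := by
    funext i
    rcases i with q | l | c
    · simp only [Sum.elim_inl, Pi.add_apply, coordY, map_add]; ring
    · simp only [Sum.elim_inl, Sum.elim_inr, Pi.add_apply, coordB, map_add]
    · simp only [Sum.elim_inr, Pi.add_apply, coordA]
      split_ifs <;> ring
  map_smul' r F := by
    funext i
    rcases i with q | l | c
    · simp only [Sum.elim_inl, Pi.smul_apply, coordY, map_smul, smul_eq_mul, RingHom.id_apply]; ring
    · simp only [Sum.elim_inl, Sum.elim_inr, Pi.smul_apply, coordB, map_smul, RingHom.id_apply]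
    · simp only [Sum.elim_inr, Pi.smul_apply, coordA, smul_eq_mul, RingHom.id_apply]
      split_ifs <;> ring

/-- Reconstruction of an array from its adapted coordinates as a linear map. -/
noncomputable def reconL : (CoordIndex k n → ℝ) →ₗ[ℝ] Arr k n where
  toFun w := recon (fun q => w (.inl q)) (fun l => w (.inr (.inl l))) (fun c => w (.inr (.inr c)))
  map_add' w w' := by
    funext p
    simp only [recon, Pi.add_apply]
    rw [add_add_add_comm, ← Finset.sum_add_distrib, ← Finset.sum_add_distrib]
    congr 1
    · refine Finset.sum_congr rfl fun l _ => ?_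
      split_ifs <;> ring
    · refine Finset.sum_congr rfl fun l _ => ?_
      split_ifs <;> ring
  map_smul' r w := by
    funext p
    simp only [recon, Pi.smul_apply, smul_eq_mul, RingHom.id_apply, mul_add, Finset.mul_sum]
    congr 1
    · refine Finset.sum_congr rfl fun l _ => ?_
      split_ifs <;> ring
    · refine Finset.sum_congr rfl fun l _ => ?_
      split_ifs <;> ring

theorem reconL_apply (w : CoordIndex k n → ℝ) : reconL w =
    recon (fun q => w (.inl q)) (fun l => w (.inr (.inl l))) (fun c => w (.inr (.inr c))) := rfl

theorem reconL_coordL (hk : 0 < k) (hn : k < n) (F : Arr k n) : reconL (coordL hk hn F) = F :=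
  recon_coord hk hn F

theorem card_coordIndex (hk : 0 < k) (hn : k < n) :
    Fintype.card (Fin k × Fin (n - k)) = Fintype.card (CoordIndex k n) := by
  simp only [Fintype.card_prod, Fintype.card_sum, Fintype.card_fin]
  obtain ⟨a, rfl⟩ : ∃ a, k = a + 1 := ⟨k - 1, by omega⟩
  obtain ⟨b, hb⟩ : ∃ b, n - (a + 1) = b + 1 := ⟨n - (a + 1) - 1, by omega⟩
  rw [hb]
  simp only [Nat.add_sub_cancel]
  ring

theorem coordL_reconL (hk : 0 < k) (hn : k < n) (w : CoordIndex k n → ℝ) :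
    coordL hk hn (reconL w) = w := by
  have hinj : Function.Injective (coordL (k := k) (n := n) hk hn) :=
    Function.LeftInverse.injective (reconL_coordL hk hn)
  have hsurj := (LinearMap.injective_iff_surjective_of_finrank_eq_finrank (by
    rw [Module.finrank_fintype_fun_eq_card, Module.finrank_fintype_fun_eq_card,
      card_coordIndex hk hn])).1 hinj
  obtain ⟨F, rfl⟩ := hsurj w
  rw [reconL_coordL]

theorem measurePreserving_coordL (hk : 0 < k) (hn : k < n) :
    MeasurePreserving (coordL (k := k) (n := n) hk hn) volume volume := by
  have hs : ∀ {ι : Type} [DecidableEq ι] (i j : ι),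
      (Pi.single i (1 : ℝ) : ι → ℝ) j ∈ (Int.castAddHom ℝ).range := by
    intro ι _ i j
    rw [Pi.single_apply]
    split_ifs
    exacts [⟨1, by simp⟩, ⟨0, by simp⟩]
  refine measurePreserving_of_int _ reconL ?_ (card_coordIndex hk hn) (fun p i => ?_)
    fun i p => ?_
  · exact LinearMap.ext fun F => reconL_coordL hk hn F
  · change _ ∈ (Int.castAddHom ℝ).range
    rcases i with q | l | c
    · exact exists_int_coordY hn (fun p' => hs p p') q
    · exact exists_int_rowDiff (fun p' => hs p p') _
    · change coordA hk _ c ∈ _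
      unfold coordA
      refine sub_mem (hs _ _) ?_
      split_ifs
      exacts [zero_mem _, hs _ _]
  · change _ ∈ (Int.castAddHom ℝ).range
    rw [reconL_apply]
    unfold recon
    refine add_mem (sum_mem fun l _ => ?_) (sum_mem fun c _ => ?_)
    · split_ifs
      · exact add_mem (hs _ _) (hs _ _)
      · exact add_mem (zero_mem _) (hs _ _)
      · exact zero_mem _
    · split_ifs
      exacts [hs _ _, zero_mem _]

/-- The corner of the array where monotone arrays are largest. -/
def corner (hk : 0 < k) (hn : k < n) : Fin k × Fin (n - k) := (⟨0, hk⟩, lastCol hn)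

theorem recon_corner (hk : 0 < k) (hn : k < n) (y : Fin (k - 1) × Fin (n - k - 1) → ℝ)
    (b : Fin (k - 1) → ℝ) (a : Fin (n - k) → ℝ) :
    recon y b a (corner hk hn) = ∑ l, b l + ∑ c, a c := by
  unfold recon corner lastCol
  congr 1
  · refine Finset.sum_congr rfl fun l _ => ?_
    simp
  · refine Finset.sum_congr rfl fun c _ => if_pos ?_
    rw [Fin.le_def]; simp only; omega

theorem coordB_nonneg (hn : k < n) {F : Arr k n} (hF : F ∈ cone k n) (l : Fin (k - 1)) :
    0 ≤ coordB hn F l :=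
  sub_nonneg.2 (hF.2 _ _ (Fin.le_def.2 (Nat.le_succ _)) le_rfl)

theorem coordA_nonneg (hk : 0 < k) {F : Arr k n} (hF : F ∈ cone k n) (c : Fin (n - k)) :
    0 ≤ coordA hk F c := by
  unfold coordA
  split_ifs
  · rw [sub_zero]; exact hF.1 _
  · exact sub_nonneg.2 (hF.2 _ _ le_rfl (Fin.le_def.2 (Nat.sub_le _ _)))

theorem recon_mem_cone {b : Fin (k - 1) → ℝ} {a : Fin (n - k) → ℝ} (hb : ∀ l, 0 ≤ b l)
    (ha : ∀ c, 0 ≤ a c) : recon 0 b a ∈ cone k n := by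
  have hval : ∀ p, recon 0 b a p = (∑ l : Fin (k - 1), if (p.1 : ℕ) ≤ l then b l else 0) +
      ∑ c : Fin (n - k), if c ≤ p.2 then a c else 0 := by
    intro p; simp [recon]
  constructor
  · intro p
    rw [hval]
    refine add_nonneg (Finset.sum_nonneg fun l _ => ?_) (Finset.sum_nonneg fun c _ => ?_)
    · split_ifs; exacts [hb l, le_rfl]
    · split_ifs; exacts [ha c, le_rfl]
  · intro p p' h1 h2
    rw [hval, hval]
    refine add_le_add (Finset.sum_le_sum fun l _ => ?_) (Finset.sum_le_sum fun c _ => ?_)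
    · rw [Fin.le_def] at h1
      split_ifs
      exacts [le_rfl, by omega, hb l, le_rfl]
    · split_ifs with c1 c2
      exacts [le_rfl, absurd (c1.trans h2) c2, ha c, le_rfl]

/-- The array with the coefficients of the noncrossing representation of `x`. -/
noncomputable def lift (hk : 0 < k) (hn : k < n) (x : Fin (k - 1) × Fin (n - k - 1) → ℝ) :
    Arr k n := filtComb (coef hk hn x)

theorem coordY_lift (hk : 0 < k) (hn : k < n) (x : Fin (k - 1) × Fin (n - k - 1) → ℝ) :
    coordY hn (lift hk hn x) = x := by
  apply rootSum_injective hn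
  rw [lift, ← comb_eq_rootSum, comb_coef]

theorem lift_corner (hk : 0 < k) (hn : k < n) (x : Fin (k - 1) × Fin (n - k - 1) → ℝ) :
    lift hk hn x (corner hk hn) = gauge hk hn x := by
  rw [lift, filtComb_apply, gauge]
  refine Finset.sum_congr rfl fun J _ => ?_
  by_cases h : coef hk hn x J = 0
  · rw [h, zero_mul]
  · have h1 := el_zero_lt_of_nonfrozen ((isRep_coef hk hn x).2.1 J h) hn.le
    have h2 : filt J (corner hk hn) = 1 := by
      unfold filt corner lastCol
      exact if_pos (by simp only; omega)
    rw [h2, mul_one]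

/-- For fixed coordinates modulo the frozen subsets, the cone is a translated orthant. -/
theorem mem_cone_iff (hk : 0 < k) (hn : k < n) (F : Arr k n) :
    F ∈ cone k n ↔
      (∀ l, coordB hn (lift hk hn (coordY hn F)) l ≤ coordB hn F l) ∧
        ∀ c, coordA hk (lift hk hn (coordY hn F)) c ≤ coordA hk F c := by
  set x := coordY hn F with hx
  have hlin := (coordL hk hn).map_sub F (lift hk hn x)
  have hB : ∀ l, coordB hn (F - lift hk hn x) l = coordB hn F l - coordB hn (lift hk hn x) l :=
    fun l => congrFun hlin (.inr (.inl l))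
  have hA : ∀ c, coordA hk (F - lift hk hn x) c = coordA hk F c - coordA hk (lift hk hn x) c :=
    fun c => congrFun hlin (.inr (.inr c))
  have hY : coordY hn (F - lift hk hn x) = 0 := by
    funext q
    have := congrFun hlin (.inl q)
    change coordY hn (F - lift hk hn x) q = coordY hn F q - coordY hn (lift hk hn x) q at this
    rw [this, coordY_lift, hx, sub_self]; rfl
  constructor
  · intro hF
    obtain ⟨c, hc0, hc⟩ := exists_filtComb_eq hn.le hF
    obtain ⟨c', hc0', -, hnc, hm⟩ := exists_ncSupport ⊤ isClosed_univ hk c hc0 fun _ => trivial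
    have hcF : filtComb c' = F := hm.filtComb_eq.trans hc
    -- The nonfrozen part of a noncrossing decomposition of `F` depends only on `x`. So `F - lift x`
    -- is the frozen part, a nonnegative combination of filters, and its `coordB` and `coordA`
    -- coordinates are nonnegative.
    have hpart : nonfrozenPart c' = coef hk hn x := by
      refine (isRep_nonfrozenPart hc0' hnc).eq_of_comb_eq hk hn (isRep_coef hk hn x) ?_
      rw [comb_nonfrozenPart hn, comb_eq_rootSum hn, hcF, comb_coef]
    have hdiff : F - lift hk hn x ∈ cone k n := by
      rw [lift, ← hpart, ← hcF, ← map_sub]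
      exact filtComb_mem_cone fun J => sub_nonneg.2 (nonfrozenPart_le hc0' J)
    refine ⟨fun l => ?_, fun c => ?_⟩
    · have := coordB_nonneg hn hdiff l
      rw [hB] at this; linarith
    · have := coordA_nonneg hk hdiff c
      rw [hA] at this; linarith
  · rintro ⟨h1, h2⟩
    -- Conversely the difference has zero `coordY` and nonnegative remaining coordinates, so it lies
    -- in the cone, and adding `lift x` stays there.
    have hdiff : F - lift hk hn x ∈ cone k n := by
      rw [← recon_coord hk hn (F - lift hk hn x), hY]
      refine recon_mem_cone (fun l => ?_) fun c => ?_
      · rw [hB]; linarith [h1 l]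
      · rw [hA]; linarith [h2 c]
    have := cone_add hdiff (filtComb_mem_cone (isRep_coef hk hn x).1)
    rwa [← lift, sub_add_cancel] at this

/-- In the adapted coordinates the corner entry is the sum of the `coordB` and `coordA` coordinates.
By `mem_cone_iff` the slice over `x` is an orthant with apex at those of `lift x`, so it integrates
to `exp` of minus the corner entry of `lift x`, the gauge. -/
theorem lintegral_cone (hk : 0 < k) (hn : k < n) :
    ∫⁻ F in cone k n, ENNReal.ofReal (Real.exp (-F (corner hk hn))) =
      ∫⁻ x, ENNReal.ofReal (Real.exp (-gauge hk hn x)) := by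
  let E := MeasurableEquiv.sumPiEquivProdPi (fun _ : CoordIndex k n => ℝ)
  have hE : MeasurePreserving E volume volume :=
    volume_measurePreserving_sumPiEquivProdPi (fun _ : CoordIndex k n => ℝ)
  have hmp := hE.comp (measurePreserving_coordL (k := k) (n := n) hk hn)
  let R : (Fin (k - 1) × Fin (n - k - 1) → ℝ) × (Fin (k - 1) ⊕ Fin (n - k) → ℝ) → Arr k n :=
    fun w => reconL (E.symm w)
  have hR : ∀ F, R ((E ∘ coordL hk hn) F) = F := by
    intro F
    simp only [R, Function.comp_apply, MeasurableEquiv.symm_apply_apply, reconL_coordL]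
  have hRm : Measurable R := (LinearMap.continuous_on_pi reconL).measurable.comp E.symm.measurable
  let D := R ⁻¹' cone k n
  have hD : MeasurableSet D := hRm measurableSet_cone
  have hpre : (E ∘ coordL hk hn) ⁻¹' D = cone k n := by
    ext F
    simp only [D, Set.mem_preimage, hR]
  let h : (Fin (k - 1) × Fin (n - k - 1) → ℝ) × (Fin (k - 1) ⊕ Fin (n - k) → ℝ) → ℝ≥0∞ :=
    fun w => ENNReal.ofReal (Real.exp (-∑ i, w.2 i))
  have hh : Measurable h := by fun_prop
  have e1 : ∫⁻ F in cone k n, ENNReal.ofReal (Real.exp (-F (corner hk hn))) = ∫⁻ w in D, h w := by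
    rw [← hmp.setLIntegral_comp_preimage hD hh, hpre]
    refine lintegral_congr fun F => ?_
    have : F (corner hk hn) = ∑ i, ((E ∘ coordL hk hn) F).2 i := by
      conv_lhs => rw [← recon_coord hk hn F, recon_corner]
      rw [Fintype.sum_sum_type]
      rfl
    simp only [h]
    rw [this]
  rw [e1, ← lintegral_indicator hD]
  change ∫⁻ w, D.indicator h w ∂(volume.prod volume) = _
  rw [lintegral_prod _ (hh.indicator hD).aemeasurable]
  refine lintegral_congr fun x => ?_
  let ρ : Fin (k - 1) ⊕ Fin (n - k) → ℝ :=
    Sum.elim (coordB hn (lift hk hn x)) (coordA hk (lift hk hn x))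
  have hslice : ∀ r, (x, r) ∈ D ↔ ∀ i, ρ i ≤ r i := by
    intro r
    have hc := coordL_reconL hk hn (E.symm (x, r))
    have hY : coordY hn (R (x, r)) = x := funext fun q => congrFun hc (.inl q)
    have hB : coordB hn (R (x, r)) = fun l => r (.inl l) :=
      funext fun l => congrFun hc (.inr (.inl l))
    have hA : coordA hk (R (x, r)) = fun c => r (.inr c) :=
      funext fun c => congrFun hc (.inr (.inr c))
    rw [Set.mem_preimage, mem_cone_iff hk hn, hY, hB, hA, Sum.forall]
    rfl
  have hsum : ∑ i, ρ i = gauge hk hn x := by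
    rw [← lift_corner, ← recon_coord hk hn (lift hk hn x), recon_corner, Fintype.sum_sum_type]
    rfl
  have hset : MeasurableSet {r : Fin (k - 1) ⊕ Fin (n - k) → ℝ | ∀ i, ρ i ≤ r i} := by
    rw [Set.ofPred_forall]
    exact MeasurableSet.iInter fun i => measurableSet_le measurable_const (measurable_pi_apply i)
  rw [← hsum, ← lintegral_exp_neg_sum, ← lintegral_indicator hset]
  refine lintegral_congr fun r => ?_
  by_cases hr : ∀ i, ρ i ≤ r i
  · rw [Set.indicator_of_mem ((hslice r).2 hr),
      Set.indicator_of_mem (show r ∈ {r | ∀ i, ρ i ≤ r i} from hr)]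
  · rw [Set.indicator_of_notMem (fun h' => hr ((hslice r).1 h')),
      Set.indicator_of_notMem (show r ∉ {r | ∀ i, ρ i ≤ r i} from hr)]

/-! ### Standard Young tableaux -/

/-- The order on cells in which the arrays of `cone k n` increase. -/
@[reducible]
def cellOrder (k n : ℕ) : PartialOrder (Fin k × Fin (n - k)) :=
  PartialOrder.lift (fun p => (OrderDual.toDual p.1, p.2)) fun p q h => by
    simpa [Prod.ext_iff] using h

theorem cellOrder_le_iff {p q : Fin k × Fin (n - k)} :
    (cellOrder k n).le p q ↔ q.1 ≤ p.1 ∧ p.2 ≤ q.2 := Iff.rfl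

theorem strictMono_cellOrder_iff {T : Fin k × Fin (n - k) → Fin (k * (n - k))} :
    (∀ p q, (cellOrder k n).lt p q → T p < T q) ↔
      (∀ i, StrictMono fun j => T (Fin.rev i, j)) ∧ ∀ j, StrictMono fun i => T (Fin.rev i, j) := by
  have hlt : ∀ p q : Fin k × Fin (n - k), (cellOrder k n).lt p q ↔
      (q.1 ≤ p.1 ∧ p.2 ≤ q.2) ∧ ¬ (p.1 ≤ q.1 ∧ q.2 ≤ p.2) := fun p q =>
    (cellOrder k n).lt_iff_le_not_ge p q
  simp only [hlt]
  constructor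
  · intro h
    refine ⟨fun i j j' hj => h _ _ ⟨⟨le_rfl, hj.le⟩, fun h' => absurd h'.2 (not_le.2 hj)⟩,
      fun j i i' hi => h _ _ ⟨⟨Fin.rev_le_rev.2 hi.le, le_rfl⟩, fun h' => ?_⟩⟩
    exact absurd (Fin.rev_le_rev.1 h'.1) (not_le.2 hi)
  · rintro ⟨h1, h2⟩ ⟨i, j⟩ ⟨i', j'⟩ ⟨⟨hi, hj⟩, hne⟩
    simp only at hi hj hne
    have e1 : T (i, j) ≤ T (i, j') := by
      have := (h1 (Fin.rev i)).monotone hj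
      simpa using this
    have e2 : T (i, j') ≤ T (i', j') := by
      have := (h2 j').monotone (Fin.rev_le_rev.2 hi)
      simpa using this
    refine lt_of_le_of_ne (e1.trans e2) fun he => ?_
    rcases hj.lt_or_eq with hj' | rfl
    · have := h1 (Fin.rev i) hj'
      simp only [Fin.rev_rev] at this
      exact absurd (this.trans_le e2) (by rw [he]; exact lt_irrefl _)
    · rcases hi.lt_or_eq with hi' | rfl
      · have := h2 j (Fin.rev_lt_rev.2 hi')
        simp only [Fin.rev_rev] at this
        exact absurd this (by rw [he]; exact lt_irrefl _)
      · exact hne ⟨le_rfl, le_rfl⟩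

/-- Cone arrays decrease down the columns, whereas tableaux increase; reversing the row index
matches linear extensions of `cellOrder` with standard Young tableaux. -/
theorem lintegral_cone_eq_multiCatalan (hk : 0 < k) (hn : k < n) :
    ∫⁻ F in cone k n, ENNReal.ofReal (Real.exp (-F (corner hk hn))) = multiCatalan k (n - k) := by
  have hN : 0 < k * (n - k) := Nat.mul_pos hk (by omega)
  have h1 := @lintegral_orderCone (Fin k × Fin (n - k)) (k * (n - k)) _ (cellOrder k n) hN
    finProdFinEquiv (corner hk hn) (fun p => cellOrder_le_iff.2
      ⟨Fin.le_def.2 (Nat.zero_le _), Fin.le_def.2 (by simp only [corner, lastCol]; omega)⟩)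
  have h2 : {F : Arr k n | (∀ p, 0 ≤ F p) ∧
      @Monotone _ _ (cellOrder k n).toPreorder _ F} = cone k n := by
    ext F
    refine and_congr_right fun _ => ⟨fun h p p' a b => h (cellOrder_le_iff.2 ⟨a, b⟩),
      fun h p p' hp => h p p' (cellOrder_le_iff.1 hp).1 (cellOrder_le_iff.1 hp).2⟩
  rw [h2] at h1
  rw [h1, multiCatalan]
  congr 1
  let τ : (Fin k × Fin (n - k)) ≃ (Fin k × Fin (n - k)) :=
    Equiv.prodCongr Fin.revPerm (Equiv.refl _)
  refine Nat.card_congr (Equiv.subtypeEquiv (Equiv.equivCongr τ (Equiv.refl _)) fun T => ?_)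
  have h3 := strictMono_cellOrder_iff (k := k) (n := n) (T := T)
  have hτ : ∀ p : Fin k × Fin (n - k), (Equiv.equivCongr τ (Equiv.refl _) T) p =
      T (Fin.rev p.1, p.2) := fun p => rfl
  simp only [hτ]
  exact h3

/-! ### The dual realization -/

/-- Subtraction of the row averages. -/
noncomputable def center (hn : k < n) : Grid k n →ₗ[ℝ] rowZero k n where
  toFun x := ⟨fun q => x q - (∑ j, x (q.1, j)) / ((n - k : ℕ) : ℝ), fun i => by
    have : ((n - k : ℕ) : ℝ) ≠ 0 := by
      have : n - k ≠ 0 := by omega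
      exact_mod_cast this
    simp only [Finset.sum_sub_distrib, Finset.sum_const, Finset.card_univ, Fintype.card_fin,
      nsmul_eq_mul]
    field_simp
    ring⟩
  map_add' x y := by
    ext q
    simp only [Pi.add_apply, Finset.sum_add_distrib, Submodule.coe_add]
    ring
  map_smul' r x := by
    ext q
    simp only [Pi.smul_apply, smul_eq_mul, ← Finset.mul_sum, Submodule.coe_smul, RingHom.id_apply]
    ring

theorem center_apply (hn : k < n) (x : Grid k n) (q : Fin (k - 1) × Fin (n - k)) :
    (center hn x : Grid k n) q = x q - (∑ j, x (q.1, j)) / ((n - k : ℕ) : ℝ) := rfl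

theorem center_of_mem (hn : k < n) (y : rowZero k n) : center hn (y : Grid k n) = y := by
  ext q
  rw [center_apply, y.2 q.1, zero_div, sub_zero]

/-- The map from linear functions on `rowZero k n` to `rowZero k n` with `α q ↦ f q`. -/
noncomputable def dualMap (hn : k < n) : Module.Dual ℝ (rowZero k n) →ₗ[ℝ] rowZero k n where
  toFun w := ⟨fsum fun q => w (center hn (e q)), fsum_mem_rowZero _⟩
  map_add' w w' := by
    apply Subtype.ext
    exact map_add fsum (fun q => w (center hn (e q))) fun q => w' (center hn (e q))
  map_smul' r w := by
    apply Subtype.ext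
    exact map_smul fsum r fun q => w (center hn (e q))

theorem coe_dualMap (hn : k < n) (w : Module.Dual ℝ (rowZero k n)) :
    (dualMap hn w : Grid k n) = fsum fun q => w (center hn (e q)) := rfl

theorem sum_smul_e (x : Grid k n) : ∑ q, x q • (e q : Grid k n) = x := by
  funext p
  simp [e, Pi.single_apply]

/-- If the image vanishes, `w` takes one value on all centred basis vectors of a row. These sum to
zero, so the value is 0, and the centred basis vectors span `rowZero`. -/
theorem dualMap_injective (hn : k < n) : Function.Injective (dualMap (k := k) (n := n) hn) := by
  rw [← LinearMap.ker_eq_bot, LinearMap.ker_eq_bot']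
  intro w hw
  have hm : ((n - k : ℕ) : ℝ) ≠ 0 := by
    have : n - k ≠ 0 := by omega
    exact_mod_cast this
  have h1 : fsum (fun q => w (center hn (e q))) = 0 := by rw [← coe_dualMap, hw]; rfl
  rw [fsum_eq_zero_iff] at h1
  have h2 : ∀ i, ∑ j, center hn (e (i, j)) = 0 := by
    intro i
    rw [← map_sum]
    ext q
    rw [center_apply]
    simp only [Finset.sum_apply, e, Pi.single_apply, Prod.ext_iff]
    by_cases h : q.1 = i
    · simp [h, hm]
    · simp [h]
  have h3 : ∀ q, w (center hn (e q)) = 0 := by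
    rintro ⟨i, j⟩
    have h4 := congrArg w (h2 i)
    rw [map_sum, map_zero, Finset.sum_congr rfl fun j' _ => h1 i j' j, Finset.sum_const,
      Finset.card_univ, Fintype.card_fin, nsmul_eq_mul] at h4
    exact (mul_eq_zero.1 h4).resolve_left hm
  ext y
  rw [← center_of_mem hn y, ← sum_smul_e (y : Grid k n), map_sum, map_sum]
  simp [h3]

/-- Centring changes the coefficient array of the coordinate function `q` from `Pi.single q 1` by an
array constant along rows, which `fsum` kills. -/
theorem dualMap_proj (hn : k < n) (q : Fin (k - 1) × Fin (n - k)) :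
    (dualMap hn ((LinearMap.proj q : Module.Dual ℝ (Grid k n)).domRestrict (rowZero k n)) :
      Grid k n) = f q := by
  classical
  rw [coe_dualMap]
  have h1 : (f q : Grid k n) = fsum (Pi.single q 1) := by simp [fsum]
  rw [h1, ← sub_eq_zero, ← map_sub, fsum_eq_zero_iff]
  have key : ∀ i j, ((fun p => ((LinearMap.proj q : Module.Dual ℝ (Grid k n)).domRestrict
      (rowZero k n)) (center hn (e p))) - Pi.single q 1 : Grid k n) (i, j) =
        -((if q.1 = i then 1 else 0) / ((n - k : ℕ) : ℝ)) := by
    intro i j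
    simp only [Pi.sub_apply, LinearMap.domRestrict_apply, LinearMap.proj_apply, center_apply, e,
      Pi.single_apply]
    have e1 : (if q = (i, j) then (1 : ℝ) else 0) = if (i, j) = q then 1 else 0 :=
      if_congr eq_comm rfl rfl
    have e2 : (∑ j', if (q.1, j') = (i, j) then (1 : ℝ) else 0) = if q.1 = i then 1 else 0 := by
      simp only [Prod.mk.injEq]
      by_cases h : q.1 = i <;> simp [h]
    rw [e1, e2]; ring
  intro i j j'
  rw [key, key]

theorem dualMap_gamma (hn : k < n) (J : KSubset k n) :
    (dualMap hn ((gamma J).domRestrict (rowZero k n)) : Grid k n) = v J := by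
  have h1 : (gamma J).domRestrict (rowZero k n) = ∑ q ∈ cells J,
      (LinearMap.proj q : Module.Dual ℝ (Grid k n)).domRestrict (rowZero k n) := by
    ext y
    simp [gamma, LinearMap.domRestrict_apply]
  rw [h1, map_sum, Submodule.coe_sum, v]
  exact Finset.sum_congr rfl fun q _ => dualMap_proj hn q

theorem exists_dual_equiv (hn : k < n) : ∃ Φ : Module.Dual ℝ (rowZero k n) ≃ₗ[ℝ] rowZero k n,
    (∀ q : Fin (k - 1) × Fin (n - k),
      (Φ ((LinearMap.proj q : Module.Dual ℝ (Grid k n)).domRestrict (rowZero k n)) : Grid k n)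
        = f q) ∧
    (∀ J : KSubset k n, (Φ ((gamma J).domRestrict (rowZero k n)) : Grid k n) = v J) ∧
    (fun w => (Φ w : Grid k n)) '' dualRootPolytope k n = rootPolytope k n := by
  refine ⟨LinearMap.linearEquivOfInjective (dualMap hn) (dualMap_injective hn)
    Subspace.dual_finrank_eq, fun q => dualMap_proj hn q, fun J => dualMap_gamma hn J, ?_⟩
  change (fun w => ((rowZero k n).subtype ∘ₗ dualMap hn) w) '' convexHull ℝ _ = convexHull ℝ _
  rw [LinearMap.image_convexHull, Set.image_image]
  congr 1
  exact Set.image_congr fun J _ => dualMap_gamma hn J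

end RootPolytope

open RootPolytope in
theorem mainTheorem1 (k n : ℕ) (hk : 2 ≤ k) (hn : k + 2 ≤ n) :
    -- the two realizations of the root polytope correspond under a linear isomorphism
    (∃ Φ : Module.Dual ℝ (rowZero k n) ≃ₗ[ℝ] rowZero k n,
      (∀ q : Fin (k - 1) × Fin (n - k),
        (Φ ((LinearMap.proj q : Module.Dual ℝ (Grid k n)).domRestrict (rowZero k n)) : Grid k n)
          = f q) ∧
      (∀ J : KSubset k n, (Φ ((gamma J).domRestrict (rowZero k n)) : Grid k n) = v J) ∧
      (fun w => (Φ w : Grid k n)) '' dualRootPolytope k n = rootPolytope k n) ∧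
    -- the points `0` and `v_J`, for `J` nonfrozen, are pairwise distinct
    (Set.InjOn v (nonfrozen k n) ∧ ∀ J ∈ nonfrozen k n, v J ≠ 0) ∧
    -- the simplices `conv {0, v_J : J ∈ 𝒥}` and their faces form a flag unimodular triangulation
    (∃ K : Geometry.SimplicialComplex ℝ (Grid k n),
      K.faces = {s | s.Nonempty ∧ ∃ 𝒥 ∈ NC k n, s ⊆ insert 0 (𝒥.image v)} ∧
      K.space = rootPolytope k n ∧
      IsFlag K ∧
      IsUnimodular K) ∧
    normalizedVolume (rootPolytope k n) = (multiCatalan k (n - k) : ℝ≥0∞) := by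
  have hk0 : 0 < k := by omega
  have hkn : k < n := by omega
  refine ⟨exists_dual_equiv hkn, ⟨v_injOn hk0 hkn, fun J hJ => v_ne_zero hk0 hkn hJ⟩,
    ⟨ncComplex hk0 hkn, rfl, space_ncComplex hk hn, isFlag_ncComplex hk0 hkn,
      isUnimodular_ncComplex hk0 hkn⟩, ?_⟩
  rw [normalizedVolume_eq_lintegral hk hn, ← lintegral_cone hk0 hkn,
    lintegral_cone_eq_multiCatalan hk0 hkn]
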